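/- **Setting.** Fix a discount rate $r>0$. Let $F^0,F^1:[0,\infty)\to[-\infty,\infty)$ be concave and upper semi-continuous with $F^0\le F^1$, with unique peaks $u^0>0$ and $u^1\ge 0$ respectively (that is, $F^j(u)<F^j(u^j)$ for every $u\neq u^j$), such that $u^1<u^0$ and $F^0$ is finite on $(0,u^0]$. A supergradient of $F^j$ at a point $u$ of the closure of $\{F^j>-\infty\}$ is an $\eta\in[-\infty,\infty]$ with $F^j(u')\le F^j(u)+\eta(u'-u)$ for every $u'\ne u$ in $[0,\infty)$ (where $-\infty+\infty$ on the right-hand side is read as $\infty$). Let $u^\star$ be the greatest $u\in[0,u^0)$ at which $F^0$ and $F^1$ share a supergradient, and assume that, if $u^\star>0$, then $u^\star$ is a strict local maximum of $F^1-F^0$. A *mechanism* is a pair $(x,X^1)$ of a Lebesgue-measurable $x:[0,\infty)\to[0,\infty)$ and a function $X^1:[0,\infty)\to[0,\infty]$. It is *incentive-compatible (IC)* iff for every $t\ge 0$, $$X^1_t\ \ge\ r\int_t^{t+d}e^{-r(s-t)}x_s\,ds+e^{-rd}X^1_{t+d}\ \text{ for all } d>0,\qquad X^1_t\ \ge\ r\int_t^\infty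 e^{-r(s-t)}x_s\,ds .$$ For a probability distribution (CDF) $G$ of a time $\tau\in[0,\infty)$, its payoff is $$\Pi_G(x,X^1)=\mathbf E_{\tau\sim G}\Big(r\int_0^\tau e^{-rt}F^0(x_t)\,dt+e^{-r\tau}F^1(X^1_\tau)\Big)\in[-\infty,\infty),\qquad F^1(\infty):=-\infty .$$ An IC mechanism is *undominated* iff no IC mechanism has a weakly higher payoff under every distribution and a strictly higher payoff under some distribution. An IC mechanism is *optimal for $G$* iff it maximises $\Pi_G$ among IC mechanisms and is undominated. A *version* of $(x,X^1)$ is a mechanism $(\tilde x,X^1)$ with $\tilde x=x$ Lebesgue-almost everywhere. **Theorem 3.** Let $G$ be a distribution on $[0,\infty)$ with $G(0)=0$ and unbounded support. Then any mechanism $(x,X^1)$ that is optimal for $G$ has a version $(\tilde x,X^1)$ in which $\tilde x$ is (weakly) decreasing, with $$\lim_{t\downarrow 0}\tilde x_t=u^0\qquad\text{and}\qquad \lim_{t\to\infty}\tilde x_t=u^\star .$$ -/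

import Mathlib

open Set Filter Topology MeasureTheory
open scoped ENNReal

noncomputable section

/-- The Lebesgue integral of an extended-real-valued function: integral of the positive part minus
integral of the negative part. Below it is only applied to functions that are bounded above by an
integrable function, so the positive part always has a finite integral. -/
def eintegral {α : Type*} [MeasurableSpace α] (μ : Measure α) (f : α → EReal) : EReal :=
  ((∫⁻ a, (f a).toENNReal ∂μ : ℝ≥0∞) : EReal) - ((∫⁻ a, (-f a).toENNReal ∂μ : ℝ≥0∞) : EReal)

/-- A utility possibility frontier `F : [0,∞) → [-∞,∞)` (only the values of `F` on `[0,∞)` matter):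
concave, upper semi-continuous, with unique peak `p`. -/
structure IsFrontier (F : ℝ → EReal) (p : ℝ) : Prop where
  ne_top : ∀ u, 0 ≤ u → F u ≠ ⊤
  concave : ∀ u v a b : ℝ, 0 ≤ u → 0 ≤ v → 0 ≤ a → 0 ≤ b → a + b = 1 →
    (a : EReal) * F u + (b : EReal) * F v ≤ F (a * u + b * v)
  usc : UpperSemicontinuousOn F (Ici 0)
  peak_nonneg : 0 ≤ p
  peak : ∀ u, 0 ≤ u → u ≠ p → F u < F p

/-- `η ∈ [-∞,∞]` is a supergradient of `F` at a point `u` of the closure of the effective domain: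
`F u' ≤ F u + η (u' - u)` for all `u' ≠ u` in `[0,∞)`. The inequality is written with `F u`
subtracted, so that a `u` with `F u = -∞` admits the supergradient `∞` if it is the left end of the
effective domain, as usual (`-∞ + ∞` counts as `∞` on the right-hand side). -/
def IsSupergradient (F : ℝ → EReal) (u : ℝ) (η : EReal) : Prop :=
  u ∈ closure {v : ℝ | 0 ≤ v ∧ F v ≠ ⊥} ∧
    ∀ u', 0 ≤ u' → u' ≠ u → F u' - F u ≤ η * ((u' - u : ℝ) : EReal)

/-- `F⁰` and `F¹` have equal slopes at `u`: they share a supergradient there. -/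
def EqualSlopes (F₀ F₁ : ℝ → EReal) (u : ℝ) : Prop :=
  ∃ η : EReal, IsSupergradient F₀ u η ∧ IsSupergradient F₁ u η

/-- The model assumptions on the old frontier `F₀` (peak `u₀`) and the new frontier `F₁`
(peak `u₁`), where `us` is the rightmost utility to the left of `u₀` at which the frontiers have
equal slopes. The strict-local-maximum assumption has content only if `us > 0`; it holds
automatically if `us = 0` (where `F₁ - F₀` may be undefined). -/
structure IsTechnology (F₀ F₁ : ℝ → EReal) (u₀ u₁ us : ℝ) : Prop where
  old : IsFrontier F₀ u₀
  new : IsFrontier F₁ u₁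
  old_finite : ∀ u, 0 < u → u ≤ u₀ → F₀ u ≠ ⊥
  old_le_new : ∀ u, 0 ≤ u → F₀ u ≤ F₁ u
  conflict : u₁ < u₀
  ustar : IsGreatest {u : ℝ | 0 ≤ u ∧ u < u₀ ∧ EqualSlopes F₀ F₁ u} us
  strict_max : 0 < us → ∀ᶠ u in 𝓝[≠] us, F₁ u - F₀ u < F₁ us - F₀ us

/-- A mechanism: a Lebesgue-measurable pre-disclosure flow `[0,∞) → [0,∞)` and a disclosure reward
`[0,∞) → [0,∞]` (values at negative times are irrelevant). -/
structure Mechanism where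
  flow : ℝ → ℝ
  reward : ℝ → ℝ≥0∞
  flow_nonneg : ∀ t, 0 ≤ t → 0 ≤ flow t
  flow_meas : AEMeasurable flow (volume.restrict (Ici 0))

namespace Mechanism

/-- The value `r ∫_S e^{-r(s-t)} x⁰_s ds`, discounted to time `t`, of the flow over the times `S`. -/
def flowValue (r : ℝ) (m : Mechanism) (t : ℝ) (S : Set ℝ) : ℝ≥0∞ :=
  ∫⁻ s in S, ENNReal.ofReal (r * Real.exp (-r * (s - t)) * m.flow s)

/-- Incentive-compatibility: at every time, prompt disclosure is weakly better than disclosure with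
any delay `d > 0` and than never disclosing. -/
def IC (r : ℝ) (m : Mechanism) : Prop :=
  ∀ t, 0 ≤ t →
    (∀ d, 0 < d →
      m.flowValue r t (Ioo t (t + d)) + ENNReal.ofReal (Real.exp (-r * d)) * m.reward (t + d)
        ≤ m.reward t) ∧
    m.flowValue r t (Ioi t) ≤ m.reward t

/-- The principal's payoff if the breakthrough occurs at (and is disclosed at) time `τ`:
`r ∫₀^τ e^{-rt} F⁰(x⁰_t) dt + e^{-rτ} F¹(X¹_τ)`, with the convention `F¹(∞) = -∞`. -/
def payoffAt (F₀ F₁ : ℝ → EReal) (r : ℝ) (m : Mechanism) (τ : ℝ) : EReal :=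
  eintegral (volume.restrict (Ioo 0 τ))
      (fun t => ((r * Real.exp (-r * t) : ℝ) : EReal) * F₀ (m.flow t)) +
    ((Real.exp (-r * τ) : ℝ) : EReal) *
      (if m.reward τ = ∞ then ⊥ else F₁ (m.reward τ).toReal)

/-- The principal's expected payoff when the breakthrough time has law `G`. -/
def payoff (F₀ F₁ : ℝ → EReal) (r : ℝ) (G : Measure ℝ) (m : Mechanism) : EReal :=
  eintegral G (m.payoffAt F₀ F₁ r)

end Mechanism

/-- The law of a breakthrough time: a probability measure carried by `[0,∞)`. -/
structure IsTimeLaw (G : Measure ℝ) : Prop where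
  prob : IsProbabilityMeasure G
  nonneg : G (Iio 0) = 0

namespace Mechanism

/-- `m` dominates `m'`: weakly better under every law, strictly better under some law. -/
def Dominates (F₀ F₁ : ℝ → EReal) (r : ℝ) (m m' : Mechanism) : Prop :=
  (∀ G, IsTimeLaw G → m'.payoff F₀ F₁ r G ≤ m.payoff F₀ F₁ r G) ∧
    ∃ G, IsTimeLaw G ∧ m'.payoff F₀ F₁ r G < m.payoff F₀ F₁ r G

/-- An incentive-compatible mechanism that no incentive-compatible mechanism dominates. -/
def Undominated (F₀ F₁ : ℝ → EReal) (r : ℝ) (m : Mechanism) : Prop :=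
  m.IC r ∧ ∀ m' : Mechanism, m'.IC r → ¬ m'.Dominates F₀ F₁ r m

/-- `m` is optimal for `G`: it maximises the principal's payoff under `G` among incentive-compatible
mechanisms, and it is undominated. -/
def Optimal (F₀ F₁ : ℝ → EReal) (r : ℝ) (G : Measure ℝ) (m : Mechanism) : Prop :=
  m.IC r ∧ (∀ m' : Mechanism, m'.IC r → m'.payoff F₀ F₁ r G ≤ m.payoff F₀ F₁ r G) ∧
    m.Undominated F₀ F₁ r

/-- `m'` is a version of `m`: same rewards, and flows that agree at almost every time. -/
def IsVersion (m' m : Mechanism) : Prop :=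
  m'.flow =ᵐ[volume.restrict (Ici 0)] m.flow ∧ ∀ t, 0 ≤ t → m'.reward t = m.reward t

end Mechanism

end

/-! Let `μ` have density `r e^{-rt}` on `(0,∞)`, and let `X_τ = cont μ x τ` be the `μ`-average of
the flow after `τ`, that is, its continuation value.

Reduction. Dirac laws are admissible, so an undominated mechanism cannot be improved weakly at every
breakthrough time and strictly at one. Hence flow (almost everywhere) and rewards stay below `u₀`.
Rewards also equal continuation values (`Mechanism.reward_eq_cont`). Incentive compatibility says
that the discounted reward exceeds the discounted remaining flow by a nonnegative decreasing amount.
If rewards cannot be pushed towards the peak `u₁`, this excess falls only where the flow is below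
`u₁`. Adding the rate of fall to the flow then preserves incentives and raises the old payoff, so
undominatedness forces a zero excess. The payoff at `τ` becomes `∫_{≤τ} f₀(x) dμ + μ(τ,∞) f₁(X_τ)`.

Perturbation. Move the flow pointwise towards a level `m`, keeping its total, with `s` a
supergradient of `f₀` at `m`. By concavity the first term changes by at least `s` times the flow
gained up to `τ`, which is exactly `s μ(τ,∞) (X_τ - Y_τ)`, `Y` being the new continuation value. So
everything rests on comparing `s` with slopes of `f₁` (`Efficient.eq_of_between`). Strictly between
`us` and `u₀` the old frontier is strictly steeper than the new one (`FrontierPair.gap`). It follows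
that `X` never falls below `us`, stays at `us` once there, and never rises, since any rise could be
flattened. Consequently the flow lies above `X`. Shifting flow between dates then shows that the
flow never rises either (`Efficient.flow_antitone`).

Limits. These use optimality for `G`. If the flow stayed below some `v < u₀`, raising it on a short
interval `(0, ε]` would hurt only breakthroughs before `ε`, which are improbable because `G(0) = 0`.
If its limit exceeded `us`, cutting the flow after a late `S` and, where there is room, raising it
on `(T, T+1]` would gain on `[T+1, S]` and lose only after `S`. Since `G` has unbounded support, the
gain dominates as `S → ∞` (`limit_le_us`). -/

/-! ### Supergradients of concave functions on the line -/

/-- `s` is a supergradient at `u` of the restriction of `f` to `I`. -/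
def SupergradOn (f : ℝ → ℝ) (I : Set ℝ) (u s : ℝ) : Prop :=
  ∀ v ∈ I, f v ≤ f u + s * (v - u)

/-- Towards `m`, the chord from `x` has slope controlled by `s`, because `f m ≤ f x + s (m - x)`
with the roles of the points reversed; concavity passes this to the intermediate `y`. This is the
estimate behind every perturbation of the flow. -/
theorem SupergradOn.lower_bound {f : ℝ → ℝ} {I : Set ℝ} {m s x y : ℝ} (hf : ConcaveOn ℝ I f)
    (hs : SupergradOn f I m s) (hm : m ∈ I) (hx : x ∈ I) (hy : (x ≤ y ∧ y ≤ m) ∨ (m ≤ y ∧ y ≤ x)) :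
    y ∈ I ∧ f x + s * (y - x) ≤ f y := by
  rcases eq_or_ne x m with rfl | hne
  · have : y = x := by rcases hy with h | h <;> linarith [h.1, h.2]
    subst this; simpa using hm
  have hd : m - x ≠ 0 := sub_ne_zero.2 hne.symm
  set b := (y - x) / (m - x) with hb
  have hbm : b * (m - x) = y - x := by rw [hb]; field_simp
  have hb01 : 0 ≤ b ∧ b ≤ 1 := by
    rcases hy with ⟨h1, h2⟩ | ⟨h1, h2⟩
    · have : 0 < m - x := lt_of_le_of_ne (by linarith) hd.symm
      exact ⟨div_nonneg (by linarith) this.le, (div_le_one this).2 (by linarith)⟩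
    · have : m - x < 0 := lt_of_le_of_ne (by linarith) hd
      exact ⟨div_nonneg_of_nonpos (by linarith) this.le, (div_le_one_of_neg this).2 (by linarith)⟩
  have hyeq : (1 - b) • x + b • m = y := by simp only [smul_eq_mul]; linarith
  have h1 := hf.2 hx hm (sub_nonneg.2 hb01.2) hb01.1 (by ring)
  have hyI := hf.1 hx hm (sub_nonneg.2 hb01.2) hb01.1 (by ring)
  rw [hyeq] at h1 hyI
  refine ⟨hyI, ?_⟩
  have h2 := hs x hx
  simp only [smul_eq_mul] at h1
  have h3 : s * (y - x) = b * (s * (m - x)) := by rw [← hbm]; ring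
  nlinarith [hb01.1, mul_le_mul_of_nonneg_left h2 hb01.1]

/-- The supremum of the slopes to the right of `u` works: each of them is at most each slope to the
left. -/
theorem ConcaveOn.exists_supergradOn {f : ℝ → ℝ} {I : Set ℝ} {a u b : ℝ} (hf : ConcaveOn ℝ I f)
    (ha : a ∈ I) (hb : b ∈ I) (hau : a < u) (hub : u < b) : ∃ s, SupergradOn f I u s := by
  set S : Set ℝ := (fun v => (f v - f u) / (v - u)) '' (I ∩ Ioi u) with hS
  have hbound : ∀ w ∈ I, w < u → ∀ q ∈ S, q ≤ (f u - f w) / (u - w) := by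
    rintro w hw hwu q ⟨v, ⟨hv, hvu⟩, rfl⟩
    exact hf.slope_anti_adjacent hw hv hwu hvu
  have hne : S.Nonempty := ⟨_, mem_image_of_mem _ ⟨hb, hub⟩⟩
  have hbdd : BddAbove S := ⟨_, fun q hq => hbound a ha hau q hq⟩
  refine ⟨sSup S, fun v hv => ?_⟩
  rcases lt_trichotomy v u with h | rfl | h
  · have := csSup_le hne (hbound v hv h)
    rw [le_div_iff₀ (sub_pos.2 h)] at this
    nlinarith
  · simp
  · have := le_csSup hbdd (mem_image_of_mem (fun v => (f v - f u) / (v - u)) ⟨hv, h⟩)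
    rw [div_le_iff₀ (sub_pos.2 h)] at this
    linarith

theorem SupergradOn.sub_le_of_le {f : ℝ → ℝ} {I : Set ℝ} {m s u v : ℝ} (hf : ConcaveOn ℝ I f)
    (hs : SupergradOn f I m s) (hm : m ∈ I) (hv : v ∈ I) (hmu : m ≤ u) (huv : u ≤ v) :
    f v - f u ≤ s * (v - u) := by
  have := (hs.lower_bound hf hm hv (Or.inr ⟨hmu, huv⟩)).2
  nlinarith

theorem SupergradOn.le_sub_of_le {f : ℝ → ℝ} {I : Set ℝ} {m s u v : ℝ} (hf : ConcaveOn ℝ I f)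
    (hs : SupergradOn f I m s) (hm : m ∈ I) (hu : u ∈ I) (huv : u ≤ v) (hvm : v ≤ m) :
    s * (v - u) ≤ f v - f u := by
  have := (hs.lower_bound hf hm hu (Or.inl ⟨huv, hvm⟩)).2
  linarith

/-! ### Real-valued frontier pairs -/

/-- Real-valued old and new frontiers, with effective domains `I₀` and `I₁` inside `[0, u₀]`. -/
structure FrontierPair (f₀ f₁ : ℝ → ℝ) (I₀ I₁ : Set ℝ) (u₀ u₁ us : ℝ) : Prop where
  us_nonneg : 0 ≤ us
  us_lt : us < u₀
  u1_nonneg : 0 ≤ u₁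
  u1_lt : u₁ < u₀
  Ioc_subset : Ioc 0 u₀ ⊆ I₀
  subset_new : I₀ ⊆ I₁
  subset_Icc : I₁ ⊆ Icc 0 u₀
  conc_old : ConcaveOn ℝ I₀ f₀
  conc_new : ConcaveOn ℝ I₁ f₁
  meas_old : Measurable f₀
  mono_old : StrictMonoOn f₀ I₀
  anti_new : StrictAntiOn f₁ (Icc u₁ u₀)
  gap : ∀ u s η, us < u → u < u₀ → SupergradOn f₀ I₀ u s → SupergradOn f₁ I₁ u η → η < s
  shared : 0 < us → ∃ η, SupergradOn f₀ I₀ us η ∧ SupergradOn f₁ I₁ us η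
  strict_max : 0 < us → ∀ᶠ v in 𝓝[≠] us, f₁ v - f₀ v < f₁ us - f₀ us

namespace FrontierPair

variable {f₀ f₁ : ℝ → ℝ} {I₀ I₁ : Set ℝ} {u₀ u₁ us : ℝ}

theorem u0_pos (h : FrontierPair f₀ f₁ I₀ I₁ u₀ u₁ us) : 0 < u₀ := h.us_nonneg.trans_lt h.us_lt

theorem mem_old (h : FrontierPair f₀ f₁ I₀ I₁ u₀ u₁ us) {u : ℝ} (hu : 0 < u) (hu' : u ≤ u₀) :
    u ∈ I₀ := h.Ioc_subset ⟨hu, hu'⟩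

theorem mem_new (h : FrontierPair f₀ f₁ I₀ I₁ u₀ u₁ us) {u : ℝ} (hu : 0 < u) (hu' : u ≤ u₀) :
    u ∈ I₁ := h.subset_new (h.mem_old hu hu')

theorem exists_supergrad_old (h : FrontierPair f₀ f₁ I₀ I₁ u₀ u₁ us) {u : ℝ} (hu : 0 < u)
    (hu' : u < u₀) : ∃ s, SupergradOn f₀ I₀ u s :=
  h.conc_old.exists_supergradOn (h.mem_old (half_pos hu) (by linarith))
    (h.mem_old h.u0_pos le_rfl) (half_lt_self hu) hu'

theorem exists_supergrad_new (h : FrontierPair f₀ f₁ I₀ I₁ u₀ u₁ us) {u : ℝ} (hu : 0 < u)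
    (hu' : u < u₀) : ∃ s, SupergradOn f₁ I₁ u s :=
  h.conc_new.exists_supergradOn (h.mem_new (half_pos hu) (by linarith))
    (h.mem_new h.u0_pos le_rfl) (half_lt_self hu) hu'

theorem supergrad_old_pos (h : FrontierPair f₀ f₁ I₀ I₁ u₀ u₁ us) {u s : ℝ} (hu : 0 < u)
    (hu' : u < u₀) (hs : SupergradOn f₀ I₀ u s) : 0 < s := by
  have h1 := hs u₀ (h.mem_old h.u0_pos le_rfl)
  have h2 := h.mono_old (h.mem_old hu hu'.le) (h.mem_old h.u0_pos le_rfl) hu'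
  by_contra hc
  nlinarith

end FrontierPair

/-! ### Discounting laws, continuation values and efficiency -/

/-- A nonatomic probability law on `(0, ∞)` that charges every interval. -/
structure IsDiscount (μ : Measure ℝ) : Prop where
  prob : IsProbabilityMeasure μ
  noAtoms : NullSingletonClass μ
  nonpos : μ (Iic 0) = 0
  pos : ∀ a b, 0 ≤ a → a < b → 0 < μ (Ioc a b)

/-- The value of the flow `x` after time `t`, discounted to time `0`. -/
noncomputable def tail (μ : Measure ℝ) (x : ℝ → ℝ) (t : ℝ) : ℝ := ∫ s in Ioi t, x s ∂μ

/-- The value of the flow `x` after time `t`, discounted to time `t`. -/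
noncomputable def cont (μ : Measure ℝ) (x : ℝ → ℝ) (t : ℝ) : ℝ := tail μ x t / μ.real (Ioi t)

/-- Measurable flows in `[0, u₀]` that yield a finite payoff before any time. -/
structure Admissible (μ : Measure ℝ) (f₀ : ℝ → ℝ) (I₀ : Set ℝ) (u₀ : ℝ) (x : ℝ → ℝ) : Prop where
  meas : Measurable x
  nonneg : ∀ t, 0 ≤ x t
  le : ∀ t, x t ≤ u₀
  ae_mem : ∀ᵐ t ∂μ, x t ∈ I₀
  integ : ∀ τ, IntegrableOn (fun t => f₀ (x t)) (Iic τ) μ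

/-- The payoff at the breakthrough time `τ` of flow `x` with reward equal to continuation value. -/
noncomputable def value (μ : Measure ℝ) (f₀ f₁ : ℝ → ℝ) (x : ℝ → ℝ) (τ : ℝ) : ℝ :=
  (∫ t in Iic τ, f₀ (x t) ∂μ) + μ.real (Ioi τ) * f₁ (cont μ x τ)

/-- No admissible flow is weakly better at every time and strictly better at some time. -/
def Efficient (μ : Measure ℝ) (f₀ f₁ : ℝ → ℝ) (I₀ : Set ℝ) (u₀ : ℝ) (x : ℝ → ℝ) : Prop :=
  ∀ y, Admissible μ f₀ I₀ u₀ y → (∀ τ, 0 ≤ τ → value μ f₀ f₁ x τ ≤ value μ f₀ f₁ y τ) →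
    ∀ τ, 0 ≤ τ → value μ f₀ f₁ y τ = value μ f₀ f₁ x τ

section Core

variable {μ : Measure ℝ} {f₀ f₁ : ℝ → ℝ} {I₀ I₁ : Set ℝ} {u₀ u₁ us : ℝ} {x y : ℝ → ℝ}

theorem integrable_of_bounds [IsFiniteMeasure μ] (hx : Measurable x) {a b : ℝ}
    (ha : ∀ t, a ≤ x t) (hb : ∀ t, x t ≤ b) : Integrable x μ := by
  refine Integrable.of_bound hx.aestronglyMeasurable (max |a| |b|) (ae_of_all _ fun t => ?_)
  rw [Real.norm_eq_abs]
  exact abs_le_max_abs_abs (ha t) (hb t)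

theorem Admissible.integrable [IsFiniteMeasure μ] (hx : Admissible μ f₀ I₀ u₀ x) :
    Integrable x μ := integrable_of_bounds hx.meas hx.nonneg hx.le

theorem IsDiscount.tail_pos (hμ : IsDiscount μ) (t : ℝ) : 0 < μ.real (Ioi t) := by
  have := hμ.prob
  rw [measureReal_def]
  refine ENNReal.toReal_pos (ne_of_gt ?_) (measure_ne_top _ _)
  exact (hμ.pos (max t 0) (max t 0 + 1) (le_max_right _ _) (by linarith)).trans_le
    (measure_mono fun s hs => (le_max_left t 0).trans_lt hs.1)

theorem tail_add [IsFiniteMeasure μ] (hx : Integrable x μ) (t : ℝ) :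
    (∫ s in Iic t, x s ∂μ) + tail μ x t = ∫ s, x s ∂μ := by
  have := integral_add_compl (measurableSet_Iic (a := t)) hx
  rwa [compl_Iic] at this

theorem tail_sub_tail [IsFiniteMeasure μ] (hx : Integrable x μ) {a b : ℝ} (hab : a ≤ b) :
    tail μ x a - tail μ x b = ∫ s in Ioc a b, x s ∂μ := by
  unfold tail
  rw [← Ioc_union_Ioi_eq_Ioi hab, setIntegral_union (Ioc_disjoint_Ioi le_rfl) measurableSet_Ioi
    hx.integrableOn hx.integrableOn]
  ring

theorem continuous_tail (hμ : IsDiscount μ) (hx : Integrable x μ) : Continuous (tail μ x) := by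
  have := hμ.prob
  have := hμ.noAtoms
  have h : tail μ x = fun t => tail μ x 0 - ∫ s in (0 : ℝ)..t, x s ∂μ := by
    funext t
    rcases le_total 0 t with ht | ht
    · rw [intervalIntegral.integral_of_le ht, ← tail_sub_tail hx ht]; ring
    · rw [intervalIntegral.integral_of_ge ht, ← tail_sub_tail hx ht]; ring
  rw [h]
  exact continuous_const.sub
    (intervalIntegral.continuous_primitive (fun a b => hx.intervalIntegrable) 0)

theorem measureReal_Ioi_eq_tail : (fun t => μ.real (Ioi t)) = tail μ (fun _ => 1) := by
  funext t; simp [tail]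

theorem continuous_measureReal_Ioi (hμ : IsDiscount μ) : Continuous fun t => μ.real (Ioi t) := by
  have := hμ.prob
  rw [measureReal_Ioi_eq_tail]
  exact continuous_tail hμ (integrable_const 1)

theorem continuous_cont (hμ : IsDiscount μ) (hx : Integrable x μ) : Continuous (cont μ x) :=
  (continuous_tail hμ hx).div (continuous_measureReal_Ioi hμ) fun t => (hμ.tail_pos t).ne'

theorem mul_cont (hμ : IsDiscount μ) (t : ℝ) : μ.real (Ioi t) * cont μ x t = tail μ x t := by
  unfold cont
  field_simp [(hμ.tail_pos t).ne']

theorem tail_mono_of_ae [IsFiniteMeasure μ] {t : ℝ} (hx : Integrable x μ) (hy : Integrable y μ)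
    (h : ∀ᵐ s ∂μ, t < s → x s ≤ y s) : tail μ x t ≤ tail μ y t :=
  setIntegral_mono_on_ae hx.integrableOn hy.integrableOn measurableSet_Ioi h

theorem tail_const (c t : ℝ) : tail μ (fun _ => c) t = μ.real (Ioi t) * c := by
  simp [tail]

theorem cont_const (hμ : IsDiscount μ) (c t : ℝ) : cont μ (fun _ => c) t = c := by
  rw [cont, tail_const, mul_div_cancel_left₀ _ (hμ.tail_pos t).ne']

theorem Admissible.cont_mem (hμ : IsDiscount μ) (hx : Admissible μ f₀ I₀ u₀ x) (t : ℝ) :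
    cont μ x t ∈ Icc 0 u₀ := by
  have := hμ.prob
  have h1 := tail_mono_of_ae (t := t) (integrable_const 0) hx.integrable
    (ae_of_all _ fun s _ => hx.nonneg s)
  have h2 := tail_mono_of_ae (t := t) hx.integrable (integrable_const u₀)
    (ae_of_all _ fun s _ => hx.le s)
  rw [tail_const] at h1 h2
  constructor
  · exact div_nonneg (by linarith) (hμ.tail_pos t).le
  · rw [cont, div_le_iff₀ (hμ.tail_pos t)]; linarith

/-- Only a lower bound on the perturbed old payoff needs checking, since `f₀ u₀` bounds it above;
the two bounds together give integrability up to every finite time. -/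
theorem Admissible.of_lower_bound (hμ : IsDiscount μ) (hF : FrontierPair f₀ f₁ I₀ I₁ u₀ u₁ us)
    (hx : Admissible μ f₀ I₀ u₀ x) {z : ℝ → ℝ} (hym : Measurable y) (hy0 : ∀ t, 0 ≤ y t)
    (hyu : ∀ t, y t ≤ u₀) (hz : Integrable z μ)
    (h : ∀ᵐ t ∂μ, x t ∈ I₀ → y t ∈ I₀ ∧ f₀ (x t) + z t ≤ f₀ (y t)) :
    Admissible μ f₀ I₀ u₀ y ∧
      ∀ τ, (∫ t in Iic τ, f₀ (x t) ∂μ) + ∫ t in Iic τ, z t ∂μ ≤ ∫ t in Iic τ, f₀ (y t) ∂μ := by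
  have := hμ.prob
  have hae : ∀ᵐ t ∂μ, y t ∈ I₀ ∧ f₀ (x t) + z t ≤ f₀ (y t) := by
    filter_upwards [h, hx.ae_mem] with t h1 h2 using h1 h2
  have hInt : ∀ τ, IntegrableOn (fun t => f₀ (y t)) (Iic τ) μ := by
    intro τ
    have h1 : IntegrableOn (fun t => |f₀ (x t) + z t| + |f₀ u₀|) (Iic τ) μ :=
      (((hx.integ τ).add hz.integrableOn).abs).add (integrable_const _)
    refine Integrable.mono' h1 (hF.meas_old.comp hym).aestronglyMeasurable ?_
    refine ae_restrict_of_ae ?_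
    filter_upwards [hae] with t ht
    have h2 : f₀ (y t) ≤ f₀ u₀ :=
      hF.mono_old.monotoneOn ht.1 (hF.mem_old hF.u0_pos le_rfl) (hyu t)
    rw [Real.norm_eq_abs, abs_le]
    constructor
    · linarith [neg_abs_le (f₀ (x t) + z t), abs_nonneg (f₀ u₀)]
    · linarith [le_abs_self (f₀ u₀), abs_nonneg (f₀ (x t) + z t)]
  refine ⟨⟨hym, hy0, hyu, hae.mono fun t ht => ht.1, hInt⟩, fun τ => ?_⟩
  rw [← integral_add (hx.integ τ) hz.integrableOn]
  exact integral_mono_ae ((hx.integ τ).add hz.integrableOn) (hInt τ)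
    (ae_restrict_of_ae (hae.mono fun t ht => ht.2))

/-- Moving the flow `x` towards `m` changes the pre-disclosure payoff at least linearly. -/
theorem Admissible.of_between (hμ : IsDiscount μ) (hF : FrontierPair f₀ f₁ I₀ I₁ u₀ u₁ us)
    (hx : Admissible μ f₀ I₀ u₀ x) {m s : ℝ} (hm0 : 0 < m) (hm : m ≤ u₀)
    (hs : SupergradOn f₀ I₀ m s) (hym : Measurable y)
    (hy : ∀ t, (x t ≤ y t ∧ y t ≤ m) ∨ (m ≤ y t ∧ y t ≤ x t)) :
    Admissible μ f₀ I₀ u₀ y ∧ ∀ τ, (∫ t in Iic τ, f₀ (x t) ∂μ) +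
      s * ∫ t in Iic τ, (y t - x t) ∂μ ≤ ∫ t in Iic τ, f₀ (y t) ∂μ := by
  have := hμ.prob
  have hy0 : ∀ t, 0 ≤ y t := fun t => by rcases hy t with h | h <;> linarith [hx.nonneg t]
  have hyu : ∀ t, y t ≤ u₀ := fun t => by rcases hy t with h | h <;> linarith [hx.le t]
  have hyi : Integrable y μ := integrable_of_bounds hym hy0 hyu
  have := hx.of_lower_bound hμ hF hym hy0 hyu (z := fun t => s * (y t - x t))
    ((hyi.sub hx.integrable).const_mul s) (ae_of_all _ fun t ht =>
      hs.lower_bound hF.conc_old (hF.mem_old hm0 hm) ht (hy t))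
  refine ⟨this.1, fun τ => ?_⟩
  rw [← integral_const_mul]
  exact this.2 τ

end Core

/-! ### Neutral redistributions of an efficient flow -/

section Core

variable {μ : Measure ℝ} {f₀ f₁ : ℝ → ℝ} {I₀ I₁ : Set ℝ} {u₀ u₁ us : ℝ} {x y : ℝ → ℝ}

/-- The primitive of `w` is increasing and, as `μ` has no atoms, continuous, so it defines a
Stieltjes measure. Comparing measures on half-open intervals shows that the negative part of `w` has
a density measure below that of the positive part; evaluated on `{w < 0}` the latter vanishes. -/
theorem ae_nonneg_of_forall_Ioc [IsFiniteMeasure μ] [NullSingletonClass μ] {w : ℝ → ℝ}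
    (hw : Integrable w μ) (h : ∀ a b, a ≤ b → 0 ≤ ∫ t in Ioc a b, w t ∂μ) : ∀ᵐ t ∂μ, 0 ≤ w t := by
  have hprim : ∀ a t, a ≤ t → (∫ s in (0 : ℝ)..t, w s ∂μ) - ∫ s in (0 : ℝ)..a, w s ∂μ =
      ∫ s in Ioc a t, w s ∂μ := fun a t hat => by
    rw [intervalIntegral.integral_interval_sub_left hw.intervalIntegrable hw.intervalIntegrable,
      intervalIntegral.integral_of_le hat]
  let S : StieltjesFunction ℝ :=
    { toFun := fun t => ∫ s in (0 : ℝ)..t, w s ∂μ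
      mono' := fun a b hab => by linarith [hprim a b hab, h a b hab]
      right_continuous' := fun t => (intervalIntegral.continuous_primitive
        (fun a b => hw.intervalIntegrable) 0).continuousWithinAt }
  have hpos : ∀ s, (∫⁻ t in s, ENNReal.ofReal (w t) ∂μ) ≠ ∞ := fun s =>
    (hw.integrableOn (s := s)).lintegral_lt_top.ne
  have hneg : ∀ s, (∫⁻ t in s, ENNReal.ofReal (-w t) ∂μ) ≠ ∞ := fun s =>
    (hw.neg.integrableOn (s := s)).lintegral_lt_top.ne
  set μp := μ.withDensity fun t => ENNReal.ofReal (w t)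
  set μn := μ.withDensity fun t => ENNReal.ofReal (-w t)
  have : IsFiniteMeasure μp := isFiniteMeasure_withDensity (by simpa using hpos univ)
  have : IsFiniteMeasure μn := isFiniteMeasure_withDensity (by simpa using hneg univ)
  have heq : S.measure + μn = μp := by
    refine (Measure.ext_of_Ioc _ _ fun a b hab => ?_).symm
    rw [Measure.add_apply, S.measure_Ioc, withDensity_apply _ measurableSet_Ioc,
      withDensity_apply _ measurableSet_Ioc]
    change _ = ENNReal.ofReal ((∫ s in (0 : ℝ)..b, w s ∂μ) - ∫ s in (0 : ℝ)..a, w s ∂μ) + _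
    rw [hprim a b hab.le, ← ENNReal.toReal_eq_toReal_iff' (hpos _)
      (ENNReal.add_ne_top.2 ⟨ENNReal.ofReal_ne_top, hneg _⟩),
      ENNReal.toReal_add ENNReal.ofReal_ne_top (hneg _), ENNReal.toReal_ofReal (h a b hab.le),
      integral_eq_lintegral_pos_part_sub_lintegral_neg_part hw.integrableOn]
    ring
  have hle : μn ≤ μp := by rw [← heq]; exact Measure.le_add_left le_rfl
  obtain ⟨w', hw'm, hww'⟩ := hw.aestronglyMeasurable.aemeasurable
  set N := {t | w' t < 0}
  have hN : MeasurableSet N := measurableSet_lt hw'm measurable_const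
  have h1 : ∫⁻ t in N, ENNReal.ofReal (w t) ∂μ = 0 := by
    rw [lintegral_congr_ae (g := fun t => ENNReal.ofReal (w' t))
      (ae_restrict_of_ae (hww'.mono fun t ht => by simp only [ht]))]
    rw [setLIntegral_congr_fun (g := fun _ => 0) hN
      (fun t ht => ENNReal.ofReal_of_nonpos (le_of_lt ht))]
    simp
  have h2 : ∫⁻ t in N, ENNReal.ofReal (-w' t) ∂μ = 0 := by
    have h3 := hle N
    rw [withDensity_apply _ hN, withDensity_apply _ hN, h1] at h3
    rw [← nonpos_iff_eq_zero]
    refine le_trans (le_of_eq ?_) h3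
    exact lintegral_congr_ae (ae_restrict_of_ae (hww'.mono fun t ht => by simp only [ht]))
  rw [lintegral_eq_zero_iff (by fun_prop), Filter.EventuallyEq, ae_restrict_iff' hN] at h2
  filter_upwards [h2, hww'] with t ht1 ht2
  by_contra hc
  rw [ht2, not_le] at hc
  have := ht1 hc
  simp only [Pi.zero_apply, ENNReal.ofReal_eq_zero] at this
  linarith

theorem IsDiscount.ae_pos (hμ : IsDiscount μ) : ∀ᵐ t ∂μ, 0 < t := by
  rw [ae_iff]; simpa [Iic] using hμ.nonpos

theorem integral_eq_tail_zero (hμ : IsDiscount μ) : ∫ s, x s ∂μ = tail μ x 0 := by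
  rw [tail, Measure.restrict_eq_self_of_ae_mem (s := Ioi (0 : ℝ)) hμ.ae_pos]

theorem measureReal_Ioi_zero (hμ : IsDiscount μ) : μ.real (Ioi 0) = 1 := by
  have := hμ.prob
  have h := integral_eq_tail_zero (x := fun _ => (1 : ℝ)) hμ
  rw [tail_const] at h
  simpa using h.symm

theorem measureReal_Ioc [IsFiniteMeasure μ] {a b : ℝ} (hab : a ≤ b) :
    μ.real (Ioc a b) = μ.real (Ioi a) - μ.real (Ioi b) := by
  have := tail_sub_tail (μ := μ) (integrable_const (1 : ℝ)) hab
  rw [tail_const, tail_const] at this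
  simpa using this.symm

theorem setIntegral_Iic_sub [IsFiniteMeasure μ] (hx : Integrable x μ) (hy : Integrable y μ)
    (hxy : ∫ t, y t ∂μ = ∫ t, x t ∂μ) (τ : ℝ) :
    ∫ t in Iic τ, (y t - x t) ∂μ = tail μ x τ - tail μ y τ := by
  rw [integral_sub hy.integrableOn hx.integrableOn]
  linarith [tail_add hx τ, tail_add hy τ]

theorem Admissible.integrable_of_between [IsFiniteMeasure μ] (hx : Admissible μ f₀ I₀ u₀ x) {m : ℝ}
    (hm0 : 0 < m) (hm : m ≤ u₀) (hym : Measurable y)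
    (hy : ∀ t, (x t ≤ y t ∧ y t ≤ m) ∨ (m ≤ y t ∧ y t ≤ x t)) : Integrable y μ :=
  integrable_of_bounds (a := 0) (b := u₀) hym
    (fun t => by rcases hy t with h | h <;> linarith [hx.nonneg t])
    (fun t => by rcases hy t with h | h <;> linarith [hx.le t])

/-- A redistribution of the flow of an efficient mechanism towards `m` that does not pay off at
first order is neutral. -/
theorem Efficient.eq_of_between (hμ : IsDiscount μ) (hF : FrontierPair f₀ f₁ I₀ I₁ u₀ u₁ us)
    (hx : Admissible μ f₀ I₀ u₀ x) (hE : Efficient μ f₀ f₁ I₀ u₀ x) {m s : ℝ} (hm0 : 0 < m)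
    (hm : m ≤ u₀) (hs : SupergradOn f₀ I₀ m s) (hym : Measurable y)
    (hy : ∀ t, (x t ≤ y t ∧ y t ≤ m) ∨ (m ≤ y t ∧ y t ≤ x t))
    (hxy : ∫ t, y t ∂μ = ∫ t, x t ∂μ)
    (h : ∀ τ, 0 ≤ τ → f₁ (cont μ x τ) ≤ f₁ (cont μ y τ) + s * (cont μ x τ - cont μ y τ)) :
    (∀ τ, 0 ≤ τ → f₁ (cont μ x τ) = f₁ (cont μ y τ) + s * (cont μ x τ - cont μ y τ)) ∧
      ∀ᵐ t ∂μ, f₀ (y t) = f₀ (x t) + s * (y t - x t) := by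
  have := hμ.prob
  have hyi := hx.integrable_of_between (μ := μ) hm0 hm hym hy
  obtain ⟨hya, hb⟩ := hx.of_between hμ hF hm0 hm hs hym hy
  -- The totals agree, so flow gained up to `τ` is flow lost after `τ`.
  have hH : ∀ τ, ∫ t in Iic τ, (y t - x t) ∂μ = μ.real (Ioi τ) * (cont μ x τ - cont μ y τ) := by
    intro τ
    rw [setIntegral_Iic_sub hx.integrable hyi hxy, mul_sub, mul_cont hμ, mul_cont hμ]
  have hle : ∀ τ, 0 ≤ τ → value μ f₀ f₁ x τ ≤ value μ f₀ f₁ y τ := by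
    intro τ hτ
    have h1 := hb τ
    have h2 := mul_le_mul_of_nonneg_left (h τ hτ) (hμ.tail_pos τ).le
    rw [hH] at h1
    unfold value
    nlinarith
  have heq := hE y hya hle
  -- The old and the new frontier each yield a nonnegative gain over the line of slope `s`;
  -- efficiency makes their sum zero, hence each is zero.
  have hboth : ∀ τ, 0 ≤ τ →
      f₁ (cont μ x τ) = f₁ (cont μ y τ) + s * (cont μ x τ - cont μ y τ) ∧
      ∫ t in Iic τ, f₀ (y t) ∂μ =
        (∫ t in Iic τ, f₀ (x t) ∂μ) + s * ∫ t in Iic τ, (y t - x t) ∂μ := by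
    intro τ hτ
    have h0 := heq τ hτ
    have h1 := hb τ
    have h2 := h τ hτ
    have h3 := hμ.tail_pos τ
    have h4 := mul_le_mul_of_nonneg_left h2 h3.le
    rw [hH] at h1 ⊢
    unfold value at h0
    have h5 : μ.real (Ioi τ) * f₁ (cont μ x τ) =
        μ.real (Ioi τ) * (f₁ (cont μ y τ) + s * (cont μ x τ - cont μ y τ)) := by nlinarith
    exact ⟨mul_left_cancel₀ h3.ne' h5, by nlinarith⟩
  refine ⟨fun τ hτ => (hboth τ hτ).1, ?_⟩
  have hz : ∀ᵐ t ∂μ, 0 ≤ f₀ (y t) - f₀ (x t) - s * (y t - x t) := by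
    filter_upwards [hx.ae_mem] with t ht
    linarith [(hs.lower_bound hF.conc_old (hF.mem_old hm0 hm) ht (hy t)).2]
  -- Payoffs are integrable only up to finite times, so the equality is localised to `Iic n`.
  have hn : ∀ n : ℕ, ∀ᵐ t : ℝ ∂μ, t ≤ n → f₀ (y t) = f₀ (x t) + s * (y t - x t) := by
    intro n
    have hi : IntegrableOn (fun t => s * (y t - x t)) (Iic (n : ℝ)) μ :=
      ((hyi.sub hx.integrable).const_mul s).integrableOn
    have hd : IntegrableOn (fun t => f₀ (y t) - f₀ (x t)) (Iic (n : ℝ)) μ :=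
      (hya.integ n).sub (hx.integ n)
    have h0 : ∫ t in Iic (n : ℝ), (f₀ (y t) - f₀ (x t) - s * (y t - x t)) ∂μ = 0 := by
      rw [integral_sub hd hi, integral_sub (hya.integ n) (hx.integ n),
        integral_const_mul]
      linarith [(hboth n (Nat.cast_nonneg n)).2]
    rw [integral_eq_zero_iff_of_nonneg_ae (ae_restrict_of_ae hz)
      (hd.sub hi), Filter.EventuallyEq,
      ae_restrict_iff' measurableSet_Iic] at h0
    filter_upwards [h0] with t ht htn
    have := ht htn
    simp only [Pi.zero_apply] at this
    linarith
  filter_upwards [ae_all_iff.2 hn] with t ht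
  obtain ⟨n, hn⟩ := exists_nat_ge t
  exact ht n hn

/-- Replacing an efficient flow by the constant `u` from the time `T` at which its continuation
value is `u` on, possibly until a later such time. -/
theorem Efficient.eq_of_flatten (hμ : IsDiscount μ) (hF : FrontierPair f₀ f₁ I₀ I₁ u₀ u₁ us)
    (hx : Admissible μ f₀ I₀ u₀ x) (hE : Efficient μ f₀ f₁ I₀ u₀ x) {u s T : ℝ} (hu0 : 0 < u)
    (hu : u ≤ u₀) (hs : SupergradOn f₀ I₀ u s) (hTu : cont μ x T = u) {J : Set ℝ}
    (hJ : J = Ioi T ∨ ∃ S, T ≤ S ∧ cont μ x S = u ∧ J = Ioc T S)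
    (h : ∀ τ ∈ J, 0 ≤ τ → f₁ (cont μ x τ) ≤ f₁ u + s * (cont μ x τ - u)) :
    ∀ τ ∈ J, 0 ≤ τ → f₁ (cont μ x τ) = f₁ u + s * (cont μ x τ - u) := by
  classical
  have := hμ.prob
  have hJm : MeasurableSet J := by
    rcases hJ with rfl | ⟨S, -, -, rfl⟩
    exacts [measurableSet_Ioi, measurableSet_Ioc]
  have hJT : J ⊆ Ioi T := by
    rcases hJ with rfl | ⟨S, -, -, rfl⟩
    exacts [Subset.rfl, Ioc_subset_Ioi_self]
  set y : ℝ → ℝ := J.piecewise (fun _ => u) x with hy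
  have hym : Measurable y := Measurable.piecewise hJm measurable_const hx.meas
  have hyb : ∀ t, (x t ≤ y t ∧ y t ≤ u) ∨ (u ≤ y t ∧ y t ≤ x t) := by
    intro t
    by_cases ht : t ∈ J
    · simp only [hy, piecewise_eq_of_mem _ _ _ ht]
      rcases le_total (x t) u with h | h <;> simp [h]
    · simp only [hy, piecewise_eq_of_notMem _ _ _ ht]
      rcases le_total (x t) u with h | h <;> simp [h]
  have hyi := hx.integrable_of_between (μ := μ) hu0 hu hym hyb
  have hconst : ∀ a b, Ioc a b ⊆ J → ∫ t in Ioc a b, y t ∂μ = μ.real (Ioc a b) * u := by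
    intro a b hab
    rw [setIntegral_congr_fun measurableSet_Ioc
      (fun t ht => piecewise_eq_of_mem J (fun _ => u) x (hab ht))]
    simp
  have hsame : ∀ a b, a ≤ b → Disjoint (Ioc a b) J →
      ∫ t in Ioc a b, y t ∂μ = ∫ t in Ioc a b, x t ∂μ := by
    intro a b hab hd
    exact setIntegral_congr_fun measurableSet_Ioc
      (fun t ht => piecewise_eq_of_notMem _ _ _ (disjoint_left.1 hd ht))
  -- Flattening gives continuation value `u` throughout `J` and leaves it unchanged elsewhere: it
  -- already equals `u` at `T` and, if `J` is bounded, at `S`.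
  have htail : ∀ τ, (τ ∈ J ∨ τ = T → tail μ y τ = μ.real (Ioi τ) * u) ∧
      (τ ∉ J → T ≤ τ → tail μ y τ = tail μ x τ) := by
    intro τ
    rcases hJ with hJ | ⟨S, hTS, hSu, hJ⟩
    · have h1 : T ≤ τ → tail μ y τ = μ.real (Ioi τ) * u := by
        intro hτ
        rw [tail, setIntegral_congr_fun measurableSet_Ioi (fun t ht => piecewise_eq_of_mem J
          (fun _ => u) x (by rw [hJ]; exact hτ.trans_lt ht))]
        simp
      refine ⟨fun h => h1 ?_, fun h1' h2 => ?_⟩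
      · rcases h with h | h
        exacts [(hJT h).le, h.ge]
      · have : τ = T := by
          rw [hJ, mem_Ioi, not_lt] at h1'
          exact le_antisymm h1' h2
        rw [h1 h2, this, ← mul_cont hμ (x := x), hTu]
    · have h1 : ∀ τ, S ≤ τ → tail μ y τ = tail μ x τ := by
        intro τ hτ
        refine setIntegral_congr_fun measurableSet_Ioi (fun t ht => piecewise_eq_of_notMem _ _ _ ?_)
        rw [hJ]
        exact fun h => absurd h.2 (not_le.2 (hτ.trans_lt ht))
      have h2 : T ≤ τ → τ ≤ S → tail μ y τ = μ.real (Ioi τ) * u := by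
        intro hT hS
        have h3 := tail_sub_tail hyi hS
        rw [hconst _ _ (by rw [hJ]; exact Ioc_subset_Ioc_left hT), measureReal_Ioc hS, h1 S le_rfl,
          ← mul_cont hμ (x := x), hSu] at h3
        linarith
      refine ⟨fun h => ?_, fun h3 h4 => ?_⟩
      · rcases h with h | h
        · rw [hJ] at h; exact h2 h.1.le h.2
        · exact h2 h.ge (h.le.trans hTS)
      · rcases h4.eq_or_lt with h5 | h5
        · rw [h2 h4 (h5 ▸ hTS), ← h5, ← mul_cont hμ (x := x), hTu]
        · refine h1 τ ?_
          rw [hJ] at h3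
          by_contra h6
          exact h3 ⟨h5, (not_le.1 h6).le⟩
  have htailT : tail μ y T = tail μ x T := by
    rw [(htail T).1 (Or.inr rfl), ← mul_cont hμ (x := x), hTu]
  have hbefore : ∀ τ, τ ≤ T → tail μ y τ = tail μ x τ := by
    intro τ hτ
    have h1 := tail_sub_tail hyi hτ
    have h2 := tail_sub_tail hx.integrable hτ
    rw [hsame τ T hτ (disjoint_left.2 fun t ht ht' => absurd (hJT ht') (not_lt.2 ht.2))] at h1
    linarith
  have htot : ∫ t, y t ∂μ = ∫ t, x t ∂μ := by
    rw [← tail_add hyi T, ← tail_add hx.integrable T, htailT]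
    congr 1
    exact setIntegral_congr_fun measurableSet_Iic
      (fun t ht => piecewise_eq_of_notMem _ _ _ fun h => notMem_Ioi.2 ht (hJT h))
  have hcJ : ∀ τ ∈ J, cont μ y τ = u := by
    intro τ hτ
    rw [cont, (htail τ).1 (Or.inl hτ), mul_div_cancel_left₀ _ (hμ.tail_pos τ).ne']
  have hcn : ∀ τ, τ ∉ J → cont μ y τ = cont μ x τ := by
    intro τ hτ
    rw [cont, cont]
    rcases le_total T τ with h1 | h1
    · rw [(htail τ).2 hτ h1]
    · rw [hbefore τ h1]
  have hfin := (hE.eq_of_between hμ hF hx hu0 hu hs hym hyb htot (fun τ hτ => by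
    by_cases hτJ : τ ∈ J
    · rw [hcJ τ hτJ]; exact h τ hτJ hτ
    · rw [hcn τ hτJ]; simp)).1
  intro τ hτJ hτ
  have := hfin τ hτ
  rwa [hcJ τ hτJ] at this

end Core

/-! ### Continuation values of efficient flows: the floor `us` and monotonicity -/

section Core

variable {μ : Measure ℝ} {f₀ f₁ : ℝ → ℝ} {I₀ I₁ : Set ℝ} {u₀ u₁ us : ℝ} {x y : ℝ → ℝ}

/-- Only the value `0` is in doubt. If it is a continuation value, then the flow vanishes almost
everywhere afterwards, and `0` is in `I₀` by admissibility. -/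
theorem Admissible.cont_mem_new (hμ : IsDiscount μ) (hF : FrontierPair f₀ f₁ I₀ I₁ u₀ u₁ us)
    (hx : Admissible μ f₀ I₀ u₀ x) (τ : ℝ) : cont μ x τ ∈ I₁ := by
  have := hμ.prob
  rcases (hx.cont_mem hμ τ).1.eq_or_lt with h4 | h4
  · rw [← h4]
    by_contra hI
    have h5 : tail μ x τ = 0 := by rw [← mul_cont hμ, ← h4, mul_zero]
    rw [tail, integral_eq_zero_iff_of_nonneg (fun t => hx.nonneg t)
      hx.integrable.integrableOn, Filter.EventuallyEq, ae_restrict_iff' measurableSet_Ioi] at h5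
    have h6 : ∀ᵐ t ∂μ, t ∉ Ioi τ := by
      filter_upwards [h5, hx.ae_mem] with t ht1 ht2 ht3
      rw [ht1 ht3] at ht2
      exact hI (hF.subset_new ht2)
    have h7 : μ (Ioi τ) = 0 := by
      rw [ae_iff] at h6
      simpa only [not_not, ofPred_mem_eq] using h6
    have := hμ.tail_pos τ
    rw [measureReal_def, h7] at this
    simp at this
  · exact hF.mem_new h4 (hx.cont_mem hμ τ).2

/-- Otherwise the constant flow `us` is strictly better at every time: with a shared supergradient
`η > 0`, the gains on the two frontiers add up to at least `η (us - cont μ x 0)`, whatever `τ` is.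
-/
theorem Efficient.us_le_cont_zero (hμ : IsDiscount μ) (hF : FrontierPair f₀ f₁ I₀ I₁ u₀ u₁ us)
    (hx : Admissible μ f₀ I₀ u₀ x) (hE : Efficient μ f₀ f₁ I₀ u₀ x) : us ≤ cont μ x 0 := by
  have := hμ.prob
  rcases hF.us_nonneg.eq_or_lt with h0 | h0
  · rw [← h0]; exact (hx.cont_mem hμ 0).1
  by_contra hc
  rw [not_le] at hc
  obtain ⟨η, hη0, hη1⟩ := hF.shared h0
  have hηpos := hF.supergrad_old_pos h0 hF.us_lt hη0
  have hb := hx.of_between hμ hF h0 hF.us_lt.le hη0 (y := fun _ => us) measurable_const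
    (fun t => by rcases le_total (x t) us with h | h <;> simp [h])
  have hlt : ∀ τ, 0 ≤ τ → value μ f₀ f₁ x τ < value μ f₀ f₁ (fun _ => us) τ := by
    intro τ _
    have h1 := hb.2 τ
    have hus := integrable_const (μ := μ) us
    rw [integral_sub hus.integrableOn hx.integrable.integrableOn] at h1
    have h2 := tail_add hx.integrable τ
    have h3 := tail_add hus τ
    rw [integral_eq_tail_zero hμ, tail_const, tail_const, measureReal_Ioi_zero hμ] at h3
    rw [integral_eq_tail_zero hμ, ← mul_cont hμ (x := x), ← mul_cont hμ (x := x),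
      measureReal_Ioi_zero hμ] at h2
    have hmem : f₁ (cont μ x τ) ≤ f₁ us + η * (cont μ x τ - us) :=
      hη1 _ (hx.cont_mem_new hμ hF τ)
    have h5 := mul_le_mul_of_nonneg_left hmem (hμ.tail_pos τ).le
    have h6 : 0 < η * (us - cont μ x 0) := mul_pos hηpos (by linarith)
    unfold value
    rw [cont_const hμ]
    nlinarith
  exact absurd (hE _ hb.1 (fun τ hτ => (hlt τ hτ).le) 0 le_rfl) (hlt 0 le_rfl).ne'

/-- Flattening at `us` after `T` is neutral, so `f₁` is on its supporting line of slope `η` at every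
later continuation value. If some differed from `us`, continuity would give values `v` arbitrarily
near `us`; there `f₀` is below its line of the same slope, so `f₁ - f₀` is no smaller at `v` than at
`us`, against the strict local maximum. If `us = 0`, no flow remains after `T`. -/
theorem Efficient.cont_eq_us (hμ : IsDiscount μ) (hF : FrontierPair f₀ f₁ I₀ I₁ u₀ u₁ us)
    (hx : Admissible μ f₀ I₀ u₀ x) (hE : Efficient μ f₀ f₁ I₀ u₀ x) {T : ℝ} (hT : 0 ≤ T)
    (hTu : cont μ x T = us) {τ : ℝ} (hτ : T ≤ τ) : cont μ x τ = us := by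
  have := hμ.prob
  rcases hF.us_nonneg.eq_or_lt with h0 | h0
  · have h1 : tail μ x T = 0 := by rw [← mul_cont hμ, hTu, ← h0, mul_zero]
    have h2 := tail_sub_tail hx.integrable hτ
    have h3 : 0 ≤ ∫ s in Ioc T τ, x s ∂μ := integral_nonneg hx.nonneg
    have h4 := (hx.cont_mem hμ τ).1
    have h5 := mul_cont hμ (x := x) τ
    have h6 := hμ.tail_pos τ
    rw [← h0]
    nlinarith
  obtain ⟨η, hη0, hη1⟩ := hF.shared h0
  obtain ⟨ρ, hρ, hmax⟩ := Metric.mem_nhdsWithin_iff.1 (hF.strict_max h0)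
  by_contra hne
  set X := cont μ x
  have hXτ := hx.cont_mem hμ τ
  -- `θ` shrinks the displacement from `us` into the neighbourhood of the strict maximum.
  obtain ⟨θ, hθ0, hθ1, hθ2⟩ : ∃ θ : ℝ, 0 < θ ∧ θ < 1 ∧ θ * |X τ - us| < ρ := by
    have hpos : 0 < |X τ - us| := abs_pos.2 (sub_ne_zero.2 hne)
    refine ⟨min (1 / 2) (ρ / (2 * |X τ - us|)), by positivity,
      (min_le_left _ _).trans_lt (by norm_num), ?_⟩
    calc _ ≤ ρ / (2 * |X τ - us|) * |X τ - us| := by gcongr; exact min_le_right _ _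
      _ = ρ / 2 := by field_simp
      _ < ρ := by linarith
  set v := us + θ * (X τ - us) with hv
  have hvne : v ≠ us := by
    intro h
    have : θ * (X τ - us) = 0 := by linarith
    rcases mul_eq_zero.1 this with h | h
    · exact hθ0.ne' h
    · exact hne (sub_eq_zero.1 h)
  have hvmem : v ∈ uIcc (X T) (X τ) := by
    rw [hTu, mem_uIcc]
    rcases le_total us (X τ) with h | h
    · left; constructor <;> nlinarith
    · right; constructor <;> nlinarith
  obtain ⟨σ, hσ, hσv⟩ := intermediate_value_uIcc
    ((continuous_cont hμ hx.integrable).continuousOn) hvmem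
  rw [uIcc_of_le hτ] at hσ
  have hσT : T < σ := by
    refine lt_of_le_of_ne hσ.1 fun h => hvne ?_
    rw [← hσv, ← h]; exact hTu
  have hpos : ∀ τ, τ ∈ Ioi T → 0 ≤ τ → f₁ (X τ) ≤ f₁ us + η * (X τ - us) :=
    fun τ _ _ => hη1 _ (hx.cont_mem_new hμ hF τ)
  have heq := hE.eq_of_flatten hμ hF hx h0 hF.us_lt.le hη0 hTu (Or.inl rfl) hpos σ hσT
    (hT.trans hσT.le)
  have hv0 : 0 < v := by nlinarith [hXτ.1]
  have hvu : v ≤ u₀ := by rw [← hσv]; exact (hx.cont_mem hμ σ).2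
  have h1 := hη0 v (hF.mem_old hv0 hvu)
  have h2 : f₁ v - f₀ v < f₁ us - f₀ us := hmax ⟨by
    rw [Metric.mem_ball, Real.dist_eq, hv, add_sub_cancel_left, abs_mul, abs_of_pos hθ0]
    exact hθ2, hvne⟩
  rw [hσv] at heq
  linarith

theorem Efficient.us_le_cont (hμ : IsDiscount μ) (hF : FrontierPair f₀ f₁ I₀ I₁ u₀ u₁ us)
    (hx : Admissible μ f₀ I₀ u₀ x) (hE : Efficient μ f₀ f₁ I₀ u₀ x) {τ : ℝ} (hτ : 0 ≤ τ) :
    us ≤ cont μ x τ := by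
  have := hμ.prob
  by_contra hc
  rw [not_le] at hc
  obtain ⟨T, hT, hTu⟩ := intermediate_value_Icc' hτ
    ((continuous_cont hμ hx.integrable).continuousOn) ⟨hc.le, hE.us_le_cont_zero hμ hF hx⟩
  exact hc.ne (hE.cont_eq_us hμ hF hx hT.1 hTu hT.2)

/-- If the continuation value rises through some `u > us`, flatten the excursion above `u`. On it
`f₁` grows at rate at most `η`, less than the old slope `s` at `u`, so the flattening is strictly
profitable at `b`. -/
theorem Efficient.antitoneOn_cont (hμ : IsDiscount μ) (hF : FrontierPair f₀ f₁ I₀ I₁ u₀ u₁ us)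
    (hx : Admissible μ f₀ I₀ u₀ x) (hE : Efficient μ f₀ f₁ I₀ u₀ x) :
    AntitoneOn (cont μ x) (Ici 0) := by
  have := hμ.prob
  intro a ha b hb hab
  by_contra hc
  rw [not_le] at hc
  set X := cont μ x
  have hXc : Continuous X := continuous_cont hμ hx.integrable
  have hua := hE.us_le_cont hμ hF hx ha
  have hXb := (hx.cont_mem hμ b).2
  change us ≤ X a at hua
  change X b ≤ u₀ at hXb
  obtain ⟨u, hau, hub⟩ := exists_between hc
  have hu0 : 0 < u := by linarith [hF.us_nonneg]
  have hclosed : IsClosed {t | X t = u} := isClosed_eq hXc continuous_const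
  -- `T` is the last crossing of `u` before `b`; the excursion ends at the first return `S` after
  -- `b`, if there is one.
  obtain ⟨T, ⟨hTab, hTu⟩, hTmax⟩ := (isCompact_Icc.inter_right hclosed).exists_isGreatest
    (s := Icc a b ∩ {t | X t = u}) (by
      obtain ⟨t, ht, h⟩ := intermediate_value_Icc hab hXc.continuousOn ⟨hau.le, hub.le⟩
      exact ⟨t, ht, h⟩)
  have hright : ∀ t, T < t → t ≤ b → u ≤ X t := by
    intro t ht htb
    by_contra hlt
    rw [not_le] at hlt
    obtain ⟨t', ht', h⟩ := intermediate_value_Icc htb hXc.continuousOn ⟨hlt.le, hub.le⟩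
    have := hTmax ⟨⟨hTab.1.trans (ht.le.trans ht'.1), ht'.2⟩, h⟩
    linarith [ht'.1]
  have hTb : T < b := lt_of_le_of_ne hTab.2 fun h => by
    rw [h] at hTu; exact hub.ne hTu.symm
  obtain ⟨s, hs⟩ := hF.exists_supergrad_old hu0 (hub.trans_le hXb)
  obtain ⟨η, hη⟩ := hF.exists_supergrad_new hu0 (hub.trans_le hXb)
  have hgap := hF.gap u s η (hua.trans_lt hau) (hub.trans_le hXb) hs hη
  have hnew : ∀ τ, u ≤ X τ → f₁ (X τ) ≤ f₁ u + η * (X τ - u) := fun τ h =>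
    hη _ (hF.mem_new (hu0.trans_le h) (hx.cont_mem hμ τ).2)
  have key : ∀ J : Set ℝ, b ∈ J → (J = Ioi T ∨ ∃ S, T ≤ S ∧ X S = u ∧ J = Ioc T S) →
      (∀ t ∈ J, u ≤ X t) → False := by
    intro J hbJ hJ hJu
    have h1 := hE.eq_of_flatten hμ hF hx hu0 (hub.le.trans hXb) hs hTu hJ
      (fun τ hτ _ => (hnew τ (hJu τ hτ)).trans (by
        have := hJu τ hτ
        change _ ≤ _ + s * (X τ - u)
        nlinarith)) b hbJ hb
    have h2 := hnew b hub.le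
    change f₁ (X b) = f₁ u + s * (X b - u) at h1
    nlinarith
  by_cases hS : ∃ t, b ≤ t ∧ X t ≤ u
  · obtain ⟨c, hbc, hcu⟩ := hS
    obtain ⟨S, ⟨hSbc, hSu⟩, hSmin⟩ := (isCompact_Icc.inter_right hclosed).exists_isLeast
      (s := Icc b c ∩ {t | X t = u}) (by
        obtain ⟨t, ht, h⟩ := intermediate_value_Icc' hbc hXc.continuousOn ⟨hcu, hub.le⟩
        exact ⟨t, ht, h⟩)
    refine key (Ioc T S) ⟨hTb, hSbc.1⟩ (Or.inr ⟨S, hTb.le.trans hSbc.1, hSu, rfl⟩) ?_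
    intro t ht
    rcases le_total t b with htb | htb
    · exact hright t ht.1 htb
    · by_contra hlt
      rw [not_le] at hlt
      obtain ⟨t', ht', h⟩ := intermediate_value_Icc' htb hXc.continuousOn ⟨hlt.le, hub.le⟩
      have h1 := hSmin ⟨⟨ht'.1, ht'.2.trans (ht.2.trans hSbc.2)⟩, h⟩
      have h2 : t = S := le_antisymm ht.2 (h1.trans ht'.2)
      rw [h2] at hlt
      exact hlt.ne hSu
  · push Not at hS
    refine key (Ioi T) hTb (Or.inl rfl) fun t ht => ?_
    rcases le_total t b with htb | htb
    · exact hright t ht htb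
    · exact (hS t htb).le

theorem IsDiscount.ae_nonneg (hμ : IsDiscount μ) {w : ℝ → ℝ} (hw : Integrable w μ)
    (h : ∀ a b, 0 ≤ a → a ≤ b → 0 ≤ ∫ t in Ioc a b, w t ∂μ) : ∀ᵐ t ∂μ, 0 ≤ w t := by
  have := hμ.prob
  have := hμ.noAtoms
  refine ae_nonneg_of_forall_Ioc hw fun a b hab => ?_
  have h1 : Ioc a b =ᵐ[μ] Ioc (max a 0) (max b 0) := by
    filter_upwards [hμ.ae_pos] with t ht
    simp only [eq_iff_iff]
    change (a < t ∧ t ≤ b) ↔ (max a 0 < t ∧ t ≤ max b 0)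
    simp [ht, not_le.2 ht]
  rw [setIntegral_congr_set h1]
  exact h _ _ (le_max_right _ _) (max_le_max hab le_rfl)

/-- On `(a, b]` the integral of the flow minus `cont μ x a` is `μ(b,∞) (cont μ x a - cont μ x b) ≥
0`, and the continuation value is at most `cont μ x a` there. -/
theorem cont_le_ae (hμ : IsDiscount μ) (hx : Admissible μ f₀ I₀ u₀ x)
    (hX : AntitoneOn (cont μ x) (Ici 0)) : ∀ᵐ t ∂μ, cont μ x t ≤ x t := by
  have := hμ.prob
  have hXi : Integrable (cont μ x) μ :=
    integrable_of_bounds (continuous_cont hμ hx.integrable).measurable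
      (fun t => (hx.cont_mem hμ t).1) (fun t => (hx.cont_mem hμ t).2)
  have := hμ.ae_nonneg (hx.integrable.sub hXi) (fun a b ha hab => by
    have h1 : ∫ t in Ioc a b, cont μ x t ∂μ ≤ ∫ t in Ioc a b, cont μ x a ∂μ :=
      setIntegral_mono_on hXi.integrableOn (integrable_const _).integrableOn measurableSet_Ioc
        (fun t ht => hX ha (ha.trans ht.1.le) ht.1.le)
    rw [setIntegral_const, smul_eq_mul, measureReal_Ioc hab] at h1
    have h2 := tail_sub_tail hx.integrable hab
    rw [← mul_cont hμ (x := x), ← mul_cont hμ (x := x)] at h2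
    have h3 := mul_le_mul_of_nonneg_left (hX ha (ha.trans hab) hab) (hμ.tail_pos b).le
    simp only [Pi.sub_apply]
    rw [integral_sub hx.integrable.integrableOn hXi.integrableOn]
    linarith)
  filter_upwards [this] with t ht
  simpa using ht

end Core

/-! ### Transfers between dates and monotonicity of the flow -/

section Core

variable {μ : Measure ℝ} {f₀ f₁ : ℝ → ℝ} {I₀ I₁ : Set ℝ} {u₀ u₁ us : ℝ} {x y : ℝ → ℝ}

/-- The equality case of `SupergradOn.lower_bound`: concavity carries equality at an intermediate
point over to a bound at the far end `m`. It extracts information from neutral transfers. -/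
theorem SupergradOn.le_line_of_eq {f : ℝ → ℝ} {I : Set ℝ} {m s x y : ℝ} (hf : ConcaveOn ℝ I f)
    (hm : m ∈ I) (hx : x ∈ I) (hy : (x ≤ y ∧ y ≤ m) ∨ (m ≤ y ∧ y ≤ x)) (hne : y ≠ x)
    (h : f y = f x + s * (y - x)) : f m ≤ f x + s * (m - x) := by
  have hd : m - x ≠ 0 := fun h => hne (by rcases hy with h' | h' <;> linarith [h'.1, h'.2])
  set b := (y - x) / (m - x) with hb
  have hbm : b * (m - x) = y - x := by rw [hb]; field_simp
  have hb01 : 0 < b ∧ b ≤ 1 := by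
    rcases hy with ⟨h1, h2⟩ | ⟨h1, h2⟩
    · have h3 : 0 < m - x := lt_of_le_of_ne (by linarith) hd.symm
      have h4 : x < y := lt_of_le_of_ne h1 hne.symm
      exact ⟨div_pos (by linarith) h3, (div_le_one h3).2 (by linarith)⟩
    · have h3 : m - x < 0 := lt_of_le_of_ne (by linarith) hd
      have h4 : y < x := lt_of_le_of_ne h2 hne
      exact ⟨div_pos_of_neg_of_neg (by linarith) h3, (div_le_one_of_neg h3).2 (by linarith)⟩
  have hyeq : (1 - b) • x + b • m = y := by simp only [smul_eq_mul]; linarith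
  have h1 := hf.2 hx hm (sub_nonneg.2 hb01.2) hb01.1.le (by ring)
  rw [hyeq, h, ← hbm] at h1
  simp only [smul_eq_mul] at h1
  have h2 : b * f m ≤ b * (f x + s * (m - x)) := by nlinarith
  exact le_of_mul_le_mul_left h2 hb01.1

theorem tail_mem_Icc [IsFiniteMeasure μ] {h : ℝ → ℝ} (hi : Integrable h μ) (h0 : ∀ t, 0 ≤ h t)
    (τ : ℝ) : 0 ≤ tail μ h τ ∧ tail μ h τ ≤ ∫ t, h t ∂μ := by
  refine ⟨integral_nonneg h0, ?_⟩
  have := tail_add hi τ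
  have h1 : 0 ≤ ∫ t in Iic τ, h t ∂μ := integral_nonneg h0
  linarith

theorem tail_eq_zero {h : ℝ → ℝ} {τ : ℝ} (h0 : ∀ t, τ < t → h t = 0) : tail μ h τ = 0 := by
  rw [tail, setIntegral_congr_fun measurableSet_Ioi (g := fun _ => 0) (fun t ht => h0 t ht)]
  simp

theorem tail_eq_integral [IsFiniteMeasure μ] {h : ℝ → ℝ} (hi : Integrable h μ) {τ : ℝ}
    (h0 : ∀ t, t ≤ τ → h t = 0) : tail μ h τ = ∫ t, h t ∂μ := by
  have := tail_add hi τ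
  rw [setIntegral_congr_fun measurableSet_Iic (g := fun _ => 0) (fun t ht => h0 t ht)] at this
  simpa using this

/-- Moving a small amount of flow between an earlier set `P` and a later set `Q`, towards a level
`m` that separates the flow on `P` from the flow on `Q`. -/
theorem exists_transfer (hμ : IsDiscount μ) (hx : Admissible μ f₀ I₀ u₀ x) {m c₀ c c₁ ε κ : ℝ}
    (hε : ε = 1 ∨ ε = -1) (hκ : 0 < κ) {P Q : Set ℝ} (hP : MeasurableSet P) (hQ : MeasurableSet Q)
    (hPc : P ⊆ Ioc c₀ c) (hQc : Q ⊆ Ioc c c₁) (hP0 : 0 < μ P) (hQ0 : 0 < μ Q)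
    (hPm : ∀ t ∈ P, 0 < ε * (m - x t)) (hQm : ∀ t ∈ Q, 0 < ε * (x t - m)) :
    ∃ y : ℝ → ℝ, Measurable y ∧ (∀ t, (x t ≤ y t ∧ y t ≤ m) ∨ (m ≤ y t ∧ y t ≤ x t)) ∧
      (∫ t, y t ∂μ = ∫ t, x t ∂μ) ∧ (∀ τ, 0 ≤ ε * (cont μ x τ - cont μ y τ)) ∧
      (∀ τ, ε * (cont μ x τ - cont μ y τ) ≤ κ) ∧
      (∀ τ, τ ≤ c₀ ∨ c₁ ≤ τ → cont μ y τ = cont μ x τ) ∧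
      0 < ε * (cont μ x c - cont μ y c) ∧ ∀ t ∈ Q, y t ≠ x t := by
  have := hμ.prob
  have hεε : ε * ε = 1 := by rcases hε with rfl | rfl <;> norm_num
  set h₁ : ℝ → ℝ := P.indicator fun t => ε * (m - x t) with hh₁
  set h₂ : ℝ → ℝ := Q.indicator fun t => ε * (x t - m) with hh₂
  have hi₁ : Integrable h₁ μ := (((integrable_const m).sub hx.integrable).const_mul ε).indicator hP
  have hi₂ : Integrable h₂ μ := ((hx.integrable.sub (integrable_const m)).const_mul ε).indicator hQ
  have hm₁ : Measurable h₁ := ((measurable_const.sub hx.meas).const_mul ε).indicator hP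
  have hm₂ : Measurable h₂ := ((hx.meas.sub measurable_const).const_mul ε).indicator hQ
  have h0₁ : ∀ t, 0 ≤ h₁ t := indicator_nonneg fun t ht => (hPm t ht).le
  have h0₂ : ∀ t, 0 ≤ h₂ t := indicator_nonneg fun t ht => (hQm t ht).le
  have hout₁ : ∀ t, t ∉ P → h₁ t = 0 := fun t ht => indicator_of_notMem ht _
  have hout₂ : ∀ t, t ∉ Q → h₂ t = 0 := fun t ht => indicator_of_notMem ht _
  have hin₁ : ∀ t, t ∈ P → h₁ t = ε * (m - x t) := fun t ht => indicator_of_mem ht _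
  have hin₂ : ∀ t, t ∈ Q → h₂ t = ε * (x t - m) := fun t ht => indicator_of_mem ht _
  set wP := ∫ t, h₁ t ∂μ with hwP
  set wQ := ∫ t, h₂ t ∂μ with hwQ
  have hwP0 : 0 < wP := by
    rw [hwP, integral_pos_iff_support_of_nonneg h0₁ hi₁]
    exact hP0.trans_le (measure_mono fun t ht => by
      rw [Function.mem_support, hin₁ t ht]; exact (hPm t ht).ne')
  have hwQ0 : 0 < wQ := by
    rw [hwQ, integral_pos_iff_support_of_nonneg h0₂ hi₂]
    exact hQ0.trans_le (measure_mono fun t ht => by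
      rw [Function.mem_support, hin₂ t ht]; exact (hQm t ht).ne')
  -- The first two bounds keep `y` between `x` and `m`. The third caps the shift of the continuation
  -- value by `κ`; dividing by the tail mass is harmless, because the shift vanishes from `c₁` on.
  obtain ⟨θ, hθ0, hθP, hθQ, hθκ⟩ : ∃ θ : ℝ, 0 < θ ∧ θ * wP ≤ 1 ∧ θ * wQ ≤ 1 ∧
      θ * (wP * wQ) ≤ κ * μ.real (Ioi c₁) := by
    have he := hμ.tail_pos c₁
    refine ⟨min (1 / wP) (min (1 / wQ) (κ * μ.real (Ioi c₁) / (wP * wQ))), by positivity, ?_, ?_, ?_⟩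
    · rw [← le_div_iff₀ hwP0]; exact min_le_left _ _
    · rw [← le_div_iff₀ hwQ0]; exact (min_le_right _ _).trans (min_le_left _ _)
    · rw [← le_div_iff₀ (mul_pos hwP0 hwQ0)]; exact (min_le_right _ _).trans (min_le_right _ _)
  have hPQ : ∀ t, t ∈ P → t ∉ Q := fun t h h' => absurd (hPc h).2 (not_le.2 (hQc h').1)
  -- Weighting each set by the mass of the other makes the transfer balanced. With `ε = 1` flow
  -- moves from `Q` back to the earlier `P`, with `ε = -1` from `P` forward to `Q`.
  set y : ℝ → ℝ := fun t => x t + ε * θ * (wQ * h₁ t - wP * h₂ t) with hy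
  have hyi : Integrable (fun t => ε * θ * (wQ * h₁ t - wP * h₂ t)) μ :=
    ((hi₁.const_mul wQ).sub (hi₂.const_mul wP)).const_mul (ε * θ)
  have hyP : ∀ t ∈ P, y t - x t = θ * wQ * (m - x t) := by
    intro t ht
    have : y t - x t = (ε * ε) * (θ * wQ * (m - x t)) := by
      simp only [hy, hin₁ t ht, hout₂ t (hPQ t ht)]; ring
    rw [this, hεε, one_mul]
  have hyQ : ∀ t ∈ Q, y t - x t = θ * wP * (m - x t) := by
    intro t ht
    have : y t - x t = (ε * ε) * (θ * wP * (m - x t)) := by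
      simp only [hy, hin₂ t ht, hout₁ t (fun h => hPQ t h ht)]; ring
    rw [this, hεε, one_mul]
  have hbet : ∀ t b, 0 ≤ b → b ≤ 1 → y t - x t = b * (m - x t) →
      (x t ≤ y t ∧ y t ≤ m) ∨ (m ≤ y t ∧ y t ≤ x t) := by
    intro t b hb0 hb1 h
    rcases le_total (x t) m with h1 | h1
    · left; constructor <;> nlinarith
    · right; constructor <;> nlinarith
  have htail : ∀ τ, tail μ x τ - tail μ y τ = ε * (θ * (wP * tail μ h₂ τ - wQ * tail μ h₁ τ)) := by
    intro τ
    have : tail μ y τ = tail μ x τ + ε * θ * (wQ * tail μ h₁ τ - wP * tail μ h₂ τ) := by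
      simp only [tail, hy]
      rw [integral_add hx.integrable.integrableOn hyi.integrableOn, integral_const_mul,
        integral_sub (hi₁.const_mul wQ).integrableOn (hi₂.const_mul wP).integrableOn,
        integral_const_mul, integral_const_mul]
    rw [this]; ring
  have hcont : ∀ τ, ε * (cont μ x τ - cont μ y τ) =
      θ * (wP * tail μ h₂ τ - wQ * tail μ h₁ τ) / μ.real (Ioi τ) := by
    intro τ
    rw [cont, cont, ← sub_div, htail, ← mul_div_assoc, ← mul_assoc, hεε, one_mul]
  have hb₁ := tail_mem_Icc hi₁ h0₁
  have hb₂ := tail_mem_Icc hi₂ h0₂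
  have hz₁ : ∀ τ, c ≤ τ → tail μ h₁ τ = 0 := fun τ hτ =>
    tail_eq_zero fun t ht => hout₁ t fun h => absurd (hPc h).2 (not_le.2 (hτ.trans_lt ht))
  have hz₂ : ∀ τ, τ ≤ c → tail μ h₂ τ = wQ := fun τ hτ =>
    tail_eq_integral hi₂ fun t ht => hout₂ t fun h => absurd (hQc h).1 (not_lt.2 (ht.trans hτ))
  have hnn : ∀ τ, 0 ≤ wP * tail μ h₂ τ - wQ * tail μ h₁ τ ∧
      wP * tail μ h₂ τ - wQ * tail μ h₁ τ ≤ wP * wQ := by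
    intro τ
    have h1 := hb₁ τ
    have h2 := hb₂ τ
    rcases le_total τ c with h | h
    · rw [hz₂ τ h]; constructor <;> nlinarith
    · rw [hz₁ τ h]; constructor <;> nlinarith
  have hzero : ∀ τ, τ ≤ c₀ ∨ c₁ ≤ τ → wP * tail μ h₂ τ - wQ * tail μ h₁ τ = 0 := by
    have hcne := nonempty_of_measure_ne_zero hP0.ne'
    obtain ⟨p, hp⟩ := hcne
    obtain ⟨q, hq⟩ := nonempty_of_measure_ne_zero hQ0.ne'
    have hc0 : c₀ < c := (hPc hp).1.trans_le (hPc hp).2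
    have hc1 : c < c₁ := (hQc hq).1.trans_le (hQc hq).2
    rintro τ (h | h)
    · rw [hz₂ τ (h.trans hc0.le), tail_eq_integral hi₁ fun t ht => hout₁ t fun h' =>
        absurd (hPc h').1 (not_lt.2 (ht.trans h))]
      ring
    · rw [hz₁ τ (hc1.le.trans h), tail_eq_zero fun t ht => hout₂ t fun h' =>
        absurd (hQc h').2 (not_le.2 (h.trans_lt ht))]
      ring
  refine ⟨y, ?_, ?_, ?_, ?_, ?_, ?_, ?_, ?_⟩
  · exact hx.meas.add (((hm₁.const_mul wQ).sub (hm₂.const_mul wP)).const_mul (ε * θ))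
  · intro t
    by_cases hP' : t ∈ P
    · exact hbet t _ (by positivity) hθQ (hyP t hP')
    by_cases hQ' : t ∈ Q
    · exact hbet t _ (by positivity) hθP (hyQ t hQ')
    · exact hbet t 0 le_rfl zero_le_one (by simp [hy, hout₁ t hP', hout₂ t hQ'])
  · simp only [hy]
    rw [integral_add hx.integrable hyi, integral_const_mul,
      integral_sub (hi₁.const_mul wQ) (hi₂.const_mul wP), integral_const_mul, integral_const_mul]
    ring
  · intro τ
    rw [hcont]
    exact div_nonneg (mul_nonneg hθ0.le (hnn τ).1) (hμ.tail_pos τ).le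
  · intro τ
    rw [hcont]
    by_cases hτ : c₁ ≤ τ
    · rw [hzero τ (Or.inr hτ)]; simpa using hκ.le
    · rw [div_le_iff₀ (hμ.tail_pos τ)]
      have h1 : μ.real (Ioi c₁) ≤ μ.real (Ioi τ) :=
        measureReal_mono (Ioi_subset_Ioi (not_le.1 hτ).le)
      have h2 := mul_le_mul_of_nonneg_left (hnn τ).2 hθ0.le
      nlinarith
  · intro τ hτ
    have := hcont τ
    rw [hzero τ hτ] at this
    simp only [mul_zero, zero_div, mul_eq_zero] at this
    rcases this with h | h
    · rw [h] at hεε; norm_num at hεε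
    · linarith
  · rw [hcont, hz₁ c le_rfl, hz₂ c le_rfl]
    have := hμ.tail_pos c
    rw [mul_zero, sub_zero]
    positivity
  · intro t ht h
    have h1 := hyQ t ht
    have h2 := hQm t ht
    have h3 : m - x t = 0 := by
      have h4 : θ * wP * (m - x t) = 0 := by rw [← h1, h, sub_self]
      exact (mul_eq_zero.1 h4).resolve_left (mul_pos hθ0 hwP0).ne'
    rw [← neg_sub, h3] at h2
    simp at h2

theorem exists_Ioc_pos (A : Set ℝ) {T : ℝ} (h : 0 < μ (A ∩ Ioi T)) :
    ∃ n, T < n ∧ 0 < μ (A ∩ Ioc T n) := by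
  by_contra hc
  push Not at hc
  have hU : A ∩ Ioi T = ⋃ n : ℕ, A ∩ Ioc T (T + (n + 1)) := by
    rw [← inter_iUnion]
    congr 1
    ext t
    simp only [mem_Ioi, mem_iUnion, mem_Ioc]
    refine ⟨fun ht => ?_, fun ⟨n, hn⟩ => hn.1⟩
    obtain ⟨n, hn⟩ := exists_nat_ge (t - T)
    exact ⟨n, ht, by linarith⟩
  rw [hU] at h
  exact h.ne' (measure_iUnion_null fun n => nonpos_iff_eq_zero.1
    (hc _ (by linarith [Nat.cast_nonneg (α := ℝ) n])))

/-- Without atoms the remaining mass of `A` is continuous in time, so it takes a value strictly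
between those at `a` and `b`. -/
theorem exists_split_Ioc (hμ : IsDiscount μ) {A : Set ℝ} (hA : MeasurableSet A) {a b : ℝ}
    (hab : a < b) (h : 0 < μ (A ∩ Ioc a b)) :
    ∃ c, a < c ∧ c < b ∧ 0 < μ (A ∩ Ioc a c) ∧ 0 < μ (A ∩ Ioc c b) := by
  have := hμ.prob
  have hi : Integrable (A.indicator fun _ => (1 : ℝ)) μ := (integrable_const 1).indicator hA
  have hg : ∀ c d, c ≤ d → tail μ (A.indicator fun _ => (1 : ℝ)) c -
      tail μ (A.indicator fun _ => (1 : ℝ)) d = μ.real (A ∩ Ioc c d) := by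
    intro c d hcd
    rw [tail_sub_tail hi hcd, setIntegral_indicator hA]
    simp [inter_comm]
  set g := tail μ (A.indicator fun _ => (1 : ℝ))
  have hpos : 0 < μ.real (A ∩ Ioc a b) := ENNReal.toReal_pos h.ne' (measure_ne_top _ _)
  rw [← hg a b hab.le] at hpos
  have hab' : g b < g a := by linarith
  obtain ⟨v, hv1, hv2⟩ := exists_between hab'
  obtain ⟨c, hc, hcv⟩ := intermediate_value_Icc' hab.le (continuous_tail hμ hi).continuousOn
    ⟨hv1.le, hv2.le⟩
  change g c = v at hcv
  refine ⟨c, lt_of_le_of_ne hc.1 fun h => ?_, lt_of_le_of_ne hc.2 fun h => ?_, ?_, ?_⟩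
  · rw [← h] at hcv; linarith
  · rw [h] at hcv; linarith
  · have h1 := hg a c hc.1
    exact (ENNReal.toReal_pos_iff.1 (show 0 < μ.real (A ∩ Ioc a c) by linarith)).1
  · have h1 := hg c b hc.2
    exact (ENNReal.toReal_pos_iff.1 (show 0 < μ.real (A ∩ Ioc c b) by linarith)).1

/-- On `(a, b]` the flow lies above its continuation value, hence above the constant `cont μ x a`,
and its average there equals that constant. -/
theorem ae_eq_of_cont_eq (hμ : IsDiscount μ) (hx : Admissible μ f₀ I₀ u₀ x)
    (hX : AntitoneOn (cont μ x) (Ici 0)) {a b : ℝ} (ha : 0 ≤ a) (hab : a ≤ b)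
    (h : cont μ x b = cont μ x a) : ∀ᵐ t ∂μ, t ∈ Ioc a b → x t = cont μ x a := by
  have := hμ.prob
  have h1 := tail_sub_tail hx.integrable hab
  rw [← mul_cont hμ (x := x), ← mul_cont hμ (x := x), h] at h1
  have h2 : ∫ t in Ioc a b, (x t - cont μ x a) ∂μ = 0 := by
    rw [integral_sub hx.integrable.integrableOn (integrable_const _).integrableOn,
      setIntegral_const, smul_eq_mul, measureReal_Ioc hab]
    linarith
  have hi : Integrable (fun t => x t - cont μ x a) μ := hx.integrable.sub (integrable_const _)
  rw [integral_eq_zero_iff_of_nonneg_ae _ hi.integrableOn,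
    Filter.EventuallyEq, ae_restrict_iff' measurableSet_Ioc] at h2
  · filter_upwards [h2] with t ht htab
    have := ht htab
    simp only [Pi.zero_apply] at this
    linarith
  · rw [Filter.EventuallyLE, ae_restrict_iff' measurableSet_Ioc]
    filter_upwards [cont_le_ae hμ hx hX] with t ht htab
    have := hX (ha.trans htab.1.le) (ha.trans hab) htab.2
    simp only [Pi.zero_apply]
    linarith

theorem cont_lt_of_pos (hμ : IsDiscount μ) (hx : Admissible μ f₀ I₀ u₀ x)
    (hX : AntitoneOn (cont μ x) (Ici 0)) {a b : ℝ} (ha : 0 ≤ a) (hab : a ≤ b) {A : Set ℝ}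
    (hA : 0 < μ (A ∩ Ioc a b)) (h : ∀ t ∈ A, x t ≠ cont μ x a) : cont μ x b < cont μ x a := by
  refine lt_of_le_of_ne (hX ha (ha.trans hab) hab) fun heq => hA.ne' ?_
  have h1 := ae_eq_of_cont_eq hμ hx hX ha hab heq
  rw [ae_iff] at h1
  refine measure_mono_null (fun t ht => ?_) h1
  simp only [mem_ofPred_eq, Classical.not_imp]
  exact ⟨ht.2, h t ht.1⟩

/-- A flow cannot exceed its own average almost everywhere. -/
theorem measure_le_cont_pos (hμ : IsDiscount μ) (hx : Admissible μ f₀ I₀ u₀ x) (n : ℝ) :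
    0 < μ ({t | x t ≤ cont μ x n} ∩ Ioi n) := by
  have := hμ.prob
  rw [pos_iff_ne_zero]
  intro h0
  have hlt : ∀ᵐ t ∂μ, t ∈ Ioi n → cont μ x n < x t := by
    rw [ae_iff]
    refine measure_mono_null (fun t ht => ?_) h0
    simp only [mem_ofPred_eq, Classical.not_imp, not_lt] at ht
    exact ⟨ht.2, ht.1⟩
  have h1 : ∫ t in Ioi n, (x t - cont μ x n) ∂μ = 0 := by
    rw [integral_sub hx.integrable.integrableOn (integrable_const _).integrableOn,
      setIntegral_const, smul_eq_mul, mul_cont hμ]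
    exact sub_self _
  have hi : Integrable (fun t => x t - cont μ x n) μ := hx.integrable.sub (integrable_const _)
  rw [integral_eq_zero_iff_of_nonneg_ae _ hi.integrableOn,
    Filter.EventuallyEq, ae_restrict_iff' measurableSet_Ioi] at h1
  · have h2 : μ (Ioi n) = 0 := by
      have h3 : ∀ᵐ t ∂μ, t ∉ Ioi n := by
        filter_upwards [h1, hlt] with t ht1 ht2 ht
        have h4 := ht1 ht
        have h5 := ht2 ht
        simp only [Pi.zero_apply] at h4
        linarith
      rw [ae_iff] at h3
      simpa only [not_not, ofPred_mem_eq] using h3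
    have := hμ.tail_pos n
    rw [measureReal_def, h2] at this
    simp at this
  · rw [Filter.EventuallyLE, ae_restrict_iff' measurableSet_Ioi]
    filter_upwards [hlt] with t ht htn
    have := ht htn
    simp only [Pi.zero_apply]
    linarith

end Core

section Core

variable {μ : Measure ℝ} {f₀ f₁ : ℝ → ℝ} {I₀ I₁ : Set ℝ} {u₀ u₁ us : ℝ} {x y : ℝ → ℝ}

/-- After a time `T`, the old frontier is at least as steep at the flow as the new frontier is at
the continuation value at `T`. -/
theorem Efficient.flow_le (hμ : IsDiscount μ) (hF : FrontierPair f₀ f₁ I₀ I₁ u₀ u₁ us)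
    (hx : Admissible μ f₀ I₀ u₀ x) (hE : Efficient μ f₀ f₁ I₀ u₀ x) {T η v s : ℝ} (hT : 0 ≤ T)
    (hTs : us < cont μ x T) (hTu : cont μ x T < u₀) (hη : SupergradOn f₁ I₁ (cont μ x T) η)
    (hv0 : 0 < v) (hvu : v < u₀) (hs : SupergradOn f₀ I₀ v s) (hsη : s ≤ η) :
    μ ({t | v < x t} ∩ Ioi T) = 0 := by
  have := hμ.prob
  have hX := hE.antitoneOn_cont hμ hF hx
  have hXT0 : 0 < cont μ x T := hF.us_nonneg.trans_lt hTs
  have hvI := hF.mem_old hv0 hvu.le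
  have hXI := hF.mem_old hXT0 hTu.le
  -- The target of the contradiction: the gap would give `η < s` if `s` were an old supergradient at
  -- the continuation value.
  have hnot : ¬ SupergradOn f₀ I₀ (cont μ x T) s := fun h =>
    absurd (hF.gap _ s η hTs hTu h hη) (not_lt.2 hsη)
  have hXv : cont μ x T < v := by
    by_contra hc
    rw [not_lt] at hc
    rcases hc.eq_or_lt with h | h
    · exact hnot (h ▸ hs)
    obtain ⟨s', hs'⟩ := hF.exists_supergrad_old hXT0 hTu
    have h1 := hF.gap _ s' η hTs hTu hs' hη
    have h2 := hs' v hvI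
    have h3 := hs _ hXI
    nlinarith
  by_contra hne
  obtain ⟨n, hTn, hn⟩ := exists_Ioc_pos {t | v < x t} (pos_iff_ne_zero.2 hne)
  have hAm : MeasurableSet {t | v < x t} := measurableSet_lt measurable_const hx.meas
  -- Part of the high flow is kept on `(T, t₁]`, to make the continuation value drop strictly there;
  -- the rest, on `(t₁, n]`, is available for transfer.
  obtain ⟨t₁, hTt, htn, hA1, hA2⟩ := exists_split_Ioc hμ hAm hTn hn
  have hlt : cont μ x t₁ < cont μ x T := cont_lt_of_pos hμ hx hX hT hTt.le hA1
    (fun t ht => (hXv.trans ht).ne')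
  have hBm : MeasurableSet {t | x t ≤ cont μ x T} := measurableSet_le hx.meas measurable_const
  have hB : 0 < μ ({t | x t ≤ cont μ x T} ∩ Ioi n) :=
    (measure_le_cont_pos hμ hx n).trans_le (measure_mono (inter_subset_inter_left _
      fun t (ht : x t ≤ _) => ht.trans (hX hT (hT.trans hTn.le) hTn.le)))
  obtain ⟨c₁, hnc, hB1⟩ := exists_Ioc_pos _ hB
  -- Postponing flow from `(t₁, n]` to low-flow times after `n` raises continuation values, but by
  -- `κ` never above `cont μ x T`. There `f₁` grows at rate at least `η ≥ s`, so the transfer costs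
  -- nothing and must be neutral.
  obtain ⟨y, hym, hyb, hxy, hy0, hyκ, hyout, -, hyQ⟩ := exists_transfer hμ hx (m := v) (c₀ := t₁)
    (c := n) (c₁ := c₁) (ε := -1) (κ := cont μ x T - cont μ x t₁) (Or.inr rfl) (by linarith)
    (hAm.inter measurableSet_Ioc) (hBm.inter measurableSet_Ioc) inter_subset_right
    inter_subset_right hA2 hB1 (fun t ht => by
      have : v < x t := ht.1
      linarith) (fun t ht => by
      have : x t ≤ cont μ x T := ht.1
      linarith)
  have heq := (hE.eq_of_between hμ hF hx hv0 hvu.le hs hym hyb hxy (fun τ hτ => by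
    by_cases hτ1 : τ ≤ t₁ ∨ c₁ ≤ τ
    · rw [hyout τ hτ1]; simp
    push Not at hτ1
    have h1 := hy0 τ
    have h2 := hyκ τ
    have h3 := hX (hT.trans hTt.le) hτ hτ1.1.le
    have h4 := hη.le_sub_of_le hF.conc_new (hF.subset_new hXI) (hx.cont_mem_new hμ hF τ)
      (v := cont μ y τ) (by linarith) (by linarith)
    have h5 : s * (cont μ y τ - cont μ x τ) ≤ η * (cont μ y τ - cont μ x τ) :=
      mul_le_mul_of_nonneg_right hsη (by linarith)
    linarith)).2
  have hpos : ∃ t, t ∈ {t | x t ≤ cont μ x T} ∩ Ioc n c₁ ∧ x t ∈ I₀ ∧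
      f₀ (y t) = f₀ (x t) + s * (y t - x t) := by
    by_contra hc
    push Not at hc
    refine hB1.ne' (measure_mono_null (fun t ht => ?_) (ae_iff.1 (hx.ae_mem.and heq)))
    exact fun h => hc t ht h.1 h.2
  obtain ⟨t, ht, htI, hteq⟩ := hpos
  -- Neutrality bounds `f₀ v` by the line of slope `s` from some `x t ≤ cont μ x T < v`. Then `s` is
  -- an old supergradient at the intermediate `cont μ x T` too.
  have h1 := SupergradOn.le_line_of_eq hF.conc_old hvI htI (hyb t) (hyQ t ht) hteq
  have h2 := (hs.lower_bound hF.conc_old hvI htI (y := cont μ x T) (Or.inl ⟨ht.1, hXv.le⟩)).2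
  refine hnot fun w hw => ?_
  have h3 := hs w hw
  linarith

/-- The flow of an efficient mechanism never rises. -/
theorem Efficient.flow_antitone (hμ : IsDiscount μ) (hF : FrontierPair f₀ f₁ I₀ I₁ u₀ u₁ us)
    (hx : Admissible μ f₀ I₀ u₀ x) (hE : Efficient μ f₀ f₁ I₀ u₀ x) {p q T₀ : ℝ} (hT₀ : 0 ≤ T₀)
    (hpq : p < q) (hA : 0 < μ ({t | x t ≤ p} ∩ Ioc 0 T₀)) : μ ({t | q ≤ x t} ∩ Ioi T₀) = 0 := by
  have := hμ.prob
  have hX := hE.antitoneOn_cont hμ hF hx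
  have hAm : MeasurableSet {t | x t ≤ p} := measurableSet_le hx.meas measurable_const
  have hBm : MeasurableSet {t | q ≤ x t} := measurableSet_le measurable_const hx.meas
  by_contra hne
  obtain ⟨n, hTn, hn⟩ := exists_Ioc_pos {t | q ≤ x t} (pos_iff_ne_zero.2 hne)
  obtain ⟨T, hT0T, hTn', hB1, hB2⟩ := exists_split_Ioc hμ hBm hTn hn
  obtain ⟨c₁, hT0c, hcT, hB3, hB4⟩ := exists_split_Ioc hμ hBm hT0T hB1
  have hT : 0 ≤ T := hT₀.trans hT0T.le
  -- At some time before `T₀` the flow is at most `p` yet at least the continuation value, which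
  -- decreases afterwards.
  have hXp : cont μ x T ≤ p := by
    obtain ⟨t, ht, hle⟩ : ∃ t, t ∈ {t | x t ≤ p} ∩ Ioc 0 T₀ ∧ cont μ x t ≤ x t := by
      by_contra hc
      push Not at hc
      exact hA.ne' (measure_mono_null (fun t ht => not_le.2 (hc t ht))
        (ae_iff.1 (cont_le_ae hμ hx hX)))
    exact (hX ht.2.1.le hT (ht.2.2.trans hT0T.le)).trans (hle.trans ht.1)
  have hqu : q ≤ u₀ := by
    obtain ⟨t, ht⟩ := nonempty_of_measure_ne_zero hB1.ne'
    exact le_trans ht.1 (hx.le t)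
  -- At `us` the continuation value would stay constant, incompatible with flow above `q` after `T`.
  have hTs : us < cont μ x T := by
    refine lt_of_le_of_ne (hE.us_le_cont hμ hF hx hT) fun h => ?_
    have h1 := hE.cont_eq_us hμ hF hx hT h.symm hTn'.le
    have h2 := cont_lt_of_pos hμ hx hX hT hTn'.le hB2
      (fun t ht => ((hXp.trans_lt hpq).trans_le ht).ne')
    linarith
  obtain ⟨m, hpm, hmq⟩ := exists_between hpq
  have hm0 : 0 < m := by linarith [hF.us_nonneg]
  have hmu : m < u₀ := hmq.trans_le hqu
  have hXT0 : 0 < cont μ x T := hF.us_nonneg.trans_lt hTs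
  have hXTu : cont μ x T < u₀ := by linarith
  obtain ⟨s, hs⟩ := hF.exists_supergrad_old hm0 hmu
  obtain ⟨η, hη⟩ := hF.exists_supergrad_new hXT0 hXTu
  have hηs : η < s := by
    by_contra hc
    have h1 := hE.flow_le hμ hF hx hT hTs hXTu hη hm0 hmu hs (not_lt.1 hc)
    exact hB2.ne' (measure_mono_null (t := {t | m < x t} ∩ Ioi T)
      (fun t ht => ⟨hmq.trans_le ht.1, ht.2.1⟩) h1)
  have hlt : cont μ x T < cont μ x c₁ := by
    refine lt_of_le_of_ne (hX (hT₀.trans hT0c.le) hT hcT.le) fun h => ?_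
    exact absurd h (cont_lt_of_pos hμ hx hX (hT₀.trans hT0c.le) hcT.le hB4
      (fun t ht => (lt_of_lt_of_le (by rw [← h]; linarith) ht).ne')).ne
  -- Flow above `q` in `(T₀, c₁]` is advanced to low-flow times before `T₀`. By the choice of `κ`
  -- continuation values stay above `cont μ x T` before `c₁`, where `f₁` has slope at most `η < s`.
  -- The gain is strict at `T₀`.
  obtain ⟨y, hym, hyb, hxy, hy0, hyκ, hyout, hyc, -⟩ := exists_transfer hμ hx (m := m) (c₀ := 0)
    (c := T₀) (c₁ := c₁) (ε := 1) (κ := cont μ x c₁ - cont μ x T) (Or.inl rfl) (by linarith)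
    (hAm.inter measurableSet_Ioc) (hBm.inter measurableSet_Ioc) inter_subset_right
    inter_subset_right hA hB3 (fun t ht => by
      have : x t ≤ p := ht.1
      linarith) (fun t ht => by
      have : q ≤ x t := ht.1
      linarith)
  have hkey : ∀ τ, 0 ≤ τ → τ < c₁ →
      f₁ (cont μ x τ) ≤ f₁ (cont μ y τ) + η * (cont μ x τ - cont μ y τ) := by
    intro τ hτ hτ1
    have h1 := hy0 τ
    have h2 := hyκ τ
    have h3 := hX hτ (hT₀.trans hT0c.le) hτ1.le
    have h4 := hη.sub_le_of_le hF.conc_new (hF.mem_new hXT0 hXTu.le) (hx.cont_mem_new hμ hF τ)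
      (u := cont μ y τ) (by linarith) (by linarith)
    linarith
  have heq := (hE.eq_of_between hμ hF hx hm0 hmu.le hs hym hyb hxy (fun τ hτ => by
    by_cases hτ1 : c₁ ≤ τ
    · rw [hyout τ (Or.inr hτ1)]; simp
    have h1 := hkey τ hτ (not_le.1 hτ1)
    have h5 : η * (cont μ x τ - cont μ y τ) ≤ s * (cont μ x τ - cont μ y τ) :=
      mul_le_mul_of_nonneg_right hηs.le (by linarith [hy0 τ])
    linarith)).1 T₀ hT₀
  have h1 := hkey T₀ hT₀ hT0c
  nlinarith

/-- An essentially decreasing bounded flow has a decreasing version. -/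
theorem exists_antitone_version (hμ : IsDiscount μ) {u : ℝ}
    (hx0 : ∀ t, 0 ≤ x t) (hxu : ∀ t, x t ≤ u)
    (h : ∀ p q T, 0 ≤ T → p < q → 0 < μ ({t | x t ≤ p} ∩ Ioc 0 T) →
      μ ({t | q ≤ x t} ∩ Ioi T) = 0) :
    ∃ z : ℝ → ℝ, Antitone z ∧ (∀ t, 0 ≤ z t) ∧ (∀ t, z t ≤ u) ∧ z =ᵐ[μ] x := by
  have := hμ.prob
  have := hμ.noAtoms
  have hu : 0 ≤ u := (hx0 0).trans (hxu 0)
  -- The version is the essential supremum of `x` after `t`, decreasing by construction. That it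
  -- agrees with `x` is tested on rational levels.
  let S : ℝ → Set ℝ := fun t => {q | 0 ≤ q ∧ ∀ᵐ s ∂μ, t < s → x s ≤ q}
  have hbdd : ∀ t, BddBelow (S t) := fun t => ⟨0, fun q hq => hq.1⟩
  have hne : ∀ t, (S t).Nonempty := fun t => ⟨u, hu, ae_of_all _ fun s _ => hxu s⟩
  have hmono : ∀ t q q', q ∈ S t → q ≤ q' → q' ∈ S t := fun t q q' hq hqq =>
    ⟨hq.1.trans hqq, hq.2.mono fun s hs hts => (hs hts).trans hqq⟩
  refine ⟨fun t => sInf (S t), fun a b hab => ?_, fun t => ?_, fun t => ?_, ?_⟩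
  · exact csInf_le_csInf (hbdd b) (hne a)
      fun q hq => ⟨hq.1, hq.2.mono fun s hs hbs => hs (hab.trans_lt hbs)⟩
  · exact le_csInf (hne t) fun q hq => hq.1
  · exact csInf_le (hbdd t) ⟨hu, ae_of_all _ fun s _ => hxu s⟩
  have hset : ∀ (q : ℚ), 0 ≤ (q : ℝ) → ∀ᵐ t ∂μ, (x t ≤ q → (q : ℝ) ∈ S t) ∧
      ((q : ℝ) ∈ S t → x t ≤ q) := by
    intro q hq
    -- Once the flow has been below `q` on positive measure, it is almost surely below every `q + 1
    -- / (k + 1)` afterwards, hence below `q`.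
    have hdrop : ∀ d, 0 ≤ d → μ {t | ¬ (t ∈ Ioc (0 : ℝ) d → ¬ x t ≤ q)} ≠ 0 → (q : ℝ) ∈ S d := by
      intro d hd hc
      refine ⟨hq, ?_⟩
      have hpos : 0 < μ ({t | x t ≤ q} ∩ Ioc 0 d) :=
        (pos_iff_ne_zero.2 hc).trans_le (measure_mono fun t ht => by
          simp only [mem_ofPred_eq, Classical.not_imp, not_not] at ht
          exact ⟨ht.2, ht.1⟩)
      have h2 : ∀ k : ℕ, ∀ᵐ s ∂μ, ¬ (s ∈ {t | (q : ℝ) + 1 / (k + 1) ≤ x t} ∩ Ioi d) := by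
        intro k
        rw [ae_iff]
        simpa only [not_not, ofPred_mem_eq] using h q (q + 1 / (k + 1)) d hd (by
          have : (0 : ℝ) < 1 / (k + 1) := by positivity
          linarith) hpos
      filter_upwards [ae_all_iff.2 h2] with s hs hns
      by_contra hlt
      rw [not_le] at hlt
      obtain ⟨k, hk⟩ := exists_nat_one_div_lt (sub_pos.2 hlt)
      exact hs k ⟨by change (q : ℝ) + 1 / (k + 1) ≤ x s; linarith, hns⟩
    by_cases hall : ∀ t, 0 ≤ t → (q : ℝ) ∉ S t
    · have h1 : ∀ n : ℕ, ∀ᵐ t ∂μ, t ∈ Ioc (0 : ℝ) n → ¬ x t ≤ q := by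
        intro n
        rw [ae_iff]
        by_contra hc
        exact hall n (Nat.cast_nonneg n) (hdrop n (Nat.cast_nonneg n) hc)
      filter_upwards [ae_all_iff.2 h1, hμ.ae_pos] with t ht htpos
      obtain ⟨n, hn⟩ := exists_nat_ge t
      exact ⟨fun hle => absurd hle (ht n ⟨htpos, hn⟩), fun hS => absurd hS (hall t htpos.le)⟩
    · push Not at hall
      set K := {t : ℝ | 0 ≤ t ∧ (q : ℝ) ∈ S t} with hK
      have hKne : K.Nonempty := hall
      have hKb : BddBelow K := ⟨0, fun t ht => ht.1⟩
      set b := sInf K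
      have hright : ∀ t, b < t → (q : ℝ) ∈ S t := by
        intro t hbt
        obtain ⟨t', ht', htt⟩ := (csInf_lt_iff hKb hKne).1 hbt
        exact ⟨hq, ht'.2.2.mono fun s hs hts => hs (htt.trans hts)⟩
      have hb0 : 0 ≤ b := le_csInf hKne fun t ht => ht.1
      have hA : ∀ k : ℕ, ∀ᵐ t ∂μ, b + 1 / ((k : ℝ) + 1) < t → x t ≤ q := fun k =>
        (hright (b + 1 / ((k : ℝ) + 1)) (by
          have : (0 : ℝ) < 1 / (k + 1) := by positivity
          linarith)).2
      have hB : ∀ k : ℕ, ∀ᵐ t ∂μ, t ∈ Ioc (0 : ℝ) (b - 1 / ((k : ℝ) + 1)) → ¬ x t ≤ q := by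
        intro k
        have hk : (0 : ℝ) < 1 / (k + 1) := by positivity
        set d := b - 1 / ((k : ℝ) + 1) with hd
        rcases lt_or_ge d 0 with hd0 | hd0
        · exact ae_of_all _ fun t ht => absurd (ht.1.trans_le ht.2) (not_lt.2 hd0.le)
        rw [ae_iff]
        by_contra hc
        have : b ≤ d := csInf_le hKb ⟨hd0, hdrop d hd0 hc⟩
        linarith
      have hbn : ∀ᵐ t ∂μ, t ≠ b := by simp [ae_iff]
      filter_upwards [ae_all_iff.2 hA, ae_all_iff.2 hB, hbn, hμ.ae_pos] with t h1 h2 h3 h4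
      rcases lt_or_gt_of_ne h3 with h5 | h5
      · obtain ⟨k, hk⟩ := exists_nat_one_div_lt (sub_pos.2 h5)
        refine ⟨fun hle => absurd hle (h2 k ⟨h4, by linarith⟩), fun hS => ?_⟩
        exact absurd (csInf_le hKb ⟨h4.le, hS⟩) (not_le.2 h5)
      · obtain ⟨k, hk⟩ := exists_nat_one_div_lt (sub_pos.2 h5)
        exact ⟨fun _ => hright t h5, fun _ => h1 k (by linarith)⟩
  have hall : ∀ᵐ t ∂μ, ∀ q : ℚ, 0 ≤ (q : ℝ) → (x t ≤ q → (q : ℝ) ∈ S t) ∧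
      ((q : ℝ) ∈ S t → x t ≤ q) := by
    rw [ae_all_iff]
    intro q
    by_cases hq : 0 ≤ (q : ℝ)
    · filter_upwards [hset q hq] with t ht _ using ht
    · exact ae_of_all _ fun t h => absurd h hq
  filter_upwards [hall] with t ht
  refine le_antisymm (le_of_forall_gt_imp_ge_of_dense fun a ha => ?_) ?_
  · obtain ⟨q, hq1, hq2⟩ := exists_rat_btwn ha
    exact (csInf_le (hbdd t) ((ht q ((hx0 t).trans hq1.le)).1 hq1.le)).trans hq2.le
  · refine le_csInf (hne t) fun a ha => le_of_forall_gt_imp_ge_of_dense fun a' ha' => ?_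
    obtain ⟨q, hq1, hq2⟩ := exists_rat_btwn ha'
    exact ((ht q (ha.1.trans hq1.le)).2 (hmono t a q ha hq1.le)).trans hq2.le

end Core

/-! ### Limits of the flow under a given breakthrough law -/

section Core

variable {μ G : Measure ℝ} {f₀ f₁ : ℝ → ℝ} {I₀ I₁ : Set ℝ} {u₀ u₁ us : ℝ} {x y : ℝ → ℝ}

/-- No admissible flow improves on `x` at each time `τ` by an amount whose `G`-mean is positive. -/
def MeanEfficient (μ G : Measure ℝ) (f₀ f₁ : ℝ → ℝ) (I₀ : Set ℝ) (u₀ : ℝ) (x : ℝ → ℝ) : Prop :=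
  ∀ y, Admissible μ f₀ I₀ u₀ y → ∀ k : ℝ → ℝ, Integrable k G →
    (∀ τ, 0 ≤ τ → value μ f₀ f₁ x τ + k τ ≤ value μ f₀ f₁ y τ) → ∫ τ, k τ ∂G ≤ 0

theorem tail_add_fun [IsFiniteMeasure μ] (hx : Integrable x μ) (hy : Integrable y μ) (τ : ℝ) :
    tail μ (fun t => x t + y t) τ = tail μ x τ + tail μ y τ :=
  integral_add hx.integrableOn hy.integrableOn

/-- The gap at `l` persists between a new slope slightly to the left and an old slope slightly to
the right. Otherwise the supremum `σ` of the old slopes right of `l` is below all new slopes left of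
`l`; then `σ` bounds `f₀` right of `l` and `f₁` left of `l`. -/
theorem FrontierPair.exists_gap_around (hF : FrontierPair f₀ f₁ I₀ I₁ u₀ u₁ us) {l : ℝ}
    (hl : us < l) (hlu : l < u₀) : ∃ l' m η s, 0 < l' ∧ l' < l ∧ l < m ∧ m < u₀ ∧
      SupergradOn f₁ I₁ l' η ∧ SupergradOn f₀ I₀ m s ∧ η < s := by
  by_contra! hc
  have hl0 : 0 < l := hF.us_nonneg.trans_lt hl
  set A : Set ℝ := {s | ∃ m, l < m ∧ m < u₀ ∧ SupergradOn f₀ I₀ m s} with hA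
  have hAne : A.Nonempty := by
    obtain ⟨m, h1, h2⟩ := exists_between hlu
    obtain ⟨s, hs⟩ := hF.exists_supergrad_old (hl0.trans h1) h2
    exact ⟨s, m, h1, h2, hs⟩
  have hub : ∀ l' η, 0 < l' → l' < l → SupergradOn f₁ I₁ l' η → ∀ s ∈ A, s ≤ η := by
    rintro l' η h1 h2 h3 s ⟨m, h4, h5, h6⟩
    exact hc l' m η s h1 h2 h4 h5 h3 h6
  have hbdd : BddAbove A := by
    obtain ⟨η, hη⟩ := hF.exists_supergrad_new (half_pos hl0) (by linarith)
    exact ⟨η, hub _ η (half_pos hl0) (half_lt_self hl0) hη⟩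
  set σ := sSup A
  obtain ⟨s₀, hs₀⟩ := hF.exists_supergrad_old hl0 hlu
  obtain ⟨η₀, hη₀⟩ := hF.exists_supergrad_new hl0 hlu
  have hgap := hF.gap l s₀ η₀ hl hlu hs₀ hη₀
  have hlI := hF.mem_old hl0 hlu.le
  have hold : ∀ v ∈ I₀, l < v → f₀ v ≤ f₀ l + σ * (v - l) := by
    intro v hv hlv
    have hlim : Tendsto (fun m => f₀ l + s₀ * (m - l) + σ * (v - m)) (𝓝[>] l)
        (𝓝 (f₀ l + s₀ * (l - l) + σ * (v - l))) :=
      (Continuous.tendsto (by fun_prop) l).mono_left nhdsWithin_le_nhds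
    rw [sub_self, mul_zero, add_zero] at hlim
    refine ge_of_tendsto hlim ?_
    filter_upwards [Ioo_mem_nhdsGT (lt_min hlv hlu)] with m hm
    have hmv : m < v := hm.2.trans_le (min_le_left _ _)
    have hmu : m < u₀ := hm.2.trans_le (min_le_right _ _)
    obtain ⟨s, hs⟩ := hF.exists_supergrad_old (hl0.trans hm.1) hmu
    have h1 := hs v hv
    have h2 := hs₀ m (hF.mem_old (hl0.trans hm.1) hmu.le)
    have h3 : s ≤ σ := le_csSup hbdd ⟨m, hm.1, hmu, hs⟩
    nlinarith
  have hnew : ∀ v ∈ I₁, v < l → f₁ v ≤ f₁ l + σ * (v - l) := by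
    intro v hv hvl
    have hv0 := (hF.subset_Icc hv).1
    have hlim : Tendsto (fun m => f₁ l + η₀ * (m - l) + σ * (v - m)) (𝓝[<] l)
        (𝓝 (f₁ l + η₀ * (l - l) + σ * (v - l))) :=
      (Continuous.tendsto (by fun_prop) l).mono_left nhdsWithin_le_nhds
    rw [sub_self, mul_zero, add_zero] at hlim
    refine ge_of_tendsto hlim ?_
    filter_upwards [Ioo_mem_nhdsLT hvl] with m hm
    have hm0 : 0 < m := hv0.trans_lt hm.1
    obtain ⟨η, hη⟩ := hF.exists_supergrad_new hm0 (hm.2.trans hlu)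
    have h1 := hη v hv
    have h2 := hη₀ m (hF.mem_new hm0 (hm.2.trans hlu).le)
    have h3 : σ ≤ η := csSup_le hAne (hub m η hm0 hm.2 hη)
    have := hm.1
    nlinarith
  have hσ0 : σ ≤ s₀ → SupergradOn f₀ I₀ l σ := by
    intro h v hv
    rcases lt_or_ge l v with h1 | h1
    · exact hold v hv h1
    · have := hs₀ v hv
      nlinarith
  have hσ1 : η₀ ≤ σ → SupergradOn f₁ I₁ l σ := by
    intro h v hv
    rcases lt_or_ge v l with h1 | h1
    · exact hnew v hv h1
    · have := hη₀ v hv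
      nlinarith
  -- Wherever `σ` falls relative to `s₀` and `η₀`, it is a supergradient of at least one frontier at
  -- `l`, and the gap fails against itself, `η₀` or `s₀`.
  rcases le_total σ s₀ with h1 | h1
  · rcases le_total η₀ σ with h2 | h2
    · exact lt_irrefl _ (hF.gap l σ σ hl hlu (hσ0 h1) (hσ1 h2))
    · exact absurd (hF.gap l σ η₀ hl hlu (hσ0 h1) hη₀) (not_lt.2 h2)
  · exact absurd (hF.gap l s₀ σ hl hlu hs₀ (hσ1 (hgap.le.trans h1))) (not_lt.2 h1)

theorem integral_ite_const [IsFiniteMeasure G] (A B : Set ℝ) (hA : MeasurableSet A)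
    (hB : MeasurableSet B) (a b : ℝ) :
    Integrable (fun t => A.indicator (fun _ => a) t - B.indicator (fun _ => b) t) G ∧
    ∫ t, (A.indicator (fun _ => a) t - B.indicator (fun _ => b) t) ∂G =
      a * G.real A - b * G.real B := by
  have h1 : Integrable (A.indicator fun _ => a) G := (integrable_const a).indicator hA
  have h2 : Integrable (B.indicator fun _ => b) G := (integrable_const b).indicator hB
  refine ⟨h1.sub h2, ?_⟩
  rw [integral_sub h1 h2, integral_indicator hA, integral_indicator hB, setIntegral_const,
    setIntegral_const, smul_eq_mul, smul_eq_mul]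
  ring

/-- Otherwise raise the flow to some `m > v` on `(0, ε]`. Breakthroughs after `ε` gain `s K`;
earlier ones lose at most `|η| K`, with `K` the added flow. -/
theorem exists_flow_gt (hμ : IsDiscount μ) (hF : FrontierPair f₀ f₁ I₀ I₁ u₀ u₁ us)
    [IsProbabilityMeasure G] (hx : Admissible μ f₀ I₀ u₀ x)
    (hO : MeanEfficient μ G f₀ f₁ I₀ u₀ x) (hG0 : ∀ δ, 0 < δ → ∃ ε, 0 < ε ∧ G.real (Iio ε) < δ)
    {v : ℝ} (hv : v < u₀) : ∃ t, 0 < t ∧ v < x t := by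
  classical
  have := hμ.prob
  by_contra! hc
  have hv0 : 0 ≤ v := (hx.nonneg 1).trans (hc 1 one_pos)
  obtain ⟨m, hvm, hmu⟩ := exists_between hv
  have hm0 : 0 < m := hv0.trans_lt hvm
  obtain ⟨s, hs⟩ := hF.exists_supergrad_old hm0 hmu
  obtain ⟨η, hη⟩ := hF.exists_supergrad_new hm0 hmu
  have hs0 := hF.supergrad_old_pos hm0 hmu hs
  -- The threshold makes `s (1 - G.real (Iio ε))` exceed `|η| * G.real (Iio ε)`.
  obtain ⟨ε, hε0, hε⟩ := hG0 (s / (s + |η| + 1)) (by positivity)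
  set y : ℝ → ℝ := (Ioc 0 ε).piecewise (fun _ => m) x with hy
  have hym : Measurable y := Measurable.piecewise measurableSet_Ioc measurable_const hx.meas
  have hyin : ∀ t ∈ Ioc 0 ε, y t = m := fun t ht => piecewise_eq_of_mem _ _ _ ht
  have hyout : ∀ t, t ∉ Ioc 0 ε → y t = x t := fun t ht => piecewise_eq_of_notMem _ _ _ ht
  have hyx : ∀ t, x t ≤ y t := by
    intro t
    by_cases ht : t ∈ Ioc 0 ε
    · rw [hyin t ht]; exact (hc t ht.1).trans hvm.le
    · rw [hyout t ht]
  have hyb : ∀ t, (x t ≤ y t ∧ y t ≤ m) ∨ (m ≤ y t ∧ y t ≤ x t) := by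
    intro t
    by_cases ht : t ∈ Ioc 0 ε
    · exact Or.inl ⟨hyx t, (hyin t ht).le⟩
    · rw [hyout t ht]; rcases le_total (x t) m with h | h <;> simp [h]
  have hyi := hx.integrable_of_between (μ := μ) hm0 hmu.le hym hyb
  obtain ⟨hya, hval⟩ := hx.of_between hμ hF hm0 hmu.le hs hym hyb
  have hdi : Integrable (fun t => y t - x t) μ := hyi.sub hx.integrable
  have hd0 : ∀ t, 0 ≤ y t - x t := fun t => sub_nonneg.2 (hyx t)
  set K := ∫ t, (y t - x t) ∂μ with hK
  have hK0 : 0 < K := by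
    rw [hK, integral_pos_iff_support_of_nonneg hd0 hdi]
    refine (hμ.pos 0 ε le_rfl hε0).trans_le (measure_mono fun t ht => ?_)
    rw [Function.mem_support, hyin t ht]
    have := hc t ht.1
    linarith
  have htail : ∀ τ, tail μ y τ = tail μ x τ + tail μ (fun t => y t - x t) τ := by
    intro τ
    rw [← tail_add_fun hx.integrable hdi]
    simp
  have hkey : ∀ τ, 0 ≤ τ → value μ f₀ f₁ x τ + ((Ici ε).indicator (fun _ => s * K) τ -
      (Iio ε).indicator (fun _ => |η| * K) τ) ≤ value μ f₀ f₁ y τ := by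
    intro τ hτ
    have h1 := hval τ
    have h2 := tail_mem_Icc hdi hd0 τ
    have h3 := tail_add hdi τ
    have he := hμ.tail_pos τ
    rcases le_or_gt ε τ with h | h
    · have h4 : tail μ (fun t => y t - x t) τ = 0 := tail_eq_zero fun t ht => by
        rw [hyout t fun h' => absurd h'.2 (not_le.2 (h.trans_lt ht)), sub_self]
      have h5 : cont μ y τ = cont μ x τ := by rw [cont, cont, htail, h4, add_zero]
      rw [indicator_of_mem (mem_Ici.2 h), indicator_of_notMem (notMem_Iio.2 h)]
      rw [h4, add_zero] at h3
      rw [h3] at h1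
      unfold value
      rw [h5]
      linarith
    · rw [indicator_of_notMem (notMem_Ici.2 h), indicator_of_mem (mem_Iio.2 h)]
      have h4 : μ.real (Ioi τ) * (cont μ y τ - cont μ x τ) = tail μ (fun t => y t - x t) τ := by
        rw [mul_sub, mul_cont hμ, mul_cont hμ, htail]; ring
      have h5 : cont μ x τ ≤ cont μ y τ := by
        by_contra hlt
        nlinarith [h2.1]
      have h6 : cont μ y τ ≤ m := by
        have := tail_mono_of_ae (t := τ) hyi (integrable_const m) (ae_of_all _ fun t ht => by
          by_cases ht' : t ∈ Ioc 0 ε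
          · rw [hyin t ht']
          · rw [hyout t ht']; exact (hc t (hτ.trans_lt ht)).trans hvm.le)
        rw [tail_const] at this
        rw [cont, div_le_iff₀ he]; linarith
      have h7 := hη.le_sub_of_le hF.conc_new (hF.mem_new hm0 hmu.le) (hx.cont_mem_new hμ hF τ) h5 h6
      have h8 : -(|η| * K) ≤ μ.real (Ioi τ) * (f₁ (cont μ y τ) - f₁ (cont μ x τ)) := by
        calc -(|η| * K) ≤ -(|η| * tail μ (fun t => y t - x t) τ) := by
              have := mul_le_mul_of_nonneg_left h2.2 (abs_nonneg η)
              linarith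
          _ ≤ η * tail μ (fun t => y t - x t) τ := by
              have := mul_le_mul_of_nonneg_right (neg_abs_le η) h2.1
              linarith
          _ = μ.real (Ioi τ) * (η * (cont μ y τ - cont μ x τ)) := by rw [← h4]; ring
          _ ≤ _ := mul_le_mul_of_nonneg_left h7 he.le
      have h9 : 0 ≤ s * ∫ t in Iic τ, (y t - x t) ∂μ :=
        mul_nonneg hs0.le (integral_nonneg hd0)
      unfold value
      linarith
  have hfin := integral_ite_const (G := G) (Ici ε) (Iio ε) measurableSet_Ici measurableSet_Iio
    (s * K) (|η| * K)
  have h1 := hO y hya _ hfin.1 hkey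
  rw [hfin.2] at h1
  have h2 : G.real (Ici ε) = 1 - G.real (Iio ε) := by
    rw [← compl_Iio, probReal_compl_eq_one_sub measurableSet_Iio]
  rw [h2] at h1
  rw [lt_div_iff₀ (by positivity)] at hε
  have h3 : 0 ≤ G.real (Iio ε) := measureReal_nonneg
  have h4 : 0 < s * (1 - G.real (Iio ε)) - |η| * G.real (Iio ε) := by nlinarith
  nlinarith

/-- The gain from lowering the flow by `c` after time `S` and raising it by `h` on `(T, T + 1]`. -/
theorem late_transfer_le (hμ : IsDiscount μ) (hF : FrontierPair f₀ f₁ I₀ I₁ u₀ u₁ us)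
    [IsProbabilityMeasure G] (hx : Admissible μ f₀ I₀ u₀ x)
    (hO : MeanEfficient μ G f₀ f₁ I₀ u₀ x) {l c η s s₁ T S : ℝ} (hl0 : 0 < l) (hlu : l < u₀)
    (hc : 0 < c) (hlx : ∀ t, l + c ≤ x t) (hη : SupergradOn f₁ I₁ l η) (hs : 0 ≤ s) (hηs : η < s)
    (hs₁ : SupergradOn f₀ I₀ l s₁) (hTS : T + 1 ≤ S) {h : ℝ → ℝ}
    (hm : Measurable h) (h0 : ∀ t, 0 ≤ h t) (hsupp : ∀ t, t ∉ Ioc T (T + 1) → h t = 0)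
    (hu : ∀ t, x t + h t ≤ u₀) (hf : ∀ t, f₀ (x t) + s * h t ≤ f₀ (x t + h t))
    (hle : ∫ t, h t ∂μ ≤ c * μ.real (Ioi S)) (heq : s * ∫ t, h t ∂μ = s * (c * μ.real (Ioi S))) :
    (s - η) * G.real (Icc (T + 1) S) ≤ s₁ * G.real (Ioi S) := by
  have := hμ.prob
  have hlI := hF.mem_old hl0 hlu.le
  have hs₁0 := hF.supergrad_old_pos hl0 hlu hs₁
  set h₂ : ℝ → ℝ := (Ioi S).indicator fun _ => c with hh₂
  have hi₁ : Integrable h μ := integrable_of_bounds hm h0 (b := u₀)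
    (fun t => by linarith [hu t, hx.nonneg t])
  have hi₂ : Integrable h₂ μ := (integrable_const c).indicator measurableSet_Ioi
  have h0₂ : ∀ t, 0 ≤ h₂ t := indicator_nonneg fun t _ => hc.le
  have hm₂ : Measurable h₂ := measurable_const.indicator measurableSet_Ioi
  have hin : ∀ t, S < t → h₂ t = c := fun t ht => indicator_of_mem (mem_Ioi.2 ht) _
  have hout : ∀ t, t ≤ S → h₂ t = 0 := fun t ht => indicator_of_notMem (notMem_Ioi.2 ht) _
  set K := c * μ.real (Ioi S) with hK
  have hK0 : 0 < K := mul_pos hc (hμ.tail_pos S)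
  have hInt₂ : ∫ t, h₂ t ∂μ = K := by
    rw [hh₂, integral_indicator measurableSet_Ioi, setIntegral_const, smul_eq_mul, mul_comm]
  set y : ℝ → ℝ := fun t => x t + (h t - h₂ t) with hy
  have hdisj : ∀ t, S < t → h t = 0 := fun t ht => hsupp t fun h' => by linarith [h'.2]
  obtain ⟨hya, hval⟩ := hx.of_lower_bound hμ hF (y := y) (z := fun t => s * h t - s₁ * h₂ t)
    (hx.meas.add (hm.sub hm₂))
    (fun t => by
      simp only [hy]
      rcases le_or_gt t S with ht | ht
      · rw [hout t ht]; linarith [h0 t, hx.nonneg t]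
      · rw [hin t ht, hdisj t ht]; linarith [hlx t])
    (fun t => by simp only [hy]; linarith [hu t, h0₂ t])
    ((hi₁.const_mul s).sub (hi₂.const_mul s₁))
    (ae_of_all _ fun t htI => by
      simp only [hy]
      rcases le_or_gt t S with ht | ht
      · rw [hout t ht, sub_zero, mul_zero, sub_zero]
        exact ⟨hF.mem_old (by linarith [h0 t, hlx t]) (hu t), hf t⟩
      · rw [hin t ht, hdisj t ht, mul_zero, zero_sub, zero_sub]
        have hmem := hF.mem_old (u := x t + -c) (by linarith [hlx t]) (by linarith [hx.le t])
        have := hs₁.sub_le_of_le hF.conc_old hlI htI (u := x t + -c) (by linarith [hlx t])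
          (by linarith)
        exact ⟨hmem, by linarith⟩)
  have hyi : Integrable (fun t => h t - h₂ t) μ := hi₁.sub hi₂
  have htail : ∀ τ, tail μ y τ = tail μ x τ + (tail μ h τ - tail μ h₂ τ) := by
    intro τ
    rw [hy, tail_add_fun hx.integrable hyi]
    congr 1
    exact integral_sub hi₁.integrableOn hi₂.integrableOn
  -- Before `T + 1` the change is nonnegative, on `[T + 1, S]` it is at least `(s - η) K`, and after
  -- `S` the cut costs at most `s₁ K`.
  have hkey : ∀ τ, 0 ≤ τ → value μ f₀ f₁ x τ +
      ((Icc (T + 1) S).indicator (fun _ => (s - η) * K) τ -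
        (Ioi S).indicator (fun _ => s₁ * K) τ) ≤ value μ f₀ f₁ y τ := by
    intro τ _
    have h1 := hval τ
    have ha := tail_mem_Icc hi₁ h0 τ
    have hb := tail_mem_Icc hi₂ h0₂ τ
    have ha' := tail_add hi₁ τ
    have hb' := tail_add hi₂ τ
    have he := hμ.tail_pos τ
    rw [hInt₂] at hb hb'
    set a := tail μ h τ
    set b := tail μ h₂ τ
    have hab : (τ ≤ S → b = K) ∧ (T + 1 ≤ τ → a = 0) := by
      constructor
      · intro hτ
        exact (tail_eq_integral hi₂ fun t ht => hout t (ht.trans hτ)).trans hInt₂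
      · intro hτ
        exact tail_eq_zero fun t ht => hsupp t fun h' => by linarith [h'.2]
    have hba : a ≤ b := by
      rcases le_total τ S with hτ | hτ
      · rw [hab.1 hτ]; linarith
      · rw [hab.2 (hTS.trans hτ)]; exact hb.1
    have hbc : b ≤ μ.real (Ioi τ) * c := by
      rcases le_total τ S with hτ | hτ
      · rw [hab.1 hτ, hK, mul_comm]
        exact mul_le_mul_of_nonneg_right (measureReal_mono (Ioi_subset_Ioi hτ)) hc.le
      · have := tail_mono_of_ae (t := τ) hi₂ (integrable_const c) (ae_of_all _ fun t ht => by
          rw [hin t (hτ.trans_lt ht)])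
        rwa [tail_const] at this
    have hXY : μ.real (Ioi τ) * (cont μ x τ - cont μ y τ) = b - a := by
      rw [mul_sub, mul_cont hμ, mul_cont hμ, htail]; ring
    have hX : l + c ≤ cont μ x τ := by
      have := tail_mono_of_ae (t := τ) (integrable_const (l + c)) hx.integrable
        (ae_of_all _ fun t _ => hlx t)
      rw [tail_const] at this
      rw [cont, le_div_iff₀ he]; linarith
    have hYX : cont μ y τ ≤ cont μ x τ := by
      by_contra hlt
      nlinarith
    have hXc : cont μ x τ - cont μ y τ ≤ c := by
      by_contra hlt
      have := mul_lt_mul_of_pos_left (not_le.1 hlt) he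
      linarith [ha.1]
    have h2 := hη.sub_le_of_le hF.conc_new (hF.subset_new hlI) (hx.cont_mem_new hμ hF τ)
      (u := cont μ y τ) (by linarith) hYX
    have h3 := mul_le_mul_of_nonneg_left h2 he.le
    have h4 : μ.real (Ioi τ) * (η * (cont μ x τ - cont μ y τ)) = η * (b - a) := by
      rw [← hXY]; ring
    rw [integral_sub (hi₁.const_mul s).integrableOn (hi₂.const_mul s₁).integrableOn,
      integral_const_mul, integral_const_mul] at h1
    have h5 : s * ∫ t in Iic τ, h t ∂μ = s * K - s * a := by rw [← heq, ← ha']; ring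
    have h6 : s₁ * ∫ t in Iic τ, h₂ t ∂μ = s₁ * (K - b) := by rw [← hb']; ring
    rw [h5, h6] at h1
    have hmain : value μ f₀ f₁ x τ + (s * K - s * a - s₁ * (K - b) - η * (b - a)) ≤
        value μ f₀ f₁ y τ := by
      unfold value
      linarith
    refine le_trans ?_ hmain
    rcases le_or_gt τ S with hτ | hτ
    · rw [indicator_of_notMem (notMem_Ioi.2 hτ), hab.1 hτ]
      by_cases hτT : T + 1 ≤ τ
      · rw [indicator_of_mem (mem_Icc.2 ⟨hτT, hτ⟩), hab.2 hτT]; linarith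
      · rw [indicator_of_notMem fun h' => hτT h'.1]
        nlinarith
    · rw [indicator_of_mem (mem_Ioi.2 hτ), indicator_of_notMem fun h' => absurd h'.2 (not_le.2 hτ),
        hab.2 (hTS.trans hτ.le)]
      nlinarith [mul_nonneg hs₁0.le hb.1, mul_nonneg hs (sub_nonneg.2 hb.2)]
  have hfin := integral_ite_const (G := G) (Icc (T + 1) S) (Ioi S) measurableSet_Icc
    measurableSet_Ioi ((s - η) * K) (s₁ * K)
  have h1 := hO y hya _ hfin.1 hkey
  rw [hfin.2] at h1
  by_contra hlt
  rw [not_le] at hlt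
  nlinarith

theorem exists_tail_lt [IsProbabilityMeasure G] {δ : ℝ} (hδ : 0 < δ) :
    ∃ S₀, ∀ S, S₀ ≤ S → G.real (Ioi S) < δ := by
  have h := (ProbabilityTheory.tendsto_cdf_atTop G).eventually (lt_mem_nhds (show 1 - δ < 1 by linarith))
  obtain ⟨S₀, hS₀⟩ := eventually_atTop.1 h
  refine ⟨S₀, fun S hS => ?_⟩
  have := hS₀ S hS
  rw [ProbabilityTheory.cdf_eq_real] at this
  rw [← compl_Iic, probReal_compl_eq_one_sub measurableSet_Iic]
  linarith

theorem limit_le_us (hμ : IsDiscount μ) (hF : FrontierPair f₀ f₁ I₀ I₁ u₀ u₁ us)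
    [IsProbabilityMeasure G] (hx : Admissible μ f₀ I₀ u₀ x)
    (hO : MeanEfficient μ G f₀ f₁ I₀ u₀ x) (hG : ∀ a, 0 < G.real (Ici a)) (hanti : Antitone x)
    {l : ℝ} (hl : ∀ t, l ≤ x t) (hlim : Tendsto x atTop (𝓝 l)) : l ≤ us := by
  have := hμ.prob
  by_contra! hlt
  have hl0 : 0 < l := hF.us_nonneg.trans_lt hlt
  have hlu : l ≤ u₀ := (hl 0).trans (hx.le 0)
  -- As `S → ∞` the mass on `[T + 1, S]` tends to the positive mass of `[T + 1, ∞)`, while that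
  -- after `S` tends to zero.
  have hfinal : ∀ T α β : ℝ, 0 < α → 0 < β →
      (∃ S₀, ∀ S, S₀ ≤ S → α * G.real (Icc (T + 1) S) ≤ β * G.real (Ioi S)) → False := by
    rintro T α β hα hβ ⟨S₀, hS₀⟩
    have hg := hG (T + 1)
    obtain ⟨S₁, hS₁⟩ := exists_tail_lt (G := G)
      (δ := α * G.real (Ici (T + 1)) / (α + β)) (by positivity)
    set S := max S₀ (max S₁ (T + 1)) with hS
    have h1 := hS₀ S (le_max_left _ _)
    have h2 := hS₁ S ((le_max_left _ _).trans (le_max_right _ _))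
    have h3 : G.real (Ici (T + 1)) = G.real (Icc (T + 1) S) + G.real (Ioi S) := by
      have hTS : T + 1 ≤ S := (le_max_right _ _).trans (le_max_right _ _)
      have hd : Disjoint (Icc (T + 1) S) (Ioi S) :=
        disjoint_left.2 fun t ht ht' => absurd ht.2 (not_le.2 ht')
      rw [← Icc_union_Ioi_eq_Ici hTS, measureReal_union hd measurableSet_Ioi]
    rw [lt_div_iff₀ (by positivity), h3] at h2
    nlinarith
  rcases hlu.eq_or_lt with hle | hlu
  -- The flow is constantly `u₀` and cannot be raised, so nothing is given back (`h = 0`, `s = 0`).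
  -- The cut alone pays, because `f₁` slopes down beyond `u₁`.
  · have hxu : ∀ t, x t = u₀ := fun t => le_antisymm (hx.le t) (hle ▸ hl t)
    obtain ⟨a, ha1, ha2⟩ := exists_between hF.u1_lt
    obtain ⟨b, hb1, hb2⟩ := exists_between ha2
    have ha0 : 0 < a := hF.u1_nonneg.trans_lt ha1
    have hb0 : 0 < b := ha0.trans hb1
    obtain ⟨η, hη⟩ := hF.exists_supergrad_new hb0 hb2
    obtain ⟨s₁, hs₁⟩ := hF.exists_supergrad_old hb0 hb2
    have hη0 : η < 0 := by
      have h1 := hη a (hF.mem_new ha0 ha2.le)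
      have h2 := hF.anti_new ⟨ha1.le, ha2.le⟩ ⟨(ha1.trans hb1).le, hb2.le⟩ hb1
      by_contra hc
      nlinarith
    refine hfinal 0 (0 - η) s₁ (by linarith) (hF.supergrad_old_pos hb0 hb2 hs₁) ⟨0 + 1, fun S hS => ?_⟩
    refine late_transfer_le hμ hF hx hO hb0 hb2 (c := u₀ - b) (h := fun _ => 0) (by linarith)
      (fun t => by rw [hxu t]; linarith) hη le_rfl hη0 hs₁ hS measurable_const
      (fun t => le_rfl) (fun t _ => rfl) (fun t => by simpa using hx.le t) (fun t => by simp)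
      ?_ (by simp)
    have h1 := (hμ.tail_pos S).le
    have h2 : 0 ≤ u₀ - b := by linarith
    simpa using mul_nonneg h2 h1
  · obtain ⟨l', m, η, s, hl'0, hl'l, hlm, hmu, hη, hs, hηs⟩ := hF.exists_gap_around hlt hlu
    obtain ⟨s₁, hs₁⟩ := hF.exists_supergrad_old hl'0 (hl'l.trans hlu)
    have hm0 : 0 < m := hl0.trans hlm
    have hs0 := hF.supergrad_old_pos hm0 hmu hs
    obtain ⟨T, hT0, hTm⟩ : ∃ T, 0 ≤ T ∧ x T < m := by
      obtain ⟨T, hT⟩ := eventually_atTop.1 (hlim.eventually (gt_mem_nhds hlm))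
      exact ⟨max T 0, le_max_right _ _, hT _ (le_max_left _ _)⟩
    have hxm : ∀ t, T < t → x t < m := fun t ht => (hanti ht.le).trans_lt hTm
    set g : ℝ → ℝ := (Ioc T (T + 1)).indicator fun t => m - x t with hg
    have hgi : Integrable g μ := ((integrable_const m).sub hx.integrable).indicator measurableSet_Ioc
    have hgm : Measurable g := (measurable_const.sub hx.meas).indicator measurableSet_Ioc
    have hg0 : ∀ t, 0 ≤ g t := indicator_nonneg fun t ht => sub_nonneg.2 (hxm t ht.1).le
    have hgin : ∀ t ∈ Ioc T (T + 1), g t = m - x t := fun t ht => indicator_of_mem ht _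
    have hgout : ∀ t, t ∉ Ioc T (T + 1) → g t = 0 := fun t ht => indicator_of_notMem ht _
    set R := ∫ t, g t ∂μ with hR
    have hR0 : 0 < R := by
      rw [hR, integral_pos_iff_support_of_nonneg hg0 hgi]
      refine (hμ.pos T (T + 1) hT0 (by linarith)).trans_le (measure_mono fun t ht => ?_)
      rw [Function.mem_support, hgin t ht]
      exact (sub_pos.2 (hxm t ht.1)).ne'
    have hc : 0 < l - l' := by linarith
    obtain ⟨S₁, hS₁⟩ := exists_tail_lt (G := μ) (δ := R / (l - l')) (by positivity)
    refine hfinal T (s - η) s₁ (by linarith) (hF.supergrad_old_pos hl'0 (hl'l.trans hlu) hs₁)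
      ⟨max S₁ (T + 1), fun S hS => ?_⟩
    have hSR := hS₁ S ((le_max_left _ _).trans hS)
    rw [lt_div_iff₀ hc] at hSR
    -- `θ` balances the early rise with the late cut; for large `S` the cut is small, so `θ ≤ 1` and
    -- the raised flow stays below `m`.
    set θ := (l - l') * μ.real (Ioi S) / R with hθ
    have hθ0 : 0 ≤ θ := by have := (hμ.tail_pos S).le; positivity
    have hθ1 : θ ≤ 1 := by rw [hθ, div_le_one hR0]; linarith
    have hInt : ∫ t, θ * g t ∂μ = (l - l') * μ.real (Ioi S) := by
      rw [integral_const_mul, ← hR, hθ]; field_simp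
    have hbet : ∀ t, x t + θ * g t ≤ u₀ ∧ f₀ (x t) + s * (θ * g t) ≤ f₀ (x t + θ * g t) := by
      intro t
      by_cases ht : t ∈ Ioc T (T + 1)
      · have h1 := hxm t ht.1
        have h2 : x t + θ * g t ≤ m := by rw [hgin t ht]; nlinarith
        refine ⟨h2.trans hmu.le, ?_⟩
        have := (hs.lower_bound hF.conc_old (hF.mem_old hm0 hmu.le)
          (hF.mem_old (hl0.trans_le (hl t)) (hx.le t)) (y := x t + θ * g t)
          (Or.inl ⟨by have := mul_nonneg hθ0 (hg0 t); linarith, h2⟩)).2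
        rwa [add_sub_cancel_left] at this
      · rw [hgout t ht]; simpa using hx.le t
    exact late_transfer_le hμ hF hx hO hl'0 (hl'l.trans hlu) (c := l - l') (h := fun t => θ * g t) hc
      (fun t => by linarith [hl t]) hη hs0.le hηs hs₁ ((le_max_right _ _).trans hS)
      (hgm.const_mul θ) (fun t => mul_nonneg hθ0 (hg0 t)) (fun t ht => by simp [hgout t ht])
      (fun t => (hbet t).1) (fun t => (hbet t).2) hInt.le (by rw [hInt])

end Core

section Core

variable {μ G : Measure ℝ} {f₀ f₁ : ℝ → ℝ} {I₀ I₁ : Set ℝ} {u₀ u₁ us : ℝ} {x y : ℝ → ℝ}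

theorem value_congr (h : y =ᵐ[μ] x) : value μ f₀ f₁ y = value μ f₀ f₁ x := by
  funext τ
  have h1 : tail μ y τ = tail μ x τ := integral_congr_ae (ae_restrict_of_ae h)
  unfold value cont
  rw [h1, integral_congr_ae (g := fun t => f₀ (x t))
    (ae_restrict_of_ae (h.mono fun t ht => by simp only [ht]))]

theorem Admissible.congr (hx : Admissible μ f₀ I₀ u₀ x) (h : y =ᵐ[μ] x) (hm : Measurable y)
    (h0 : ∀ t, 0 ≤ y t) (hu : ∀ t, y t ≤ u₀) : Admissible μ f₀ I₀ u₀ y where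
  meas := hm
  nonneg := h0
  le := hu
  ae_mem := by filter_upwards [hx.ae_mem, h] with t h1 h2; rwa [h2]
  integ τ := (hx.integ τ).congr (ae_restrict_of_ae (h.mono fun t ht => by simp only [ht]))

theorem exists_antitone_version_of_efficient (hμ : IsDiscount μ)
    (hF : FrontierPair f₀ f₁ I₀ I₁ u₀ u₁ us) [IsProbabilityMeasure G]
    (hx : Admissible μ f₀ I₀ u₀ x) (hE : Efficient μ f₀ f₁ I₀ u₀ x)
    (hO : MeanEfficient μ G f₀ f₁ I₀ u₀ x)
    (hG0 : ∀ δ, 0 < δ → ∃ ε, 0 < ε ∧ G.real (Iio ε) < δ) (hG : ∀ a, 0 < G.real (Ici a)) :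
    ∃ z : ℝ → ℝ, Antitone z ∧ (∀ t, 0 ≤ z t) ∧ z =ᵐ[μ] x ∧ Tendsto z (𝓝[>] 0) (𝓝 u₀) ∧
      Tendsto z atTop (𝓝 us) := by
  have := hμ.prob
  obtain ⟨z, hz, hz0, hzu, hzx⟩ := exists_antitone_version hμ hx.nonneg hx.le
    (fun p q T hT hpq hA => hE.flow_antitone hμ hF hx hT hpq hA)
  have hza := hx.congr hzx hz.measurable hz0 hzu
  have hval := value_congr (f₀ := f₀) (f₁ := f₁) hzx
  have hzO : MeanEfficient μ G f₀ f₁ I₀ u₀ z := by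
    intro y hy k hk h
    rw [hval] at h
    exact hO y hy k hk h
  refine ⟨z, hz, hz0, hzx, ?_, ?_⟩
  · refine tendsto_order.2 ⟨fun v hv => ?_, fun v hv => ?_⟩
    · obtain ⟨t, ht, hvt⟩ := exists_flow_gt hμ hF hza hzO hG0 hv
      filter_upwards [Ioo_mem_nhdsGT ht] with s hs using hvt.trans_le (hz hs.2.le)
    · exact Eventually.of_forall fun t => (hzu t).trans_lt hv
  · have hbdd : BddBelow (range z) := ⟨0, by rintro _ ⟨t, rfl⟩; exact hz0 t⟩
    have hlim := tendsto_atTop_ciInf hz hbdd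
    have hle := limit_le_us hμ hF hza hzO hG hz (fun t => ciInf_le hbdd t) hlim
    have hge : us ≤ ⨅ t, z t := by
      -- Almost everywhere the flow dominates its continuation value, hence `us`. Being decreasing,
      -- `z` then has this bound everywhere, as every tail has positive mass.
      refine le_ciInf fun t => ?_
      have hae : ∀ᵐ s ∂μ, us ≤ z s := by
        filter_upwards [hzx, cont_le_ae hμ hx (hE.antitoneOn_cont hμ hF hx), hμ.ae_pos] with s h1 h2 h3
        rw [h1]
        exact (hE.us_le_cont hμ hF hx h3.le).trans h2
      by_contra hlt
      have h1 : μ (Ioi t) = 0 := measure_mono_null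
        (fun s hs h => hlt (le_trans h (hz (le_of_lt hs)))) (ae_iff.1 hae)
      have h2 := hμ.tail_pos t
      rw [measureReal_def, h1] at h2
      simp at h2
    rwa [le_antisymm hle hge] at hlim

end Core

/-! ### From extended-real frontiers to a real-valued pair -/

/-- The effective domain of a frontier. -/
def effDomain (F : ℝ → EReal) : Set ℝ := {u | 0 ≤ u ∧ F u ≠ ⊥}

/-- The real-valued frontier; meaningful on the effective domain. -/
noncomputable def realFrontier (F : ℝ → EReal) (u : ℝ) : ℝ := (F (max u 0)).toReal

/-- For a concave function a supporting line on a neighbourhood supports globally: a far point is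
joined to `w` by a segment leaving `[a, b]` through an end. -/
theorem SupergradOn.of_local {f : ℝ → ℝ} {I : Set ℝ} {a b w s : ℝ} (hf : ConcaveOn ℝ I f)
    (hw : w ∈ I) (haw : a < w) (hwb : w < b)
    (h : ∀ v ∈ Icc a b, f v ≤ f w + s * (v - w)) : SupergradOn f I w s := by
  have key : ∀ v ∈ I, ∀ p ∈ Icc a b, ∀ t : ℝ, 0 < t → t ≤ 1 → p = (1 - t) * w + t * v →
      f v ≤ f w + s * (v - w) := by
    intro v hv p hp t ht0 ht1 hpt
    have h1 := hf.2 hw hv (sub_nonneg.2 ht1) ht0.le (by ring)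
    have h2 := h p hp
    simp only [smul_eq_mul] at h1
    rw [← hpt] at h1
    have h3 : p - w = t * (v - w) := by rw [hpt]; ring
    rw [h3] at h2
    have h4 : t * f v ≤ t * (f w + s * (v - w)) := by nlinarith
    exact le_of_mul_le_mul_left h4 ht0
  intro v hv
  rcases lt_or_ge b v with h1 | h1
  · have h2 : 0 < v - w := by linarith
    refine key v hv b ⟨by linarith, le_rfl⟩ ((b - w) / (v - w)) (div_pos (by linarith) h2)
      ((div_le_one h2).2 (by linarith)) ?_
    field_simp
    ring
  rcases lt_or_ge v a with h2 | h2
  · have h3 : 0 < w - v := by linarith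
    refine key v hv a ⟨le_rfl, by linarith⟩ ((w - a) / (w - v)) (div_pos (by linarith) h3)
      ((div_le_one h3).2 (by linarith)) ?_
    field_simp
    ring
  · exact h v ⟨h2, h1⟩

namespace IsFrontier

variable {F : ℝ → EReal} {p : ℝ}

theorem coe_real (hF : IsFrontier F p) {u : ℝ} (hu : u ∈ effDomain F) :
    (realFrontier F u : EReal) = F u := by
  rw [realFrontier, max_eq_left hu.1]
  exact EReal.coe_toReal (hF.ne_top u hu.1) hu.2

theorem mem_combo_and_le (hF : IsFrontier F p) {u v a b : ℝ} (hu : u ∈ effDomain F)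
    (hv : v ∈ effDomain F) (ha : 0 ≤ a) (hb : 0 ≤ b) (hab : a + b = 1) :
    a * u + b * v ∈ effDomain F ∧
      a * realFrontier F u + b * realFrontier F v ≤ realFrontier F (a * u + b * v) := by
  have h := hF.concave u v a b hu.1 hv.1 ha hb hab
  rw [← hF.coe_real hu, ← hF.coe_real hv, ← EReal.coe_mul, ← EReal.coe_mul, ← EReal.coe_add] at h
  have hmem : a * u + b * v ∈ effDomain F :=
    ⟨add_nonneg (mul_nonneg ha hu.1) (mul_nonneg hb hv.1), fun hbot => by
      rw [hbot] at h; exact EReal.coe_ne_bot _ (le_bot_iff.1 h)⟩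
  refine ⟨hmem, ?_⟩
  rw [← hF.coe_real hmem] at h
  exact_mod_cast h

theorem convex_effDomain (hF : IsFrontier F p) : Convex ℝ (effDomain F) :=
  fun _ hu _ hv _ _ ha hb hab => (hF.mem_combo_and_le hu hv ha hb hab).1

theorem concaveOn (hF : IsFrontier F p) : ConcaveOn ℝ (effDomain F) (realFrontier F) :=
  ⟨hF.convex_effDomain, fun _ hu _ hv _ _ ha hb hab => (hF.mem_combo_and_le hu hv ha hb hab).2⟩

/-- Upper semicontinuity is known only on `[0,∞)`; composing with `max u 0` makes it global. -/
theorem measurable_comp_max (hF : IsFrontier F p) : Measurable fun u => F (max u 0) := by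
  refine UpperSemicontinuous.measurable fun u c hc => ?_
  have h1 : Tendsto (fun v : ℝ => max v 0) (𝓝 u) (𝓝[Ici 0] (max u 0)) :=
    tendsto_nhdsWithin_iff.2 ⟨(continuous_id.max continuous_const).tendsto u,
      Eventually.of_forall fun v => mem_Ici.2 (le_max_right _ _)⟩
  exact h1.eventually (hF.usc (max u 0) (mem_Ici.2 (le_max_right _ _)) c hc)

theorem measurable_real (hF : IsFrontier F p) : Measurable (realFrontier F) :=
  hF.measurable_comp_max.ereal_toReal

theorem real_lt_iff (hF : IsFrontier F p) {u v : ℝ} (hu : u ∈ effDomain F) (hv : v ∈ effDomain F) :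
    realFrontier F u < realFrontier F v ↔ F u < F v := by
  rw [← hF.coe_real hu, ← hF.coe_real hv, EReal.coe_lt_coe_iff]

theorem peak_mem (hF : IsFrontier F p) : p ∈ effDomain F := by
  refine ⟨hF.peak_nonneg, fun h => ?_⟩
  have := hF.peak (p + 1) (by linarith [hF.peak_nonneg]) (by linarith)
  rw [h] at this
  exact not_lt_bot this

theorem le_peak (hF : IsFrontier F p) {u : ℝ} (hu : 0 ≤ u) : F u ≤ F p := by
  rcases eq_or_ne u p with rfl | h
  exacts [le_rfl, (hF.peak u hu h).le]

theorem real_lt_of_between (hF : IsFrontier F p) {u v : ℝ} (hu : u ∈ effDomain F)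
    (h : (u < v ∧ v ≤ p) ∨ (p ≤ v ∧ v < u)) :
    realFrontier F u < realFrontier F v := by
  have hp := hF.peak_mem
  have hup : u ≠ p := by rcases h with h | h <;> intro h' <;> linarith [h.1, h.2]
  have h1 := (hF.real_lt_iff hu hp).2 (hF.peak u hu.1 hup)
  have hd : p - u ≠ 0 := sub_ne_zero.2 hup.symm
  set b := (v - u) / (p - u) with hb
  have hbm : b * (p - u) = v - u := by rw [hb]; field_simp
  have hb01 : 0 < b ∧ b ≤ 1 := by
    rcases h with ⟨h1, h2⟩ | ⟨h1, h2⟩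
    · have h3 : 0 < p - u := by linarith
      exact ⟨div_pos (by linarith) h3, (div_le_one h3).2 (by linarith)⟩
    · have h3 : p - u < 0 := by linarith
      exact ⟨div_pos_of_neg_of_neg (by linarith) h3, (div_le_one_of_neg h3).2 (by linarith)⟩
  have h2 := (hF.mem_combo_and_le hu hp (sub_nonneg.2 hb01.2) hb01.1.le (by ring)).2
  rw [show (1 - b) * u + b * p = v by linarith] at h2
  nlinarith [hb01.1]

theorem isSupergradient (hF : IsFrontier F p) {u s : ℝ} (hu : u ∈ effDomain F)
    (hs : SupergradOn (realFrontier F) (effDomain F) u s) : IsSupergradient F u s := by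
  refine ⟨subset_closure hu, fun v hv0 _ => ?_⟩
  by_cases hv : F v = ⊥
  · rw [hv, EReal.bot_sub]; exact bot_le
  · have h := hs v ⟨hv0, hv⟩
    rw [← hF.coe_real hu, ← hF.coe_real ⟨hv0, hv⟩, ← EReal.coe_sub, ← EReal.coe_mul,
      EReal.coe_le_coe_iff]
    linarith

theorem supergradOn_of_isSupergradient (hF : IsFrontier F p) {u s : ℝ} (hu : u ∈ effDomain F)
    (hs : IsSupergradient F u s) : SupergradOn (realFrontier F) (effDomain F) u s := by
  intro v hv
  rcases eq_or_ne v u with rfl | hne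
  · simp
  have h := hs.2 v hv.1 hne
  rw [← hF.coe_real hu, ← hF.coe_real hv, ← EReal.coe_sub, ← EReal.coe_mul,
    EReal.coe_le_coe_iff] at h
  linarith

end IsFrontier

namespace IsTechnology

variable {F₀ F₁ : ℝ → EReal} {u₀ u₁ us : ℝ}

theorem mem_eff_old (h : IsTechnology F₀ F₁ u₀ u₁ us) {u : ℝ} (hu : 0 < u) (hu' : u ≤ u₀) :
    u ∈ effDomain F₀ := ⟨hu.le, h.old_finite u hu hu'⟩

theorem eff_subset (h : IsTechnology F₀ F₁ u₀ u₁ us) : effDomain F₀ ⊆ effDomain F₁ := fun u hu =>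
  ⟨hu.1, fun hb => hu.2 (le_bot_iff.1 (hb ▸ h.old_le_new u hu.1))⟩

theorem mem_eff_new (h : IsTechnology F₀ F₁ u₀ u₁ us) {u : ℝ} (hu : 0 < u) (hu' : u ≤ u₀) :
    u ∈ effDomain F₁ := h.eff_subset (h.mem_eff_old hu hu')

theorem u0_pos (h : IsTechnology F₀ F₁ u₀ u₁ us) : 0 < u₀ :=
  h.new.peak_nonneg.trans_lt h.conflict

theorem mem_eff_new_of_le (h : IsTechnology F₀ F₁ u₀ u₁ us) {u : ℝ} (hu : u₁ ≤ u) (hu' : u ≤ u₀) :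
    u ∈ effDomain F₁ := by
  rcases (h.new.peak_nonneg.trans hu).eq_or_lt with h1 | h1
  · have : u = u₁ := le_antisymm (by rw [← h1]; exact h.new.peak_nonneg) hu
    rw [this]; exact h.new.peak_mem
  · exact h.mem_eff_new h1 hu'

theorem exists_supergrad_eff (h : IsTechnology F₀ F₁ u₀ u₁ us) {u : ℝ} (hu : 0 < u)
    (hu' : u < u₀) : ∃ s, SupergradOn (realFrontier F₀) (effDomain F₀) u s :=
  h.old.concaveOn.exists_supergradOn (h.mem_eff_old (half_pos hu) (by linarith))
    (h.mem_eff_old h.u0_pos le_rfl) (half_lt_self hu) hu'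

theorem not_shared (h : IsTechnology F₀ F₁ u₀ u₁ us) {u s : ℝ} (hus : us < u) (hu : u < u₀)
    (h₀ : SupergradOn (realFrontier F₀) (effDomain F₀) u s)
    (h₁ : SupergradOn (realFrontier F₁) (effDomain F₁) u s) : False := by
  have hu0 : 0 < u := h.ustar.1.1.trans_lt hus
  exact absurd (h.ustar.2 ⟨hu0.le, hu, s, h.old.isSupergradient (h.mem_eff_old hu0 hu.le) h₀,
    h.new.isSupergradient (h.mem_eff_new hu0 hu.le) h₁⟩) (not_le.2 hus)

/-- Between `us` and `u₀`, the gap between the frontiers is strictly decreasing. -/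
theorem gap_lt (h : IsTechnology F₀ F₁ u₀ u₁ us) {u v : ℝ} (hus : us < u) (huv : u < v)
    (hv : v ≤ u₀) : realFrontier F₁ v - realFrontier F₀ v <
      realFrontier F₁ u - realFrontier F₀ u := by
  set f : ℝ → ℝ := fun t => realFrontier F₁ t - realFrontier F₀ t with hf
  change f v < f u
  have hu0 : 0 < u := h.ustar.1.1.trans_lt hus
  -- To the right of `u₁` the new frontier falls while the old one still rises.
  have hlate : ∀ a b, u₁ ≤ a → 0 < a → a < b → b ≤ u₀ → f b < f a := by
    intro a b h1 h2 h3 h4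
    have h5 := h.new.real_lt_of_between (h.mem_eff_new (h2.trans h3) h4) (Or.inr ⟨h1, h3⟩)
    have h6 := h.old.real_lt_of_between (h.mem_eff_old h2 (h3.le.trans h4)) (Or.inl ⟨h3, h4⟩)
    simp only [hf]
    linarith
  rcases le_or_gt u₁ u with hu1 | hu1
  · exact hlate u v hu1 hu0 huv hv
  obtain ⟨b, hb1, hb2⟩ := exists_between h.conflict
  have hcont : ContinuousOn f (Icc u b) := by
    have hsub : Icc u b ⊆ Ioo 0 u₀ := fun t ht => ⟨hu0.trans_le ht.1, ht.2.trans_lt hb2⟩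
    have h1 : ContinuousOn (realFrontier F₁) (Ioo 0 u₀) :=
      (h.new.concaveOn.subset (fun t ht => h.mem_eff_new ht.1 ht.2.le)
        (convex_Ioo 0 u₀)).continuousOn isOpen_Ioo
    have h0 : ContinuousOn (realFrontier F₀) (Ioo 0 u₀) :=
      (h.old.concaveOn.subset (fun t ht => h.mem_eff_old ht.1 ht.2.le)
        (convex_Ioo 0 u₀)).continuousOn isOpen_Ioo
    exact (h1.sub h0).mono hsub
  have hub : u < b := hu1.trans hb1
  obtain ⟨w, hw, hmax⟩ := isCompact_Icc.exists_isMaxOn (nonempty_Icc.2 hub.le) hcont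
  -- At an interior maximum of the gap an old supergradient also supports the new frontier, which
  -- cannot happen beyond `us`. The end `b > u₁` is excluded by `hlate`, so the maximum is at `u`
  -- only.
  have hwu : ∀ w ∈ Icc u b, (∀ t ∈ Icc u b, f t ≤ f w) → w = u := by
    intro w hw hmax
    by_contra hne
    have hwu : u < w := lt_of_le_of_ne hw.1 (Ne.symm hne)
    have hwb : w < b := by
      refine lt_of_le_of_ne hw.2 fun hwb => ?_
      have h1 := hmax u₁ ⟨hu1.le, hb1.le⟩
      rw [hwb] at h1
      exact absurd h1 (not_le.2 (hlate u₁ b le_rfl (hu0.trans hu1) hb1 hb2.le))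
    have hw0 : 0 < w := hu0.trans hwu
    have hwu0 : w < u₀ := hwb.trans hb2
    obtain ⟨s, hs⟩ := h.exists_supergrad_eff hw0 hwu0
    refine h.not_shared (hus.trans hwu) hwu0 hs ?_
    refine SupergradOn.of_local h.new.concaveOn (h.mem_eff_new hw0 hwu0.le) hwu hwb fun t ht => ?_
    have h1 := hmax t ht
    have h2 := hs t (h.mem_eff_old (hu0.trans_le ht.1) (ht.2.trans hb2.le))
    simp only [hf] at h1
    linarith
  have hwu' := hwu w hw fun t ht => hmax ht
  rw [hwu'] at hmax
  have hlt : ∀ t ∈ Icc u b, u < t → f t < f u := by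
    intro t ht hut
    refine lt_of_le_of_ne (hmax ht) fun heq => ?_
    have := hwu t ht fun t' ht' => by rw [heq]; exact hmax ht'
    exact hut.ne' this
  rcases le_or_gt v b with hvb | hvb
  · exact hlt v ⟨huv.le, hvb⟩ huv
  · exact (hlate b v hb1.le (hu0.trans hub) hvb hv).trans (hlt b ⟨hub.le, le_rfl⟩ hub)

theorem frontierPair (h : IsTechnology F₀ F₁ u₀ u₁ us) :
    FrontierPair (realFrontier F₀) (realFrontier F₁) (effDomain F₀ ∩ Icc 0 u₀)
      (effDomain F₁ ∩ Icc 0 u₀) u₀ u₁ us := by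
  have hus0 : 0 ≤ us := h.ustar.1.1
  have husu : us < u₀ := h.ustar.1.2.1
  -- Truncating the domain to `[0, u₀]` leaves supergradients at interior points unchanged.
  have hglob : ∀ {F : ℝ → EReal} {p u s : ℝ}, IsFrontier F p → (∀ t, 0 < t → t ≤ u₀ → t ∈ effDomain F) →
      0 < u → u < u₀ → SupergradOn (realFrontier F) (effDomain F ∩ Icc 0 u₀) u s →
      SupergradOn (realFrontier F) (effDomain F) u s := by
    intro F p u s hF hmem hu hu' hs
    refine SupergradOn.of_local hF.concaveOn (hmem u hu hu'.le) (half_lt_self hu) hu' fun t ht => ?_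
    have ht0 : 0 < t := (half_pos hu).trans_le ht.1
    exact hs t ⟨hmem t ht0 ht.2, ht0.le, ht.2⟩
  -- The shared supergradient is finite, since `F₀` is finite on both sides of `us`.
  have hshared : 0 < us → ∃ η : ℝ, IsSupergradient F₀ us η ∧ IsSupergradient F₁ us η := by
    intro hus
    obtain ⟨η, h0, h1⟩ := h.ustar.1.2.2
    have hm : ∀ t, 0 < t → t ≤ u₀ → (realFrontier F₀ t : EReal) = F₀ t := fun t h1 h2 =>
      h.old.coe_real (h.mem_eff_old h1 h2)
    have hne_top : η ≠ ⊤ := by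
      rintro rfl
      have h2 := h0.2 (us / 2) (by linarith) (by linarith)
      rw [← hm _ (half_pos hus) (by linarith), ← hm us hus husu.le, ← EReal.coe_sub,
        EReal.top_mul_coe_of_neg (by linarith)] at h2
      exact EReal.coe_ne_bot _ (le_bot_iff.1 h2)
    have hne_bot : η ≠ ⊥ := by
      rintro rfl
      have h2 := h0.2 u₀ h.u0_pos.le husu.ne'
      rw [← hm _ h.u0_pos le_rfl, ← hm us hus husu.le, ← EReal.coe_sub,
        EReal.bot_mul_coe_of_pos (by linarith)] at h2
      exact EReal.coe_ne_bot _ (le_bot_iff.1 h2)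
    lift η to ℝ using ⟨hne_top, hne_bot⟩
    exact ⟨η, h0, h1⟩
  refine
    { us_nonneg := hus0
      us_lt := husu
      u1_nonneg := h.new.peak_nonneg
      u1_lt := h.conflict
      Ioc_subset := fun u hu => ⟨h.mem_eff_old hu.1 hu.2, hu.1.le, hu.2⟩
      subset_new := inter_subset_inter_left _ h.eff_subset
      subset_Icc := inter_subset_right
      conc_old := h.old.concaveOn.subset inter_subset_left
        (h.old.convex_effDomain.inter (convex_Icc _ _))
      conc_new := h.new.concaveOn.subset inter_subset_left
        (h.new.convex_effDomain.inter (convex_Icc _ _))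
      meas_old := h.old.measurable_real
      mono_old := fun u hu v hv huv => h.old.real_lt_of_between hu.1 (Or.inl ⟨huv, hv.2.2⟩)
      anti_new := fun u hu v hv huv =>
        h.new.real_lt_of_between (h.mem_eff_new_of_le hv.1 hv.2) (Or.inr ⟨hu.1, huv⟩)
      gap := ?_
      shared := ?_
      strict_max := ?_ }
  · intro u s η hus hu hs hη
    have hu0 : 0 < u := hus0.trans_lt hus
    -- If `s ≤ η`, then `s` also supports the new frontier: left of `u` because `η` does, right of
    -- `u` because there `f₁` increases by less than `f₀`.
    by_contra hc
    rw [not_lt] at hc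
    have hs' := hglob h.old (fun t => h.mem_eff_old) hu0 hu hs
    have hη' := hglob h.new (fun t => h.mem_eff_new) hu0 hu hη
    refine h.not_shared hus hu hs' (SupergradOn.of_local h.new.concaveOn
      (h.mem_eff_new hu0 hu.le) (half_lt_self hu0) hu fun t ht => ?_)
    have ht0 : 0 < t := (half_pos hu0).trans_le ht.1
    rcases lt_trichotomy t u with h1 | rfl | h1
    · have := hη' t (h.mem_eff_new ht0 ht.2)
      nlinarith
    · simp
    · have h2 := h.gap_lt hus h1 ht.2
      have h3 := hs' t (h.mem_eff_old ht0 ht.2)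
      linarith
  · intro hus
    obtain ⟨η, h0, h1⟩ := hshared hus
    have h0' := h.old.supergradOn_of_isSupergradient (h.mem_eff_old hus husu.le) h0
    have h1' := h.new.supergradOn_of_isSupergradient (h.mem_eff_new hus husu.le) h1
    exact ⟨η, fun v hv => h0' v hv.1, fun v hv => h1' v hv.1⟩
  · intro hus
    have hev : ∀ᶠ v in 𝓝[≠] us, v ∈ Ioo 0 u₀ :=
      nhdsWithin_le_nhds (Ioo_mem_nhds hus husu)
    filter_upwards [h.strict_max hus, hev] with v hv hvI
    rw [← h.new.coe_real (h.mem_eff_new hvI.1 hvI.2.le),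
      ← h.old.coe_real (h.mem_eff_old hvI.1 hvI.2.le), ← h.new.coe_real (h.mem_eff_new hus husu.le),
      ← h.old.coe_real (h.mem_eff_old hus husu.le), ← EReal.coe_sub, ← EReal.coe_sub,
      EReal.coe_lt_coe_iff] at hv
    exact hv

end IsTechnology

/-! ### Integrals of extended-real functions -/

section EIntegral

variable {α : Type*} [MeasurableSpace α] {μ : Measure α} {f g : α → EReal} {h : α → ℝ}

theorem eintegral_mono (hfg : f ≤ᵐ[μ] g) : eintegral μ f ≤ eintegral μ g := by
  refine EReal.sub_le_sub ?_ ?_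
  · exact_mod_cast lintegral_mono_ae (hfg.mono fun a ha => EReal.toENNReal_le_toENNReal ha)
  · exact_mod_cast lintegral_mono_ae (hfg.mono fun a ha =>
      EReal.toENNReal_le_toENNReal (EReal.neg_le_neg_iff.2 ha))

theorem eintegral_congr (hfg : f =ᵐ[μ] g) : eintegral μ f = eintegral μ g :=
  le_antisymm (eintegral_mono hfg.le) (eintegral_mono hfg.symm.le)

theorem eintegral_coe (hh : Integrable h μ) :
    eintegral μ (fun a => (h a : EReal)) = ((∫ a, h a ∂μ : ℝ) : EReal) := by
  have h1 : ∫⁻ a, ENNReal.ofReal (h a) ∂μ ≠ ∞ := hh.lintegral_lt_top.ne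
  have h2 : ∫⁻ a, ENNReal.ofReal (-h a) ∂μ ≠ ∞ := hh.neg.lintegral_lt_top.ne
  unfold eintegral
  simp only [← EReal.coe_neg, EReal.real_coe_toENNReal]
  rw [integral_eq_lintegral_pos_part_sub_lintegral_neg_part hh, EReal.coe_sub,
    EReal.coe_ennreal_toReal h1, EReal.coe_ennreal_toReal h2]

theorem eintegral_dirac [MeasurableSingletonClass α] (a : α) :
    eintegral (Measure.dirac a) f = f a := by
  unfold eintegral
  rw [lintegral_dirac, lintegral_dirac]
  rcases le_total 0 (f a) with h | h
  · rw [EReal.coe_toENNReal h, EReal.toENNReal_of_nonpos (EReal.neg_le_zero.2 h)]; simp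
  · rw [EReal.toENNReal_of_nonpos h, EReal.coe_toENNReal (EReal.neg_nonneg.2 h)]; simp

/-- A measurable function that is bounded above by an integrable one and whose integral is not
`-∞` is real-valued almost everywhere, and integrable. -/
theorem integrable_of_eintegral_ne_bot (hf : AEMeasurable f μ) (hh : Integrable h μ)
    (hfh : ∀ᵐ a ∂μ, f a ≤ h a) (hbot : eintegral μ f ≠ ⊥) :
    (∀ᵐ a ∂μ, f a = ((f a).toReal : EReal)) ∧ Integrable (fun a => (f a).toReal) μ := by
  have hpos : ∫⁻ a, (f a).toENNReal ∂μ ≠ ∞ := by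
    refine ne_top_of_le_ne_top hh.lintegral_lt_top.ne (lintegral_mono_ae (hfh.mono fun a ha => ?_))
    rw [← EReal.real_coe_toENNReal]
    exact EReal.toENNReal_le_toENNReal ha
  have hneg : ∫⁻ a, (-f a).toENNReal ∂μ ≠ ∞ := by
    intro h1
    apply hbot
    rw [eintegral, h1, EReal.coe_ennreal_top, EReal.sub_top]
  have hm : AEMeasurable (fun a => (-f a).toENNReal) μ := hf.neg.ereal_toENNReal
  have hae : ∀ᵐ a ∂μ, f a = ((f a).toReal : EReal) := by
    filter_upwards [hfh, ae_lt_top' hm hneg] with a h1 h2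
    rw [EReal.coe_toReal]
    · exact (h1.trans_lt (EReal.coe_lt_top _)).ne
    · intro h3
      simp [h3] at h2
  refine ⟨hae, hf.ereal_toReal.aestronglyMeasurable, ?_⟩
  have : ∫⁻ a, ‖(f a).toReal‖ₑ ∂μ ≤ ∫⁻ a, ((f a).toENNReal + (-f a).toENNReal) ∂μ := by
    refine lintegral_mono_ae (hae.mono fun a ha => ?_)
    rw [ha, ← EReal.coe_neg, EReal.real_coe_toENNReal, EReal.real_coe_toENNReal, EReal.toReal_coe,
      Real.enorm_eq_ofReal_abs]
    rcases abs_cases (f a).toReal with h1 | h1 <;> rw [h1.1]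
    exacts [le_self_add, le_add_self]
  refine this.trans_lt ?_
  rw [lintegral_add_right' _ hm]
  exact ENNReal.add_lt_top.2 ⟨hpos.lt_top, hneg.lt_top⟩

/-- Finiteness is essential: it makes both functions integrable, so that ordered integrands with
equal integrals coincide almost everywhere. -/
theorem ae_eq_of_eintegral_eq (hf : AEMeasurable f μ) (hg : AEMeasurable g μ) (hh : Integrable h μ)
    (hfg : f ≤ᵐ[μ] g) (hgh : ∀ᵐ a ∂μ, g a ≤ h a) (hbot : eintegral μ f ≠ ⊥)
    (heq : eintegral μ f = eintegral μ g) : f =ᵐ[μ] g := by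
  obtain ⟨f1, f2⟩ := integrable_of_eintegral_ne_bot hf hh
    (by filter_upwards [hfg, hgh] with a h1 h2 using h1.trans h2) hbot
  obtain ⟨g1, g2⟩ := integrable_of_eintegral_ne_bot hg hh hgh (heq ▸ hbot)
  rw [eintegral_congr f1, eintegral_congr g1, eintegral_coe f2, eintegral_coe g2,
    EReal.coe_eq_coe_iff] at heq
  have h1 : (fun a => (f a).toReal) ≤ᵐ[μ] fun a => (g a).toReal := by
    filter_upwards [hfg, f1, g1] with a h1 h2 h3
    rw [h2, h3] at h1
    exact_mod_cast h1
  filter_upwards [(integral_eq_iff_of_ae_le f2 g2 h1).1 heq, f1, g1] with a h2 h3 h4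
  rw [h3, h4, EReal.coe_eq_coe_iff]
  exact h2

end EIntegral

/-! ### Exponential discounting -/

/-- The discounting law with density `r e^{-rt}` on `(0, ∞)`. -/
noncomputable def discount (r : ℝ) : Measure ℝ :=
  (volume.restrict (Ioi 0)).withDensity fun t => ENNReal.ofReal (r * Real.exp (-r * t))

section Discount

variable {r : ℝ}

theorem measurable_discount_density (r : ℝ) :
    Measurable fun t : ℝ => ENNReal.ofReal (r * Real.exp (-r * t)) := by fun_prop

theorem lintegral_discount (r : ℝ) (S : Set ℝ) (hS : MeasurableSet S) (φ : ℝ → ℝ≥0∞) :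
    ∫⁻ s in S, φ s ∂(discount r) =
      ∫⁻ s in S ∩ Ioi 0, ENNReal.ofReal (r * Real.exp (-r * s)) * φ s := by
  rw [discount, restrict_withDensity hS, Measure.restrict_restrict hS,
    lintegral_withDensity_eq_lintegral_mul_non_measurable _ (measurable_discount_density r)
      (ae_of_all _ fun s => ENNReal.ofReal_lt_top)]
  rfl

theorem discount_Ioi (hr : 0 < r) {t : ℝ} (ht : 0 ≤ t) :
    discount r (Ioi t) = ENNReal.ofReal (Real.exp (-r * t)) := by
  have h0 := lintegral_discount r (Ioi t) measurableSet_Ioi (fun _ => 1)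
  rw [setLIntegral_one] at h0
  rw [h0, inter_eq_left.2 (Ioi_subset_Ioi ht)]
  simp only [mul_one]
  rw [← ofReal_integral_eq_lintegral_ofReal, integral_const_mul,
    integral_exp_mul_Ioi (by linarith : -r < 0)]
  · congr 1; field_simp
  · exact (integrableOn_exp_mul_Ioi (by linarith : -r < 0) t).const_mul r
  · exact ae_of_all _ fun s => by positivity

theorem discount_real_Ioi (hr : 0 < r) {t : ℝ} (ht : 0 ≤ t) :
    (discount r).real (Ioi t) = Real.exp (-r * t) := by
  rw [measureReal_def, discount_Ioi hr ht, ENNReal.toReal_ofReal (Real.exp_pos _).le]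

theorem ae_discount_iff (hr : 0 < r) {p : ℝ → Prop} :
    (∀ᵐ t ∂(discount r), p t) ↔ ∀ᵐ t ∂(volume.restrict (Ici (0 : ℝ))), p t := by
  rw [discount, ae_withDensity_iff (measurable_discount_density r),
    Measure.restrict_congr_set Ioi_ae_eq_Ici]
  refine eventually_congr (ae_of_all _ fun t => ⟨fun h => h ?_, fun h _ => h⟩)
  exact (ENNReal.ofReal_pos.2 (by positivity)).ne'

theorem discount_absolutelyContinuous (hr : 0 < r) : discount r ≪ volume.restrict (Ici 0) := by
  intro s hs
  have : ∀ᵐ t ∂(volume.restrict (Ici (0 : ℝ))), t ∉ s := measure_eq_zero_iff_ae_notMem.1 hs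
  exact measure_eq_zero_iff_ae_notMem.2 ((ae_discount_iff hr).2 this)

theorem isDiscount_discount (hr : 0 < r) : IsDiscount (discount r) := by
  have hac := (withDensity_absolutelyContinuous (volume.restrict (Ioi (0 : ℝ)))
    fun t => ENNReal.ofReal (r * Real.exp (-r * t)))
  have hnon : discount r (Iic 0) = 0 := by
    refine hac ?_
    rw [Measure.restrict_apply measurableSet_Iic, inter_comm, Ioi_inter_Iic, Ioc_self, measure_empty]
  refine ⟨⟨?_⟩, ⟨fun t => hac (measure_singleton t)⟩, hnon, fun a b ha hab => ?_⟩
  · rw [← Iic_union_Ioi (a := (0 : ℝ)), measure_union (Iic_disjoint_Ioi le_rfl) measurableSet_Ioi,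
      hnon, discount_Ioi hr le_rfl]
    simp
  · rw [pos_iff_ne_zero]
    intro h
    have h1 : ∀ᵐ t ∂(discount r), t ∉ Ioc a b := measure_eq_zero_iff_ae_notMem.1 h
    have h2 := measure_eq_zero_iff_ae_notMem.2 ((ae_discount_iff hr).1 h1)
    rw [Measure.restrict_apply measurableSet_Ioc,
      inter_eq_left.2 fun t ht => mem_Ici.2 (ha.trans ht.1.le), Real.volume_Ioc] at h2
    simp at h2
    linarith

theorem eintegral_discount (hr : 0 < r) (τ : ℝ) (f : ℝ → EReal) :
    eintegral (volume.restrict (Ioo 0 τ)) (fun t => ((r * Real.exp (-r * t) : ℝ) : EReal) * f t) =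
      eintegral ((discount r).restrict (Iic τ)) f := by
  have h0 : ∀ t, (0 : EReal) ≤ ((r * Real.exp (-r * t) : ℝ) : EReal) := fun t => by
    exact_mod_cast (by positivity : 0 ≤ r * Real.exp (-r * t))
  have hset : volume.restrict (Ioo 0 τ) = volume.restrict (Iic τ ∩ Ioi (0 : ℝ)) := by
    rw [inter_comm, Ioi_inter_Iic, Measure.restrict_congr_set Ioo_ae_eq_Ioc]
  unfold eintegral
  rw [lintegral_discount r _ measurableSet_Iic, lintegral_discount r _ measurableSet_Iic, hset]
  simp only [← mul_neg, EReal.toENNReal_mul (h0 _), EReal.real_coe_toENNReal]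

end Discount

/-! ### Payoffs and incentives in terms of the discounting law -/

namespace Mechanism

variable {r : ℝ} {m : Mechanism}

theorem flowValue_eq_lintegral (hr : 0 < r) (m : Mechanism) (t : ℝ) {S : Set ℝ}
    (hS : MeasurableSet S) (hS0 : S ⊆ Ioi 0) : m.flowValue r t S =
      ENNReal.ofReal (Real.exp (r * t)) * ∫⁻ s in S, ENNReal.ofReal (m.flow s) ∂(discount r) := by
  rw [lintegral_discount r S hS, inter_eq_left.2 hS0, flowValue, ← lintegral_const_mul' _ _ (by simp)]
  refine lintegral_congr fun s => ?_
  rw [← mul_assoc, ← ENNReal.ofReal_mul (Real.exp_pos _).le, ← ENNReal.ofReal_mul (by positivity)]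
  congr 1
  rw [show -r * (s - t) = r * t + -r * s by ring, Real.exp_add]
  ring

theorem flowValue_eq_integral (hr : 0 < r) (m : Mechanism) {x : ℝ → ℝ} (hx : Integrable x (discount r))
    (hx0 : ∀ t, 0 ≤ x t) (hm : m.flow =ᵐ[discount r] x) (t : ℝ) {S : Set ℝ}
    (hS : MeasurableSet S) (hS0 : S ⊆ Ioi 0) : m.flowValue r t S =
      ENNReal.ofReal (Real.exp (r * t) * ∫ s in S, x s ∂(discount r)) := by
  rw [flowValue_eq_lintegral hr m t hS hS0, ENNReal.ofReal_mul (Real.exp_pos _).le,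
    ofReal_integral_eq_lintegral_ofReal hx.integrableOn (ae_of_all _ hx0)]
  congr 1
  exact lintegral_congr_ae (ae_restrict_of_ae (hm.mono fun s hs => by simp only [hs]))

theorem payoffAt_eq (hr : 0 < r) (F₀ F₁ : ℝ → EReal) (m : Mechanism) (τ : ℝ) :
    m.payoffAt F₀ F₁ r τ = eintegral ((discount r).restrict (Iic τ)) (fun t => F₀ (m.flow t)) +
      ((Real.exp (-r * τ) : ℝ) : EReal) *
        (if m.reward τ = ∞ then ⊥ else F₁ (m.reward τ).toReal) := by
  rw [payoffAt, eintegral_discount hr]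

end Mechanism

theorem IsTimeLaw.ae_nonneg {G : Measure ℝ} (hG : IsTimeLaw G) : ∀ᵐ τ ∂G, 0 ≤ τ := by
  have := measure_eq_zero_iff_ae_notMem.1 hG.nonneg
  exact this.mono fun τ h => not_lt.1 h

theorem isTimeLaw_dirac {τ : ℝ} (hτ : 0 ≤ τ) : IsTimeLaw (Measure.dirac τ) := by
  refine ⟨inferInstance, ?_⟩
  rw [Measure.dirac_apply' _ measurableSet_Iio, indicator_of_notMem (by simpa using hτ)]

/-- Flows in `[0, u₀]` with finite old-frontier payoffs, under exponential discounting. -/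
abbrev FeasibleFlow (F₀ : ℝ → EReal) (r u₀ : ℝ) (x : ℝ → ℝ) : Prop :=
  Admissible (discount r) (realFrontier F₀) (effDomain F₀ ∩ Icc 0 u₀) u₀ x

namespace Mechanism

variable {r : ℝ} {m m' : Mechanism} {F₀ F₁ : ℝ → EReal} {u₀ u₁ us : ℝ} {x R : ℝ → ℝ}
  {G : Measure ℝ}

theorem payoff_mono (hG : IsTimeLaw G)
    (h : ∀ τ, 0 ≤ τ → m.payoffAt F₀ F₁ r τ ≤ m'.payoffAt F₀ F₁ r τ) :
    m.payoff F₀ F₁ r G ≤ m'.payoff F₀ F₁ r G :=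
  eintegral_mono (hG.ae_nonneg.mono h)

theorem payoff_congr (hG : IsTimeLaw G)
    (h : ∀ τ, 0 ≤ τ → m.payoffAt F₀ F₁ r τ = m'.payoffAt F₀ F₁ r τ) :
    m.payoff F₀ F₁ r G = m'.payoff F₀ F₁ r G :=
  eintegral_congr (hG.ae_nonneg.mono h)

theorem payoff_dirac (τ : ℝ) : m.payoff F₀ F₁ r (Measure.dirac τ) = m.payoffAt F₀ F₁ r τ :=
  eintegral_dirac τ

/-- A strict improvement at `τ` would be a strict improvement under the Dirac law at `τ`, so
undominatedness is Pareto efficiency across breakthrough times. -/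
theorem Undominated.payoffAt_eq (hm : m.Undominated F₀ F₁ r) (hm' : m'.IC r)
    (h : ∀ τ, 0 ≤ τ → m.payoffAt F₀ F₁ r τ ≤ m'.payoffAt F₀ F₁ r τ) {τ : ℝ} (hτ : 0 ≤ τ) :
    m'.payoffAt F₀ F₁ r τ = m.payoffAt F₀ F₁ r τ := by
  by_contra hne
  refine hm.2 m' hm' ⟨fun G hG => payoff_mono hG h, Measure.dirac τ, isTimeLaw_dirac hτ, ?_⟩
  rw [payoff_dirac, payoff_dirac]
  exact lt_of_le_of_ne (h τ hτ) (Ne.symm hne)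

theorem flowValue_congr (hr : 0 < r) (hx : m.flow =ᵐ[discount r] m'.flow) (t : ℝ) {S : Set ℝ}
    (hS : MeasurableSet S) (hS0 : S ⊆ Ioi 0) : m.flowValue r t S = m'.flowValue r t S := by
  rw [flowValue_eq_lintegral hr m t hS hS0, flowValue_eq_lintegral hr m' t hS hS0]
  congr 1
  exact lintegral_congr_ae (ae_restrict_of_ae (hx.mono fun s hs => by simp only [hs]))

theorem payoffAt_congr (hr : 0 < r) (hx : m.flow =ᵐ[discount r] m'.flow)
    (hR : ∀ t, 0 ≤ t → m.reward t = m'.reward t) {τ : ℝ} (hτ : 0 ≤ τ) :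
    m.payoffAt F₀ F₁ r τ = m'.payoffAt F₀ F₁ r τ := by
  rw [payoffAt_eq hr, payoffAt_eq hr, hR τ hτ]
  congr 1
  exact eintegral_congr (ae_restrict_of_ae (hx.mono fun s hs => by simp only [hs]))

theorem IC.congr (hr : 0 < r) (hx : m.flow =ᵐ[discount r] m'.flow)
    (hR : ∀ t, 0 ≤ t → m.reward t = m'.reward t) (h : m.IC r) : m'.IC r := by
  intro t ht
  have h1 := h t ht
  rw [← flowValue_congr hr hx t measurableSet_Ioi (Ioi_subset_Ioi ht), ← hR t ht]
  refine ⟨fun d hd => ?_, h1.2⟩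
  rw [← flowValue_congr hr hx t measurableSet_Ioo fun s hs => mem_Ioi.2 (ht.trans_lt hs.1),
    ← hR (t + d) (by linarith)]
  exact h1.1 d hd

theorem Optimal.congr (hr : 0 < r) (hG : IsTimeLaw G) (hx : m.flow =ᵐ[discount r] m'.flow)
    (hR : ∀ t, 0 ≤ t → m.reward t = m'.reward t) (h : m.Optimal F₀ F₁ r G) :
    m'.Optimal F₀ F₁ r G := by
  have key : ∀ G', IsTimeLaw G' → m'.payoff F₀ F₁ r G' = m.payoff F₀ F₁ r G' := fun G' hG' =>
    payoff_congr hG' fun τ hτ => (payoffAt_congr hr hx hR hτ).symm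
  have hic := IC.congr hr hx hR h.1
  refine ⟨hic, fun n hn => (h.2.1 n hn).trans_eq (key G hG).symm, hic, fun n hn hd => ?_⟩
  refine h.2.2.2 n hn ⟨fun G' hG' => (key G' hG').symm.trans_le (hd.1 G' hG'), ?_⟩
  obtain ⟨G', hG', hlt⟩ := hd.2
  exact ⟨G', hG', (key G' hG').symm.trans_lt hlt⟩

/-- The mechanism with flow `x` and finite rewards `R`. -/
noncomputable def ofFlow (x R : ℝ → ℝ) (hx : Measurable x) (hx0 : ∀ t, 0 ≤ x t) : Mechanism where
  flow := x
  reward t := ENNReal.ofReal (R t)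
  flow_nonneg t _ := hx0 t
  flow_meas := hx.aemeasurable

/-- Incentive-compatibility: the excess of the discounted reward over the remaining flow is
nonnegative and decreasing. -/
theorem ofFlow_ic (hr : 0 < r) (hx : Measurable x) (hx0 : ∀ t, 0 ≤ x t)
    (hxi : Integrable x (discount r)) (hR : ∀ t, 0 ≤ t → 0 ≤ R t) :
    (ofFlow x R hx hx0).IC r ↔
      AntitoneOn (fun t => Real.exp (-r * t) * R t - tail (discount r) x t) (Ici 0) ∧
      ∀ t, 0 ≤ t → tail (discount r) x t ≤ Real.exp (-r * t) * R t := by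
  have hμ := isDiscount_discount hr
  have := hμ.prob
  have := hμ.noAtoms
  have hee : ∀ t, Real.exp (r * t) * Real.exp (-r * t) = 1 := fun t => by
    rw [← Real.exp_add]; simp
  have h1 : ∀ t, 0 ≤ t → ∀ d, 0 < d →
      (((ofFlow x R hx hx0).flowValue r t (Ioo t (t + d)) +
        ENNReal.ofReal (Real.exp (-r * d)) * (ofFlow x R hx hx0).reward (t + d)
          ≤ (ofFlow x R hx hx0).reward t) ↔
        Real.exp (-r * (t + d)) * R (t + d) - tail (discount r) x (t + d) ≤
          Real.exp (-r * t) * R t - tail (discount r) x t) := by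
    intro t ht d hd
    have hi : 0 ≤ ∫ s in Ioc t (t + d), x s ∂(discount r) := integral_nonneg hx0
    have hR' := hR (t + d) (by linarith)
    rw [flowValue_eq_integral hr _ hxi hx0 (ae_of_all _ fun _ => rfl) t measurableSet_Ioo
      fun s hs => mem_Ioi.2 (ht.trans_lt hs.1), ← integral_Ioc_eq_integral_Ioo]
    simp only [ofFlow]
    rw [← ENNReal.ofReal_mul (Real.exp_pos _).le, ← ENNReal.ofReal_add (by positivity)
      (by positivity), ENNReal.ofReal_le_ofReal_iff (hR t ht),
      ← tail_sub_tail hxi (by linarith : t ≤ t + d), show -r * (t + d) = -r * t + -r * d by ring,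
      Real.exp_add]
    have he := Real.exp_pos (-r * t)
    rw [← mul_le_mul_iff_right₀ he]
    have : Real.exp (-r * t) * (Real.exp (r * t) * (tail (discount r) x t -
        tail (discount r) x (t + d)) + Real.exp (-r * d) * R (t + d)) = (tail (discount r) x t -
        tail (discount r) x (t + d)) + Real.exp (-r * t) * Real.exp (-r * d) * R (t + d) := by
      linear_combination (tail (discount r) x t - tail (discount r) x (t + d)) * hee t
    rw [this]
    constructor <;> intro h <;> linarith
  have h2 : ∀ t, 0 ≤ t → (((ofFlow x R hx hx0).flowValue r t (Ioi t) ≤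
      (ofFlow x R hx hx0).reward t) ↔ tail (discount r) x t ≤ Real.exp (-r * t) * R t) := by
    intro t ht
    rw [flowValue_eq_integral hr _ hxi hx0 (ae_of_all _ fun _ => rfl) t measurableSet_Ioi
      (Ioi_subset_Ioi ht)]
    simp only [ofFlow]
    rw [ENNReal.ofReal_le_ofReal_iff (hR t ht), ← mul_le_mul_iff_right₀ (Real.exp_pos (-r * t))]
    have : Real.exp (-r * t) * (Real.exp (r * t) * ∫ s in Ioi t, x s ∂(discount r)) =
        tail (discount r) x t := by
      unfold tail
      linear_combination (∫ s in Ioi t, x s ∂(discount r)) * hee t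
    rw [this]
  constructor
  · intro h
    refine ⟨fun a ha b hb hab => ?_, fun t ht => (h2 t ht).1 (h t ht).2⟩
    rcases hab.eq_or_lt with rfl | hlt
    · exact le_rfl
    · have := (h1 a ha (b - a) (sub_pos.2 hlt)).1 ((h a ha).1 _ (sub_pos.2 hlt))
      rwa [add_sub_cancel] at this
  · rintro ⟨hD, h0⟩ t ht
    exact ⟨fun d hd => (h1 t ht d hd).2 (hD ht (mem_Ici.2 (by linarith)) (by linarith)),
      (h2 t ht).2 (h0 t ht)⟩

theorem eintegral_flow (hx : FeasibleFlow F₀ r u₀ x) (hF : IsFrontier F₀ u₀)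
    (hm : m.flow =ᵐ[discount r] x) (τ : ℝ) :
    eintegral ((discount r).restrict (Iic τ)) (fun t => F₀ (m.flow t)) =
      ((∫ t in Iic τ, realFrontier F₀ (x t) ∂(discount r) : ℝ) : EReal) := by
  rw [← eintegral_coe (hx.integ τ)]
  refine eintegral_congr (ae_restrict_of_ae ?_)
  filter_upwards [hm, hx.ae_mem] with t h1 h2
  rw [h1, hF.coe_real h2.1]

theorem ofFlow_payoffAt (hr : 0 < r) (hx : FeasibleFlow F₀ r u₀ x) (hF : IsFrontier F₀ u₀) {τ : ℝ}
    (hR : 0 ≤ R τ) : (ofFlow x R hx.meas hx.nonneg).payoffAt F₀ F₁ r τ =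
      ((∫ t in Iic τ, realFrontier F₀ (x t) ∂(discount r) : ℝ) : EReal) +
        ((Real.exp (-r * τ) : ℝ) : EReal) * F₁ (R τ) := by
  rw [payoffAt_eq hr, eintegral_flow hx hF (ae_of_all _ fun _ => rfl)]
  simp [ofFlow, ENNReal.toReal_ofReal hR]

theorem feasibleFlow_const (hr : 0 < r) (hF : IsTechnology F₀ F₁ u₀ u₁ us) :
    FeasibleFlow F₀ r u₀ fun _ => u₀ := by
  have := (isDiscount_discount hr).prob
  exact ⟨measurable_const, fun _ => hF.u0_pos.le, fun _ => le_rfl,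
    ae_of_all _ fun _ => ⟨hF.mem_eff_old hF.u0_pos le_rfl, hF.u0_pos.le, le_rfl⟩,
    fun τ => integrable_const _⟩

/-- The mechanism with constant flow and reward `u₀` is incentive-compatible and has bounded
payoffs. -/
theorem Optimal.payoff_ne_bot (hr : 0 < r) (hF : IsTechnology F₀ F₁ u₀ u₁ us)
    (hG : IsTimeLaw G) (hm : m.Optimal F₀ F₁ r G) : m.payoff F₀ F₁ r G ≠ ⊥ := by
  have hμ := isDiscount_discount hr
  have := hμ.prob
  have := hG.prob
  have hc := feasibleFlow_const hr hF
  have hic : (ofFlow (fun _ => u₀) (fun _ => u₀) hc.meas hc.nonneg).IC r := by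
    rw [ofFlow_ic hr _ _ hc.integrable fun _ _ => hF.u0_pos.le]
    have : ∀ t, 0 ≤ t → tail (discount r) (fun _ => u₀) t = Real.exp (-r * t) * u₀ := fun t ht => by
      rw [tail_const, discount_real_Ioi hr ht]
    refine ⟨fun a ha b hb _ => ?_, fun t ht => (this t ht).le⟩
    simp only [this a ha, this b hb, sub_self, le_refl]
  have h1 := hm.2.1 _ hic
  have hlow : (((-|realFrontier F₀ u₀| - |realFrontier F₁ u₀|) : ℝ) : EReal) ≤
      (ofFlow (fun _ => u₀) (fun _ => u₀) hc.meas hc.nonneg).payoff F₀ F₁ r G := by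
    have h2 := eintegral_coe (μ := G) (integrable_const (-|realFrontier F₀ u₀| - |realFrontier F₁ u₀|))
    rw [integral_const, probReal_univ, one_smul] at h2
    rw [← h2]
    refine eintegral_mono (hG.ae_nonneg.mono fun τ hτ => ?_)
    rw [ofFlow_payoffAt hr hc hF.old hF.u0_pos.le, ← hF.new.coe_real
      (hF.mem_eff_new hF.u0_pos le_rfl), ← EReal.coe_mul, ← EReal.coe_add, EReal.coe_le_coe_iff,
      setIntegral_const, smul_eq_mul]
    have ha : (discount r).real (Iic τ) ≤ 1 := measureReal_le_one
    have ha0 : 0 ≤ (discount r).real (Iic τ) := measureReal_nonneg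
    have hb : Real.exp (-r * τ) ≤ 1 := Real.exp_le_one_iff.2 (by nlinarith)
    have hb0 := (Real.exp_pos (-r * τ)).le
    nlinarith [neg_abs_le (realFrontier F₀ u₀), neg_abs_le (realFrontier F₁ u₀),
      abs_nonneg (realFrontier F₀ u₀), abs_nonneg (realFrontier F₁ u₀),
      mul_le_mul_of_nonneg_left (neg_abs_le (realFrontier F₀ u₀)) ha0,
      mul_le_mul_of_nonneg_left (neg_abs_le (realFrontier F₁ u₀)) hb0]
  exact ((EReal.bot_lt_coe _).trans_le (hlow.trans h1)).ne'

theorem measure_Ioi_pos (h : ¬ BddAbove G.support) (a : ℝ) : 0 < G (Ioi a) := by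
  rw [not_bddAbove_iff] at h
  obtain ⟨y, hy, hay⟩ := h a
  exact (Measure.mem_support_iff_forall y).1 hy _ (Ioi_mem_nhds hay)

/-- Beyond any `a` there is positive mass, so payoffs of `-∞` there would make the mean `-∞`. Finite
payoffs at late dates allow cancelling terms in equalities of payoffs. -/
theorem exists_payoffAt_ne_bot (hsupp : ¬ BddAbove G.support)
    (hne : m.payoff F₀ F₁ r G ≠ ⊥) (a : ℝ) :
    ∃ τ, a < τ ∧ m.payoffAt F₀ F₁ r τ ≠ ⊥ := by
  by_contra! hc
  apply hne
  have h1 : ∫⁻ τ, (-m.payoffAt F₀ F₁ r τ).toENNReal ∂G = ∞ := by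
    rw [eq_top_iff]
    calc ∞ = ∞ * G (Ioi a) := (ENNReal.top_mul (measure_Ioi_pos hsupp a).ne').symm
      _ = ∫⁻ τ in Ioi a, ∞ ∂G := by rw [setLIntegral_const]
      _ ≤ ∫⁻ τ in Ioi a, (-m.payoffAt F₀ F₁ r τ).toENNReal ∂G :=
        setLIntegral_mono' measurableSet_Ioi fun τ hτ => by simp [hc τ hτ]
      _ ≤ _ := setLIntegral_le_lintegral _ _
  rw [payoff, eintegral, h1, EReal.coe_ennreal_top, EReal.sub_top]

end Mechanism

/-! ### Bounds on undominated flows and rewards -/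

theorem EReal.eq_of_add_right_eq {a b c : EReal} (hc : c ≠ ⊥) (hc' : c ≠ ⊤) (h : a + c = b + c) :
    a = b := by
  lift c to ℝ using ⟨hc', hc⟩
  simpa only [EReal.add_sub_cancel_right] using congrArg (fun z => z - (c : EReal)) h

theorem EReal.coe_mul_lt_coe_mul {c : ℝ} (hc : 0 < c) {a b : EReal} (h : a < b) (hb : b ≠ ⊤) :
    (c : EReal) * a < c * b := by
  lift b to ℝ using ⟨hb, (bot_le.trans_lt h).ne'⟩
  induction a with
  | bot => rw [EReal.coe_mul_bot_of_pos hc, ← EReal.coe_mul]; exact EReal.bot_lt_coe _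
  | coe a =>
    rw [← EReal.coe_mul, ← EReal.coe_mul, EReal.coe_lt_coe_iff]
    exact mul_lt_mul_of_pos_left (EReal.coe_lt_coe_iff.1 h) hc
  | top => exact absurd h not_top_lt

theorem EReal.coe_mul_le_coe_mul {c : ℝ} (hc : 0 < c) {a b : EReal} (h : a ≤ b) :
    (c : EReal) * a ≤ c * b :=
  mul_le_mul_of_nonneg_left h (by exact_mod_cast hc.le)

theorem IsFrontier.lt_of_between {F : ℝ → EReal} {p u v : ℝ} (hF : IsFrontier F p) (hu : 0 ≤ u)
    (hv : v ∈ effDomain F) (h : (u < v ∧ v ≤ p) ∨ (p ≤ v ∧ v < u)) : F u < F v := by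
  by_cases hb : F u = ⊥
  · rw [hb]; exact bot_lt_iff_ne_bot.2 hv.2
  · exact (hF.real_lt_iff ⟨hu, hb⟩ hv).1 (hF.real_lt_of_between ⟨hu, hb⟩ h)

namespace Mechanism

variable {r : ℝ} {m m' : Mechanism} {F₀ F₁ : ℝ → EReal} {u₀ u₁ us : ℝ} {x R : ℝ → ℝ}
  {G : Measure ℝ}

theorem rewardPayoff_ne_top (hF : IsFrontier F₁ u₁) (c : ℝ) (hc : 0 < c) (X : ℝ≥0∞) :
    (c : EReal) * (if X = ∞ then ⊥ else F₁ X.toReal) ≠ ⊤ := by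
  split_ifs with h
  · rw [EReal.coe_mul_bot_of_pos hc]; exact bot_ne_top
  · have := EReal.coe_mul_le_coe_mul hc (hF.le_peak (u := X.toReal) ENNReal.toReal_nonneg)
    rw [← hF.coe_real hF.peak_mem, ← EReal.coe_mul] at this
    exact (this.trans_lt (EReal.coe_lt_top _)).ne

/-- If capping the flow at the peak of the old frontier does not change the payoffs, then the flow
is below the peak. -/
theorem feasibleFlow_of_undominated (hr : 0 < r) (hF : IsTechnology F₀ F₁ u₀ u₁ us)
    (hm : m.Undominated F₀ F₁ r) (hmeas : Measurable m.flow) (h0 : ∀ t, 0 ≤ m.flow t)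
    (hbot : ∀ a, ∃ τ, a < τ ∧ m.payoffAt F₀ F₁ r τ ≠ ⊥) :
    FeasibleFlow F₀ r u₀ (fun t => min (m.flow t) u₀) ∧
      m.flow =ᵐ[discount r] fun t => min (m.flow t) u₀ := by
  have hμ := isDiscount_discount hr
  have := hμ.prob
  have hcap : Measurable fun t => min (m.flow t) u₀ := hmeas.min measurable_const
  have hcap0 : ∀ t, 0 ≤ min (m.flow t) u₀ := fun t => le_min (h0 t) hF.u0_pos.le
  have hFle : ∀ t, F₀ (m.flow t) ≤ F₀ (min (m.flow t) u₀) := fun t => by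
    rcases le_total (m.flow t) u₀ with h | h
    · rw [min_eq_left h]
    · rw [min_eq_right h]; exact hF.old.le_peak (h0 t)
  have hmF : ∀ z : ℝ → ℝ, Measurable z → (∀ t, 0 ≤ z t) → Measurable fun t => F₀ (z t) := by
    intro z hz hz0
    have h1 : (fun t => F₀ (z t)) = fun t => F₀ (max (z t) 0) :=
      funext fun t => by rw [max_eq_left (hz0 t)]
    rw [h1]
    exact hF.old.measurable_comp_max.comp hz
  set m' : Mechanism := ⟨fun t => min (m.flow t) u₀, m.reward, fun t _ => hcap0 t,
    hcap.aemeasurable⟩ with hm'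
  have hval : ∀ t S, m'.flowValue r t S ≤ m.flowValue r t S := fun t S =>
    lintegral_mono fun s => ENNReal.ofReal_le_ofReal
      (mul_le_mul_of_nonneg_left (min_le_left _ _) (by positivity))
  have hic : m'.IC r := fun t ht =>
    ⟨fun d hd => (add_le_add_left (hval t _) _).trans ((hm.1 t ht).1 d hd),
      (hval t _).trans (hm.1 t ht).2⟩
  have heq := fun τ (hτ : 0 ≤ τ) => hm.payoffAt_eq hic (fun τ _ => by
    rw [payoffAt_eq hr, payoffAt_eq hr]
    exact add_le_add_left (eintegral_mono (ae_of_all _ hFle)) _) hτ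
  have hbound : ∀ z, 0 ≤ z → F₀ z ≤ ((realFrontier F₀ u₀ : ℝ) : EReal) := fun z hz => by
    rw [hF.old.coe_real hF.old.peak_mem]; exact hF.old.le_peak hz
  -- At a late date with finite payoff the reward terms cancel, so the old payoffs of the flow and
  -- of the capped flow agree almost everywhere up to then; uniqueness of the peak excludes flow
  -- above `u₀`.
  have key : ∀ a : ℝ, (∀ᵐ t ∂(discount r).restrict (Iic a), m.flow t ≤ u₀ ∧ m.flow t ∈ effDomain F₀) ∧
      IntegrableOn (fun t => (F₀ (m.flow t)).toReal) (Iic a) (discount r) := by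
    intro a
    obtain ⟨τ, hτ, hne⟩ := hbot (max a 0)
    have h1 := heq τ ((le_max_right _ _).trans hτ.le)
    rw [payoffAt_eq hr, payoffAt_eq hr] at h1
    rw [payoffAt_eq hr, EReal.add_ne_bot_iff] at hne
    have h2 := EReal.eq_of_add_right_eq hne.2 (rewardPayoff_ne_top hF.new _ (Real.exp_pos _) _) h1
    have h3 := ae_eq_of_eintegral_eq (hmF _ hmeas h0).aemeasurable (hmF _ hcap hcap0).aemeasurable
      (integrable_const (realFrontier F₀ u₀)) (ae_of_all _ hFle)
      (ae_of_all _ fun t => hbound _ (hcap0 t)) hne.1 h2.symm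
    obtain ⟨h4, h5⟩ := integrable_of_eintegral_ne_bot (hmF _ hmeas h0).aemeasurable
      (integrable_const (realFrontier F₀ u₀)) (ae_of_all _ fun t => hbound _ (h0 t)) hne.1
    have hsub : Iic a ⊆ Iic τ := Iic_subset_Iic.2 ((le_max_left _ _).trans hτ.le)
    refine ⟨ae_restrict_of_ae_restrict_of_subset hsub ?_, IntegrableOn.mono_set h5 hsub⟩
    filter_upwards [h3, h4] with t h6 h7
    refine ⟨?_, h0 t, fun h8 => ?_⟩
    · by_contra! h8
      rw [min_eq_right h8.le] at h6
      exact (hF.old.peak _ (h0 t) h8.ne').ne h6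
    · rw [h8] at h7; simp at h7
  have hall : ∀ᵐ t ∂(discount r), m.flow t ≤ u₀ ∧ m.flow t ∈ effDomain F₀ := by
    have := ae_all_iff.2 fun n : ℕ => (ae_restrict_iff' measurableSet_Iic).1 (key n).1
    filter_upwards [this] with t ht
    obtain ⟨n, hn⟩ := exists_nat_ge t
    exact ht n hn
  refine ⟨⟨hcap, hcap0, fun t => min_le_right _ _, ?_, fun τ => ?_⟩, ?_⟩
  · filter_upwards [hall] with t ht
    rw [min_eq_left ht.1]
    exact ⟨ht.2, h0 t, ht.1⟩
  · refine (key τ).2.congr (ae_restrict_of_ae ?_)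
    filter_upwards [hall] with t ht
    rw [min_eq_left ht.1, realFrontier, max_eq_left (h0 t)]
  · filter_upwards [hall] with t ht
    rw [min_eq_left ht.1]

/-- Undominated rewards never exceed the peak of the old frontier. -/
theorem reward_le_of_undominated (hr : 0 < r) (hF : IsTechnology F₀ F₁ u₀ u₁ us)
    (hm : m.Undominated F₀ F₁ r) (hx : FeasibleFlow F₀ r u₀ x) (hmx : m.flow =ᵐ[discount r] x)
    {τ : ℝ} (hτ : 0 ≤ τ) : m.reward τ ≤ ENNReal.ofReal u₀ := by
  have hμ := isDiscount_discount hr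
  have := hμ.prob
  have := hμ.noAtoms
  have hu0 := hF.u0_pos
  set m' : Mechanism := ⟨m.flow, fun t => min (m.reward t) (ENNReal.ofReal u₀), m.flow_nonneg,
    m.flow_meas⟩ with hm'
  have hee : ∀ t, Real.exp (r * t) * Real.exp (-r * t) = 1 := fun t => by
    rw [← Real.exp_add]; simp
  have htail : ∀ t, tail (discount r) x t ≤ (discount r).real (Ioi t) * u₀ := fun t => by
    rw [← tail_const]
    exact tail_mono_of_ae hx.integrable (integrable_const _) (ae_of_all _ fun s _ => hx.le s)
  -- Since the flow is at most `u₀`, no delay is worth more than a capped reward `u₀`.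
  have hic : m'.IC r := by
    intro t ht
    have hS : Ioi t ⊆ Ioi 0 := Ioi_subset_Ioi ht
    have hS' : ∀ d, Ioo t (t + d) ⊆ Ioi 0 := fun d s hs => mem_Ioi.2 (ht.trans_lt hs.1)
    refine ⟨fun d hd => le_min ?_ ?_, le_min (hm.1 t ht).2 ?_⟩
    · exact le_trans (add_le_add_right (mul_le_mul_right (min_le_left _ _) _) _)
        ((hm.1 t ht).1 d hd)
    · refine le_trans (add_le_add_right (mul_le_mul_right (min_le_right _ _) _) _) ?_
      rw [flowValue_eq_integral hr m' hx.integrable hx.nonneg hmx t measurableSet_Ioo (hS' d),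
        ← integral_Ioc_eq_integral_Ioo, ← ENNReal.ofReal_mul (Real.exp_pos _).le,
        ← ENNReal.ofReal_add (mul_nonneg (Real.exp_pos _).le (integral_nonneg hx.nonneg))
          (by positivity)]
      refine ENNReal.ofReal_le_ofReal ?_
      have h1 : ∫ s in Ioc t (t + d), x s ∂(discount r) ≤
          ∫ s in Ioc t (t + d), u₀ ∂(discount r) :=
        integral_mono hx.integrable.integrableOn (integrable_const _) hx.le
      rw [← tail_sub_tail (x := fun _ => u₀) (integrable_const u₀) (by linarith : t ≤ t + d), tail_const, tail_const,
        discount_real_Ioi hr ht, discount_real_Ioi hr (by linarith),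
        show -r * (t + d) = -r * t + -r * d by ring, Real.exp_add] at h1
      have h2 := mul_le_mul_of_nonneg_left h1 (Real.exp_pos (r * t)).le
      linear_combination h2 + u₀ * (1 - Real.exp (-r * d)) * hee t
    · rw [flowValue_eq_integral hr m' hx.integrable hx.nonneg hmx t measurableSet_Ioi hS]
      refine ENNReal.ofReal_le_ofReal ?_
      have h1 := htail t
      rw [discount_real_Ioi hr ht] at h1
      have h2 := mul_le_mul_of_nonneg_left h1 (Real.exp_pos (r * t)).le
      unfold tail at h2
      linear_combination h2 + u₀ * hee t
  have hlt : ∀ t, ENNReal.ofReal u₀ < m.reward t →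
      (if m.reward t = ∞ then ⊥ else F₁ (m.reward t).toReal) < F₁ u₀ := by
    intro t ht
    have hmem := hF.mem_eff_new hu0 le_rfl
    split_ifs with h
    · exact bot_lt_iff_ne_bot.2 hmem.2
    · exact hF.new.lt_of_between ENNReal.toReal_nonneg hmem
        (Or.inr ⟨hF.conflict.le, (ENNReal.ofReal_lt_iff_lt_toReal hu0.le h).1 ht⟩)
  have hcap : ∀ t, ENNReal.ofReal u₀ < m.reward t →
      (if m'.reward t = ∞ then ⊥ else F₁ (m'.reward t).toReal) = F₁ u₀ := by
    intro t ht
    have : m'.reward t = ENNReal.ofReal u₀ := min_eq_right ht.le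
    rw [this, if_neg ENNReal.ofReal_ne_top, ENNReal.toReal_ofReal hu0.le]
  have heq := hm.payoffAt_eq hic (fun t _ => by
    rw [payoffAt_eq hr, payoffAt_eq hr]
    refine add_le_add_right (EReal.coe_mul_le_coe_mul (Real.exp_pos _) ?_) _
    rcases le_or_gt (m.reward t) (ENNReal.ofReal u₀) with h | h
    · have : m'.reward t = m.reward t := min_eq_left h
      rw [this]
    · rw [hcap t h]; exact (hlt t h).le) hτ
  by_contra! hc
  rw [payoffAt_eq hr, payoffAt_eq hr, eintegral_flow hx hF.old hmx, hcap τ hc] at heq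
  refine (EReal.coe_mul_lt_coe_mul (Real.exp_pos (-r * τ)) (hlt τ hc) (hF.new.ne_top _ hu0.le)).ne' ?_
  rw [add_comm, add_comm (a := ((∫ t in Iic τ, realFrontier F₀ (x t) ∂(discount r) : ℝ) : EReal))]
    at heq
  exact EReal.eq_of_add_right_eq (EReal.coe_ne_bot _) (EReal.coe_ne_top _) heq

theorem Optimal.exists_ofFlow (hr : 0 < r) (hF : IsTechnology F₀ F₁ u₀ u₁ us) (hG : IsTimeLaw G)
    (hsupp : ¬ BddAbove G.support) (hm : m.Optimal F₀ F₁ r G) :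
    ∃ x R, ∃ hx : FeasibleFlow F₀ r u₀ x, (∀ t, 0 ≤ R t) ∧ (∀ t, 0 ≤ t → R t ≤ u₀) ∧
      m.flow =ᵐ[discount r] x ∧ (ofFlow x R hx.meas hx.nonneg).Optimal F₀ F₁ r G ∧
      ∀ a, ∃ τ, a < τ ∧ F₁ (R τ) ≠ ⊥ := by
  have hac := discount_absolutelyContinuous hr
  have hmeas : AEMeasurable m.flow (discount r) := m.flow_meas.mono_ac hac
  -- The flow is unconstrained at negative times and its measurable modification on a null set;
  -- truncation at zero repairs both.
  set z : ℝ → ℝ := fun t => max (hmeas.mk m.flow t) 0 with hz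
  have hzm : Measurable z := hmeas.measurable_mk.max measurable_const
  have hmz : m.flow =ᵐ[discount r] z := by
    have h1 : ∀ᵐ t ∂(discount r), 0 ≤ m.flow t := (ae_discount_iff hr).2
      ((ae_restrict_iff' measurableSet_Ici).2 (ae_of_all _ fun t ht => m.flow_nonneg t ht))
    filter_upwards [h1, hmeas.ae_eq_mk] with t h2 h3
    change _ = max _ _
    rw [← h3, max_eq_left h2]
  set n : Mechanism := ⟨z, m.reward, fun t _ => le_max_right _ _, hzm.aemeasurable⟩ with hn
  have hnopt : n.Optimal F₀ F₁ r G := hm.congr hr hG hmz fun _ _ => rfl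
  have hbot := exists_payoffAt_ne_bot hsupp (hnopt.payoff_ne_bot hr hF hG)
  obtain ⟨hx, hnx⟩ := feasibleFlow_of_undominated hr hF hnopt.2.2 hzm (fun t => le_max_right _ _) hbot
  have hR : ∀ t, 0 ≤ t → n.reward t ≤ ENNReal.ofReal u₀ := fun t ht =>
    reward_le_of_undominated hr hF hnopt.2.2 hx hnx ht
  have hRne : ∀ t, 0 ≤ t → n.reward t ≠ ∞ := fun t ht =>
    ne_top_of_le_ne_top ENNReal.ofReal_ne_top (hR t ht)
  refine ⟨_, fun t => (m.reward t).toReal, hx, fun t => ENNReal.toReal_nonneg, fun t ht => ?_,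
    hmz.trans hnx, ?_, fun a => ?_⟩
  · exact ENNReal.toReal_le_of_le_ofReal hF.u0_pos.le (hR t ht)
  · exact hnopt.congr hr hG hnx fun t ht => (ENNReal.ofReal_toReal (hRne t ht)).symm
  · obtain ⟨τ, h1, h2⟩ := hbot (max a 0)
    refine ⟨τ, (le_max_left _ _).trans_lt h1, fun h3 => ?_⟩
    rw [payoffAt_eq hr, EReal.add_ne_bot_iff] at h2
    apply h2.2
    rw [if_neg (hRne τ ((le_max_right _ _).trans h1.le)), h3, EReal.coe_mul_bot_of_pos
      (Real.exp_pos _)]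

end Mechanism

/-! ### Undominated rewards are continuation values -/

/-- If a decreasing nonnegative function cannot be moved towards `c` without losing monotonicity or
nonnegativity, then it falls no faster than `c`. -/
theorem AntitoneOn.sub_le_of_rigid {D c : ℝ → ℝ} (hD : AntitoneOn D (Ici 0))
    (hD0 : ∀ t, 0 ≤ t → 0 ≤ D t)
    (hrig : ∀ E : ℝ → ℝ, AntitoneOn E (Ici 0) → (∀ t, 0 ≤ t → 0 ≤ E t) →
      (∀ t, 0 ≤ t → (D t ≤ E t ∧ E t ≤ c t) ∨ (c t ≤ E t ∧ E t ≤ D t)) → ∀ t, 0 ≤ t → E t = D t)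
    {a b B : ℝ} (ha : 0 ≤ a) (hab : a ≤ b) (hB0 : 0 ≤ B)
    (hB : ∀ s s', a ≤ s → s ≤ s' → s' ≤ b → c s - c s' ≤ B) : D a - D b ≤ B := by
  have hself : ∀ t, (D t ≤ D t ∧ D t ≤ c t) ∨ (c t ≤ D t ∧ D t ≤ D t) := fun t =>
    (le_total (D t) (c t)).imp (fun h => ⟨le_rfl, h⟩) fun h => ⟨h, le_rfl⟩
  -- Otherwise truncating `D` at level `l` from `a` on moves it towards `c`.
  have hlow : ∀ l, 0 ≤ l → l < D a → ∃ s, a ≤ s ∧ l < D s ∧ l < c s := by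
    intro l hl hla
    by_contra! hc
    have := hrig (fun t => if t < a then D t else min (D t) l) ?_ ?_ ?_ a ha
    · simp only [lt_irrefl, if_false] at this
      rw [min_eq_right hla.le] at this
      exact hla.ne this
    · intro s hs t ht hst
      have h1 := hD hs ht hst
      dsimp only
      split_ifs with h2 h3 h3
      · exact h1
      · linarith
      · exact (min_le_left _ _).trans h1
      · exact min_le_min h1 le_rfl
    · intro t ht
      split_ifs
      exacts [hD0 t ht, le_min (hD0 t ht) hl]
    · intro t ht
      split_ifs with h2
      · exact hself t
      · rcases le_or_gt (D t) l with h3 | h3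
        · rw [min_eq_left h3]; exact hself t
        · rw [min_eq_right h3.le]
          exact Or.inr ⟨hc t (not_lt.1 h2) h3, h3.le⟩
  -- Otherwise lifting `D` to level `l` up to `b` moves it towards `c`.
  have hupp : ∀ l, D b < l → ∃ s, 0 ≤ s ∧ s ≤ b ∧ D s < l ∧ c s < l := by
    intro l hlb
    by_contra! hc
    have := hrig (fun t => if t ≤ b then max (D t) l else D t) ?_ ?_ ?_ b (ha.trans hab)
    · simp only [le_refl, if_true] at this
      rw [max_eq_right hlb.le] at this
      exact hlb.ne' this
    · intro s hs t ht hst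
      have h1 := hD hs ht hst
      dsimp only
      split_ifs with h2 h3 h3
      · exact max_le_max h1 le_rfl
      · linarith
      · exact h1.trans (le_max_left _ _)
      · exact h1
    · intro t ht
      split_ifs
      exacts [(hD0 t ht).trans (le_max_left _ _), hD0 t ht]
    · intro t ht
      split_ifs with h2
      · rcases lt_or_ge (D t) l with h3 | h3
        · rw [max_eq_right h3.le]
          exact Or.inl ⟨h3.le, hc t ht h2 h3⟩
        · rw [max_eq_left h3]; exact hself t
      · exact hself t
  by_contra! hlt
  -- With levels `D a - ε` and `D b + ε`, monotonicity of `D` puts `s` before `s'`, and `c` falls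
  -- between them by more than `B + ε`.
  set ε := (D a - D b - B) / 3 with hε
  have hε0 : 0 < ε := by rw [hε]; linarith
  have hDb := hD0 b (ha.trans hab)
  obtain ⟨s, h1, h2, h3⟩ := hlow (D a - ε) (by linarith) (by linarith)
  obtain ⟨s', h4, h5, h6, h7⟩ := hupp (D b + ε) (by linarith)
  have hss' : s ≤ s' := by
    by_contra! h
    have := hD h4 (ha.trans h1) h.le
    linarith
  have := hB s s' h1 hss' h5
  linarith

/-- A decreasing function dominated by an integral is itself an integral. -/
theorem Antitone.exists_density {μ : Measure ℝ} (hμ : IsDiscount μ) {H h : ℝ → ℝ} (hH : Antitone H)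
    (hh : Integrable h μ) (hle : ∀ a b, a ≤ b → H a - H b ≤ ∫ t in Ioc a b, h t ∂μ)
    (hh0 : ∀ t, 0 ≤ h t) :
    ∃ g : ℝ → ℝ, Measurable g ∧ (∀ t, 0 ≤ g t) ∧ Integrable g μ ∧
      ∀ a b, a ≤ b → ∫ t in Ioc a b, g t ∂μ = H a - H b := by
  have := hμ.prob
  have htail := continuous_tail hμ hh
  have hrc : ∀ t, ContinuousWithinAt H (Ici t) t := by
    intro t
    have h1 : Tendsto (fun s => H t - (tail μ h t - tail μ h s)) (𝓝[Ici t] t) (𝓝 (H t)) := by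
      have : ContinuousWithinAt (fun s => H t - (tail μ h t - tail μ h s)) (Ici t) t := by fun_prop
      simpa [ContinuousWithinAt] using this
    refine tendsto_of_tendsto_of_tendsto_of_le_of_le' h1 tendsto_const_nhds ?_ ?_
    · filter_upwards [self_mem_nhdsWithin] with s hs
      rw [tail_sub_tail hh hs]
      linarith [hle t s hs]
    · filter_upwards [self_mem_nhdsWithin] with s hs using hH hs
  -- The fall of `H` and its slack against `∫ h` are both Stieltjes measures adding up to the
  -- measure with density `h`. So the former is absolutely continuous and has a Radon–Nikodym
  -- density.
  let S : StieltjesFunction ℝ :=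
    { toFun := fun t => -H t
      mono' := fun a b hab => neg_le_neg (hH hab)
      right_continuous' := fun t => (hrc t).neg }
  let K : StieltjesFunction ℝ :=
    { toFun := fun t => H t - tail μ h t
      mono' := fun a b hab => by
        have := hle a b hab
        rw [← tail_sub_tail hh hab] at this
        dsimp only
        linarith
      right_continuous' := fun t => (hrc t).sub htail.continuousWithinAt }
  have hfin : ∀ s, (∫⁻ t in s, ENNReal.ofReal (h t) ∂μ) ≠ ∞ := fun s =>
    (hh.integrableOn (s := s)).lintegral_lt_top.ne
  set ν := μ.withDensity fun t => ENNReal.ofReal (h t)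
  have : IsFiniteMeasure ν := isFiniteMeasure_withDensity (by simpa using hfin univ)
  have heq : S.measure + K.measure = ν := by
    refine (Measure.ext_of_Ioc _ _ fun a b hab => ?_).symm
    rw [Measure.add_apply, S.measure_Ioc, K.measure_Ioc, withDensity_apply _ measurableSet_Ioc,
      ← ofReal_integral_eq_lintegral_ofReal hh.integrableOn (ae_of_all _ hh0),
      ← ENNReal.ofReal_add (sub_nonneg.2 (S.mono hab.le)) (sub_nonneg.2 (K.mono hab.le)),
      ← tail_sub_tail hh hab.le]
    congr 1
    change _ = -H b - -H a + ((H b - tail μ h b) - (H a - tail μ h a))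
    ring
  have hSν : S.measure ≤ ν := by rw [← heq]; exact Measure.le_add_right le_rfl
  have hSμ : S.measure ≪ μ :=
    (Measure.absolutelyContinuous_of_le hSν).trans (withDensity_absolutelyContinuous _ _)
  have : IsFiniteMeasure S.measure := ⟨(hSν univ).trans_lt (measure_lt_top ν univ)⟩
  refine ⟨fun t => (S.measure.rnDeriv μ t).toReal, (Measure.measurable_rnDeriv _ _).ennreal_toReal,
    fun t => ENNReal.toReal_nonneg, Measure.integrable_toReal_rnDeriv, fun a b hab => ?_⟩
  rw [Measure.setIntegral_toReal_rnDeriv hSμ, measureReal_def, S.measure_Ioc,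
    ENNReal.toReal_ofReal (sub_nonneg.2 (S.mono hab))]
  change -H b - -H a = _
  ring

theorem eq_zero_of_abs_le_mul_measureReal_Ioi {μ : Measure ℝ} [IsProbabilityMeasure μ] {k C : ℝ}
    (h : ∀ t, 0 ≤ t → |k| ≤ C * μ.real (Ioi t)) : k = 0 := by
  by_contra hk
  have hk0 := abs_pos.2 hk
  have hC : 0 < C := by
    by_contra! hC
    have := h 0 le_rfl
    nlinarith [measureReal_nonneg (μ := μ) (s := Ioi (0 : ℝ))]
  obtain ⟨S, hS⟩ := exists_tail_lt (G := μ) (div_pos hk0 hC)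
  have h1 := hS (max S 0) (le_max_left _ _)
  have h2 := h (max S 0) (le_max_right _ _)
  rw [lt_div_iff₀ hC] at h1
  linarith

namespace Mechanism

variable {r : ℝ} {F₀ F₁ : ℝ → EReal} {u₀ u₁ us : ℝ} {x R : ℝ → ℝ}

/-- Undominated rewards equal continuation values. -/
theorem reward_eq_cont (hr : 0 < r) (hF : IsTechnology F₀ F₁ u₀ u₁ us)
    (hx : FeasibleFlow F₀ r u₀ x) (hR0 : ∀ t, 0 ≤ R t) (hRu : ∀ t, 0 ≤ t → R t ≤ u₀)
    (hm : (ofFlow x R hx.meas hx.nonneg).Undominated F₀ F₁ r)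
    (hfin : ∀ a, ∃ τ, a < τ ∧ F₁ (R τ) ≠ ⊥) {t : ℝ} (ht : 0 ≤ t) :
    R t = cont (discount r) x t := by
  have hμ := isDiscount_discount hr
  have := hμ.prob
  have hP := hF.frontierPair
  have hu0 := hF.u0_pos
  have hxi := hx.integrable
  set μ := discount r with hμdef
  set D : ℝ → ℝ := fun t => Real.exp (-r * t) * R t - tail μ x t with hDdef
  obtain ⟨hDa, hD0'⟩ := (ofFlow_ic hr hx.meas hx.nonneg hxi fun t _ => hR0 t).1 hm.1
  have hD0 : ∀ t, 0 ≤ t → 0 ≤ D t := fun t ht => sub_nonneg.2 (hD0' t ht)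
  have htail0 : ∀ t, 0 ≤ tail μ x t := fun t => integral_nonneg hx.nonneg
  have hDle : ∀ t, 0 ≤ t → D t ≤ u₀ * μ.real (Ioi t) := fun t ht => by
    rw [hμdef, discount_real_Ioi hr ht]
    have := mul_le_mul_of_nonneg_left (hRu t ht) (Real.exp_pos (-r * t)).le
    have := htail0 t
    simp only [hDdef]
    linarith
  -- Moving the excess `D` towards `c` means moving rewards towards the peak `u₁`, with the flow
  -- unchanged. This strictly improves the new payoff wherever rewards change, so undominatedness
  -- makes `D` rigid.
  set c : ℝ → ℝ := fun t => Real.exp (-r * t) * u₁ - tail μ x t with hcdef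
  have hrig : ∀ E : ℝ → ℝ, AntitoneOn E (Ici 0) → (∀ t, 0 ≤ t → 0 ≤ E t) →
      (∀ t, 0 ≤ t → (D t ≤ E t ∧ E t ≤ c t) ∨ (c t ≤ E t ∧ E t ≤ D t)) →
        ∀ t, 0 ≤ t → E t = D t := by
    intro E hEa hE0 hE
    set R' : ℝ → ℝ := fun t => (E t + tail μ x t) / Real.exp (-r * t) with hR'
    have hmul : ∀ t, Real.exp (-r * t) * R' t = E t + tail μ x t := fun t => by
      simp only [hR']; field_simp
    have hR'0 : ∀ t, 0 ≤ t → 0 ≤ R' t := fun t ht =>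
      div_nonneg (add_nonneg (hE0 t ht) (htail0 t)) (Real.exp_pos _).le
    have hbet : ∀ t, 0 ≤ t → (R t ≤ R' t ∧ R' t ≤ u₁) ∨ (u₁ ≤ R' t ∧ R' t ≤ R t) := by
      intro t ht
      have he := Real.exp_pos (-r * t)
      have h0 := hmul t
      rcases hE t ht with ⟨h1, h2⟩ | ⟨h1, h2⟩ <;> simp only [hDdef, hcdef] at h1 h2
      · exact Or.inl ⟨le_of_mul_le_mul_left (by linarith) he, le_of_mul_le_mul_left (by linarith) he⟩
      · exact Or.inr ⟨le_of_mul_le_mul_left (by linarith) he, le_of_mul_le_mul_left (by linarith) he⟩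
    have hlt : ∀ t, 0 ≤ t → R' t ≠ R t → F₁ (R t) < F₁ (R' t) ∧ F₁ (R' t) ≠ ⊤ := by
      intro t ht hne
      refine ⟨?_, hF.new.ne_top _ (hR'0 t ht)⟩
      rcases hbet t ht with ⟨h1, h2⟩ | ⟨h1, h2⟩
      · have h3 := lt_of_le_of_ne h1 hne.symm
        exact hF.new.lt_of_between (hR0 t) (hF.mem_eff_new ((hR0 t).trans_lt h3)
          (h2.trans hF.conflict.le)) (Or.inl ⟨h3, h2⟩)
      · have h3 := lt_of_le_of_ne h2 hne
        exact hF.new.lt_of_between (hR0 t) (hF.mem_eff_new_of_le h1 (h2.trans (hRu t ht)))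
          (Or.inr ⟨h1, h3⟩)
    have hic : (ofFlow x R' hx.meas hx.nonneg).IC r := by
      rw [ofFlow_ic hr hx.meas hx.nonneg hxi hR'0]
      simp only [hmul, ← hμdef, add_sub_cancel_right]
      exact ⟨hEa, fun t ht => by linarith [hE0 t ht]⟩
    intro t ht
    have heq := hm.payoffAt_eq hic (fun τ hτ => by
      rw [ofFlow_payoffAt hr hx hF.old (hR0 τ), ofFlow_payoffAt hr hx hF.old (hR'0 τ hτ)]
      refine add_le_add_right (EReal.coe_mul_le_coe_mul (Real.exp_pos _) ?_) _
      by_cases hne : R' τ = R τ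
      · rw [hne]
      · exact (hlt τ hτ hne).1.le) ht
    have hRR : R' t = R t := by
      by_contra hne
      rw [ofFlow_payoffAt hr hx hF.old (hR0 t), ofFlow_payoffAt hr hx hF.old (hR'0 t ht),
        add_comm, add_comm (a := ((∫ s in Iic t, realFrontier F₀ (x s) ∂μ : ℝ) : EReal))] at heq
      exact (EReal.coe_mul_lt_coe_mul (Real.exp_pos (-r * t)) (hlt t ht hne).1 (hlt t ht hne).2).ne'
        (EReal.eq_of_add_right_eq (EReal.coe_ne_bot _) (EReal.coe_ne_top _) heq)
    have := hmul t
    rw [hRR] at this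
    simp only [hDdef]
    linarith
  -- By rigidity the excess falls no faster than `c`, hence only where the flow is below `u₁`.
  set h : ℝ → ℝ := fun t => max (u₁ - x t) 0 with hhdef
  have hhm : Measurable h := (measurable_const.sub hx.meas).max measurable_const
  have hh0 : ∀ t, 0 ≤ h t := fun t => le_max_right _ _
  have hhu : ∀ t, h t ≤ u₀ := fun t =>
    max_le (by linarith [hx.nonneg t, hF.conflict]) hu0.le
  have hhi : Integrable h μ := integrable_of_bounds hhm hh0 hhu
  have hcsub : ∀ s s', 0 ≤ s → s ≤ s' → c s - c s' = ∫ t in Ioc s s', (u₁ - x t) ∂μ := by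
    intro s s' hs hss'
    rw [integral_sub (integrable_const _) hxi.integrableOn, ← tail_sub_tail hxi hss',
      ← tail_sub_tail (integrable_const u₁) hss', tail_const, tail_const, hμdef,
      discount_real_Ioi hr hs, discount_real_Ioi hr (hs.trans hss')]
    simp only [hcdef]
    ring
  have hDsub : ∀ a b, 0 ≤ a → a ≤ b → D a - D b ≤ ∫ t in Ioc a b, h t ∂μ := by
    intro a b ha hab
    refine hDa.sub_le_of_rigid hD0 hrig ha hab (integral_nonneg hh0) fun s s' hs hss' hs' => ?_
    rw [hcsub s s' (ha.trans hs) hss']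
    calc ∫ t in Ioc s s', (u₁ - x t) ∂μ ≤ ∫ t in Ioc s s', h t ∂μ :=
          integral_mono ((integrable_const _).sub hxi.integrableOn) hhi.integrableOn
            fun t => le_max_left _ _
      _ ≤ ∫ t in Ioc a b, h t ∂μ := setIntegral_mono_set hhi.integrableOn (ae_of_all _ hh0)
            (Ioc_subset_Ioc hs hs').eventuallyLE
  obtain ⟨g, hgm, hg0, hgi, hg⟩ := Antitone.exists_density (H := fun t => D (max t 0)) (h := h) hμ
    (fun a b hab => hDa (mem_Ici.2 (le_max_right _ _)) (mem_Ici.2 (le_max_right _ _))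
      (max_le_max hab le_rfl)) hhi (fun a b hab => by
        refine (hDsub _ _ (le_max_right _ _) (max_le_max hab le_rfl)).trans ?_
        refine setIntegral_mono_set hhi.integrableOn (ae_of_all _ hh0) (LE.le.eventuallyLE ?_)
        intro s hs
        have h1 := (le_max_left a 0).trans_lt hs.1
        have h2 := (le_max_right a 0).trans_lt hs.1
        exact ⟨h1, (le_max_iff.1 hs.2).resolve_right (not_le.2 h2)⟩) hh0
  have hgh : ∀ᵐ t ∂μ, g t ≤ h t := by
    have := hμ.ae_nonneg (hhi.sub hgi) fun a b ha hab => by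
      simp only [Pi.sub_apply]
      rw [integral_sub hhi.integrableOn hgi.integrableOn, hg a b hab, max_eq_left ha,
        max_eq_left (ha.trans hab)]
      linarith [hDsub a b ha hab]
    filter_upwards [this] with t ht
    simpa using ht
  -- The density satisfies `g ≤ h` only almost everywhere; the minimum makes `x + k ≤ max (x t) u₁ ≤
  -- u₀` hold at every time.
  set k : ℝ → ℝ := fun t => min (g t) (h t) with hk
  have hkm : Measurable k := hgm.min hhm
  have hk0 : ∀ t, 0 ≤ k t := fun t => le_min (hg0 t) (hh0 t)
  have hku : ∀ t, k t ≤ u₀ := fun t => (min_le_right _ _).trans (hhu t)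
  have hki : Integrable k μ := integrable_of_bounds hkm hk0 hku
  have hkg : k =ᵐ[μ] g := hgh.mono fun t ht => min_eq_left ht
  have hksub : ∀ a b, 0 ≤ a → a ≤ b → tail μ k a - tail μ k b = D a - D b := by
    intro a b ha hab
    rw [tail_sub_tail hki hab, integral_congr_ae (ae_restrict_of_ae hkg), hg a b hab,
      max_eq_left ha, max_eq_left (ha.trans hab)]
  have hktail : ∀ t, 0 ≤ tail μ k t ∧ tail μ k t ≤ u₀ * μ.real (Ioi t) := fun t => by
    refine ⟨integral_nonneg hk0, ?_⟩
    rw [mul_comm, ← tail_const]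
    exact tail_mono_of_ae hki (integrable_const _) (ae_of_all _ fun s _ => hku s)
  -- The two sides have equal increments, so they differ by a constant; both vanish at infinity.
  have hDk : ∀ t, 0 ≤ t → D t = tail μ k t := by
    intro t ht
    refine sub_eq_zero.1 (eq_zero_of_abs_le_mul_measureReal_Ioi (μ := μ) (C := u₀) fun s hs => ?_)
    have h1 : D t - tail μ k t = D s - tail μ k s := by
      rcases le_total t s with h | h
      · linarith [hksub t s ht h]
      · linarith [hksub s t hs h]
    rw [h1, abs_le]
    constructor <;> linarith [hD0 s hs, hDle s hs, hktail s]
  -- Paying the excess out as flow keeps the rewards and makes every incentive constraint bind.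
  set y : ℝ → ℝ := fun t => x t + k t with hy
  have hyu : ∀ t, y t ≤ u₀ := fun t => by
    have h1 : k t ≤ max (u₁ - x t) 0 := min_le_right _ _
    simp only [hy]
    rcases max_cases (u₁ - x t) 0 with h | h <;> linarith [hx.le t, hF.conflict]
  have hxy : ∀ t, x t ≤ y t := fun t => le_add_of_nonneg_right (hk0 t)
  have hymem : ∀ t, x t ∈ effDomain F₀ ∩ Icc 0 u₀ → y t ∈ effDomain F₀ ∩ Icc 0 u₀ := fun t ht => by
    rcases (ht.2.1.trans (hxy t)).eq_or_lt with h | h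
    · have : x t = y t := le_antisymm (hxy t) (h ▸ ht.2.1)
      rwa [← this]
    · exact hP.mem_old h (hyu t)
  have hym : Measurable y := hx.meas.add hkm
  have hy0 : ∀ t, 0 ≤ y t := fun t => (hx.nonneg t).trans (hxy t)
  obtain ⟨hyF, hyp⟩ := hx.of_lower_bound hμ hP hym hy0 hyu (z := fun _ => 0)
    (integrable_const 0) (ae_of_all _ fun t ht => ⟨hymem t ht, by
      rw [add_zero]; exact hP.mono_old.monotoneOn ht (hymem t ht) (hxy t)⟩)
  have hty : ∀ t, tail μ y t = tail μ x t + tail μ k t := fun t => tail_add_fun hxi hki t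
  have hic : (ofFlow y R hyF.meas hyF.nonneg).IC r := by
    have h1 : ∀ t, 0 ≤ t → Real.exp (-r * t) * R t - tail μ y t = 0 := fun t ht => by
      have := hDk t ht
      simp only [hDdef] at this
      rw [hty]
      linarith
    rw [ofFlow_ic hr hyF.meas hyF.nonneg hyF.integrable fun t _ => hR0 t]
    exact ⟨fun a ha b hb _ => by simp only [← hμdef, h1 a ha, h1 b hb, le_refl],
      fun t ht => by linarith [h1 t ht]⟩
  have hle : ∀ τ, ∫ t in Iic τ, realFrontier F₀ (x t) ∂μ ≤ ∫ t in Iic τ, realFrontier F₀ (y t) ∂μ :=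
    fun τ => by simpa using hyp τ
  have heq := fun τ (hτ : 0 ≤ τ) => hm.payoffAt_eq hic (fun τ _ => by
    rw [ofFlow_payoffAt hr hx hF.old (hR0 τ), ofFlow_payoffAt hr hyF hF.old (hR0 τ)]
    exact add_le_add_left (by exact_mod_cast hle τ) _) hτ
  -- With a finite reward payoff after `a`, equal payoffs mean equal old payoffs, and `f₀` is
  -- strictly increasing below `u₀`.
  have hkz : ∀ a : ℝ, ∀ᵐ t ∂μ, t ∈ Iic a → k t = 0 := by
    intro a
    obtain ⟨τ, hτ, hb⟩ := hfin (max a 0)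
    have h1 := heq τ ((le_max_right _ _).trans hτ.le)
    have hcoe := hF.new.coe_real ⟨hR0 τ, hb⟩
    rw [ofFlow_payoffAt hr hx hF.old (hR0 τ), ofFlow_payoffAt hr hyF hF.old (hR0 τ), ← hcoe,
      ← EReal.coe_mul] at h1
    have h2 := EReal.coe_eq_coe_iff.1
      (EReal.eq_of_add_right_eq (EReal.coe_ne_bot _) (EReal.coe_ne_top _) h1)
    have h3 : (fun t => realFrontier F₀ (x t)) ≤ᵐ[μ.restrict (Iic τ)]
        fun t => realFrontier F₀ (y t) := ae_restrict_of_ae <| by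
      filter_upwards [hx.ae_mem] with t ht
      exact hP.mono_old.monotoneOn ht (hymem t ht) (hxy t)
    have h4 := (integral_eq_iff_of_ae_le (hx.integ τ) (hyF.integ τ) h3).1 h2.symm
    filter_upwards [(ae_restrict_iff' measurableSet_Iic).1 h4, hx.ae_mem] with t h5 h6 h7
    have h8 := h5 (le_trans h7 ((le_max_left _ _).trans hτ.le))
    have h9 := hP.mono_old.injOn h6 (hymem t h6) h8
    simp only [hy] at h9
    linarith
  have hkz' : k =ᵐ[μ] fun _ => 0 := by
    filter_upwards [ae_all_iff.2 fun n : ℕ => hkz n] with s hs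
    obtain ⟨n, hn⟩ := exists_nat_ge s
    exact hs n hn
  have hDz : D t = 0 := by
    rw [hDk t ht, tail, integral_congr_ae (ae_restrict_of_ae hkz')]
    simp
  rw [cont, hμdef, discount_real_Ioi hr ht, eq_div_iff (Real.exp_pos _).ne', ← hμdef]
  simp only [hDdef] at hDz
  linarith

end Mechanism

/-! ### Optimal mechanisms have efficient flows -/

/-- Subtracting `φ` from its upper bound writes the integral as a difference of monotone functions
of `τ`. -/
theorem measurable_setIntegral_Iic {μ : Measure ℝ} {φ : ℝ → ℝ} {C : ℝ} [IsFiniteMeasure μ]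
    (hφ : ∀ τ, IntegrableOn φ (Iic τ) μ) (hC : ∀ᵐ t ∂μ, φ t ≤ C) :
    Measurable fun τ => ∫ t in Iic τ, φ t ∂μ := by
  have h1 : Monotone fun τ => ∫ t in Iic τ, (C - φ t) ∂μ := fun a b hab =>
    setIntegral_mono_set ((integrable_const C).sub (hφ b))
      (ae_restrict_of_ae (hC.mono fun t ht => sub_nonneg.2 ht)) (Iic_subset_Iic.2 hab).eventuallyLE
  have h2 : Monotone fun τ => μ.real (Iic τ) := fun a b hab =>
    measureReal_mono (Iic_subset_Iic.2 hab)
  have h3 : (fun τ => ∫ t in Iic τ, φ t ∂μ) =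
      fun τ => μ.real (Iic τ) * C - ∫ t in Iic τ, (C - φ t) ∂μ := by
    funext τ
    rw [integral_sub (integrable_const C) (hφ τ), setIntegral_const, smul_eq_mul]
    ring
  rw [h3]
  exact (h2.measurable.mul_const C).sub h1.measurable

namespace Mechanism

variable {r : ℝ} {F₀ F₁ : ℝ → EReal} {u₀ u₁ us : ℝ} {x R : ℝ → ℝ} {G : Measure ℝ}

theorem ofFlow_cont_ic (hr : 0 < r) (hx : FeasibleFlow F₀ r u₀ x) :
    (ofFlow x (cont (discount r) x) hx.meas hx.nonneg).IC r := by
  have hμ := isDiscount_discount hr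
  have := hμ.prob
  have h : ∀ t, 0 ≤ t → Real.exp (-r * t) * cont (discount r) x t = tail (discount r) x t :=
    fun t ht => by rw [← discount_real_Ioi hr ht, mul_cont hμ]
  rw [ofFlow_ic hr hx.meas hx.nonneg hx.integrable fun t _ => (hx.cont_mem hμ t).1]
  exact ⟨fun a ha b hb _ => by simp only [h a ha, h b hb, sub_self, le_refl],
    fun t ht => (h t ht).ge⟩

theorem ofFlow_cont_payoffAt (hr : 0 < r) (hF : IsTechnology F₀ F₁ u₀ u₁ us)
    (hx : FeasibleFlow F₀ r u₀ x) {τ : ℝ} (hτ : 0 ≤ τ) :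
    (ofFlow x (cont (discount r) x) hx.meas hx.nonneg).payoffAt F₀ F₁ r τ =
      (value (discount r) (realFrontier F₀) (realFrontier F₁) x τ : ℝ) := by
  have hμ := isDiscount_discount hr
  rw [ofFlow_payoffAt hr hx hF.old (hx.cont_mem hμ τ).1,
    ← hF.new.coe_real (hx.cont_mem_new hμ hF.frontierPair τ).1, ← EReal.coe_mul, ← EReal.coe_add,
    value, discount_real_Ioi hr hτ]

theorem efficient_of_undominated (hr : 0 < r) (hF : IsTechnology F₀ F₁ u₀ u₁ us)
    (hx : FeasibleFlow F₀ r u₀ x)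
    (hm : (ofFlow x (cont (discount r) x) hx.meas hx.nonneg).Undominated F₀ F₁ r) :
    Efficient (discount r) (realFrontier F₀) (realFrontier F₁) (effDomain F₀ ∩ Icc 0 u₀) u₀ x := by
  intro y hy hle τ hτ
  have := hm.payoffAt_eq (ofFlow_cont_ic hr hy) (fun τ hτ => by
    rw [ofFlow_cont_payoffAt hr hF hx hτ, ofFlow_cont_payoffAt hr hF hy hτ]
    exact_mod_cast hle τ hτ) hτ
  rw [ofFlow_cont_payoffAt hr hF hx hτ, ofFlow_cont_payoffAt hr hF hy hτ] at this
  exact_mod_cast this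

theorem measurable_value (hr : 0 < r) (hF : IsTechnology F₀ F₁ u₀ u₁ us)
    (hx : FeasibleFlow F₀ r u₀ x) :
    Measurable (value (discount r) (realFrontier F₀) (realFrontier F₁) x) := by
  have hμ := isDiscount_discount hr
  have := hμ.prob
  have hP := hF.frontierPair
  refine (measurable_setIntegral_Iic (C := realFrontier F₀ u₀) hx.integ ?_).add
    ((continuous_measureReal_Ioi hμ).measurable.mul
      (hF.new.measurable_real.comp (continuous_cont hμ hx.integrable).measurable))
  filter_upwards [hx.ae_mem] with t ht
  exact hP.mono_old.monotoneOn ht (hP.mem_old hP.u0_pos le_rfl) (hx.le t)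

theorem value_le (hr : 0 < r) (hF : IsTechnology F₀ F₁ u₀ u₁ us)
    (hx : FeasibleFlow F₀ r u₀ x) (τ : ℝ) :
    value (discount r) (realFrontier F₀) (realFrontier F₁) x τ ≤
      |realFrontier F₀ u₀| + |realFrontier F₁ u₁| := by
  have hμ := isDiscount_discount hr
  have := hμ.prob
  have hP := hF.frontierPair
  have h1 : ∫ t in Iic τ, realFrontier F₀ (x t) ∂(discount r) ≤
      ∫ t in Iic τ, |realFrontier F₀ u₀| ∂(discount r) := by
    refine integral_mono_ae (hx.integ τ) (integrable_const _) (ae_restrict_of_ae ?_)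
    filter_upwards [hx.ae_mem] with t ht
    exact (hP.mono_old.monotoneOn ht (hP.mem_old hP.u0_pos le_rfl) (hx.le t)).trans (le_abs_self _)
  rw [setIntegral_const, smul_eq_mul] at h1
  have h2 : realFrontier F₁ (cont (discount r) x τ) ≤ realFrontier F₁ u₁ := by
    have hmem := (hx.cont_mem_new hμ hP τ).1
    have := hF.new.le_peak hmem.1
    rw [← hF.new.coe_real hmem, ← hF.new.coe_real hF.new.peak_mem] at this
    exact_mod_cast this
  have h3 : (discount r).real (Iic τ) ≤ 1 := measureReal_le_one
  have h4 : (discount r).real (Ioi τ) ≤ 1 := measureReal_le_one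
  have h5 : 0 ≤ (discount r).real (Ioi τ) := measureReal_nonneg
  have h6 := mul_le_mul_of_nonneg_left (h2.trans (le_abs_self _)) h5
  have h7 := mul_le_of_le_one_left (abs_nonneg (realFrontier F₁ u₁)) h4
  have h8 := mul_le_of_le_one_left (abs_nonneg (realFrontier F₀ u₀)) h3
  unfold value
  linarith

/-- The optimal payoff is finite and `value` is bounded above, so `value` is `G`-integrable for `x`.
The comparison of means then becomes one of real integrals, from which the value of `x` cancels;
nothing is needed about integrability for `y`. -/
theorem meanEfficient_of_optimal (hr : 0 < r) (hF : IsTechnology F₀ F₁ u₀ u₁ us) (hG : IsTimeLaw G)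
    (hx : FeasibleFlow F₀ r u₀ x)
    (hm : (ofFlow x (cont (discount r) x) hx.meas hx.nonneg).Optimal F₀ F₁ r G) :
    MeanEfficient (discount r) G (realFrontier F₀) (realFrontier F₁) (effDomain F₀ ∩ Icc 0 u₀)
      u₀ x := by
  intro y hy k hk hle
  have := hG.prob
  have hpx : (ofFlow x (cont (discount r) x) hx.meas hx.nonneg).payoff F₀ F₁ r G =
      eintegral G fun τ => ((value (discount r) (realFrontier F₀) (realFrontier F₁) x τ : ℝ) : EReal) :=
    eintegral_congr (hG.ae_nonneg.mono fun τ hτ => ofFlow_cont_payoffAt hr hF hx hτ)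
  have hne := hm.payoff_ne_bot hr hF hG
  rw [hpx] at hne
  have hInt : Integrable (value (discount r) (realFrontier F₀) (realFrontier F₁) x) G := by
    simpa using (integrable_of_eintegral_ne_bot
      (measurable_value hr hF hx).coe_real_ereal.aemeasurable
      (integrable_const (|realFrontier F₀ u₀| + |realFrontier F₁ u₁|))
      (ae_of_all _ fun τ => by exact_mod_cast value_le hr hF hx τ) hne).2
  have h1 := hm.2.1 _ (ofFlow_cont_ic hr hy)
  rw [hpx, eintegral_coe hInt] at h1
  have h2 : ((∫ τ, (value (discount r) (realFrontier F₀) (realFrontier F₁) x τ + k τ) ∂G : ℝ) : EReal) ≤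
      (ofFlow y (cont (discount r) y) hy.meas hy.nonneg).payoff F₀ F₁ r G := by
    refine (eintegral_coe (hInt.add hk)).symm.trans_le ?_
    refine eintegral_mono (hG.ae_nonneg.mono fun τ hτ => ?_)
    rw [ofFlow_cont_payoffAt hr hF hy hτ]
    exact EReal.coe_le_coe_iff.2 (hle τ hτ)
  have h3 := EReal.coe_le_coe_iff.1 (h2.trans h1)
  rw [integral_add hInt hk] at h3
  linarith

end Mechanism

theorem exists_measureReal_Iio_lt {G : Measure ℝ} [IsProbabilityMeasure G]
    (h : ProbabilityTheory.cdf G 0 = 0) {δ : ℝ} (hδ : 0 < δ) : ∃ ε > 0, G.real (Iio ε) < δ := by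
  have h1 : Tendsto (ProbabilityTheory.cdf G) (𝓝[>] 0) (𝓝 0) := by
    have := (ProbabilityTheory.cdf G).right_continuous 0
    rw [ContinuousWithinAt, h] at this
    exact this.mono_left (nhdsWithin_mono _ Ioi_subset_Ici_self)
  obtain ⟨ε, h2, h3⟩ := ((h1.eventually (gt_mem_nhds hδ)).and self_mem_nhdsWithin).exists
  rw [ProbabilityTheory.cdf_eq_real] at h2
  exact ⟨ε, h3, (measureReal_mono Iio_subset_Iic_self).trans_lt h2⟩

theorem theorem3 (r : ℝ) (hr : 0 < r) (F₀ F₁ : ℝ → EReal) (u₀ u₁ us : ℝ)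
    (hF : IsTechnology F₀ F₁ u₀ u₁ us)
    (G : Measure ℝ) (hG : IsTimeLaw G) (hG0 : ProbabilityTheory.cdf G 0 = 0)
    (hGsupp : ¬ BddAbove G.support)
    (m : Mechanism) (hm : m.Optimal F₀ F₁ r G) :
    ∃ m' : Mechanism, m'.IsVersion m ∧ AntitoneOn m'.flow (Ici 0) ∧
      Tendsto m'.flow (𝓝[>] 0) (𝓝 u₀) ∧ Tendsto m'.flow atTop (𝓝 us) := by
  have := hG.prob
  obtain ⟨x, R, hx, hR0, hRu, hmx, hopt, hfin⟩ := hm.exists_ofFlow hr hF hG hGsupp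
  have hR : ∀ t, 0 ≤ t → R t = cont (discount r) x t := fun t ht =>
    Mechanism.reward_eq_cont hr hF hx hR0 hRu hopt.2.2 hfin ht
  have hopt' : (Mechanism.ofFlow x (cont (discount r) x) hx.meas hx.nonneg).Optimal F₀ F₁ r G :=
    Mechanism.Optimal.congr (m := Mechanism.ofFlow x R hx.meas hx.nonneg) hr hG
      (ae_of_all _ fun _ => rfl) (fun t ht => congrArg ENNReal.ofReal (hR t ht)) hopt
  obtain ⟨z, hz, hz0, hzx, hlim0, hlim⟩ := exists_antitone_version_of_efficient
    (isDiscount_discount hr) hF.frontierPair hx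
    (Mechanism.efficient_of_undominated hr hF hx hopt'.2.2)
    (Mechanism.meanEfficient_of_optimal hr hF hG hx hopt')
    (fun δ hδ => exists_measureReal_Iio_lt hG0 hδ) fun a => by
      rw [measureReal_def]
      exact ENNReal.toReal_pos ((Mechanism.measure_Ioi_pos hGsupp a).trans_le
        (measure_mono Ioi_subset_Ici_self)).ne' (measure_ne_top _ _)
  refine ⟨⟨z, m.reward, fun t _ => hz0 t, hz.measurable.aemeasurable⟩,
    ⟨(ae_discount_iff hr).1 (hzx.trans hmx.symm), fun _ _ => rfl⟩, hz.antitoneOn _, hlim0, hlim⟩
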